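/- Let $y_1\in(0,\infty)$, $y_2\in(0,1)$, $h'=\sqrt{y_1+y_2-y_1y_2}$, $a'=\bigl(\tfrac{1-h'}{1-y_2}\bigr)^2$, $b'=\bigl(\tfrac{1+h'}{1-y_2}\bigr)^2$, and let $\kappa,\beta_x,\beta_y$ be real constants ($\kappa=2$ for real and $\kappa=1$ for complex variables; $\beta_x,\beta_y$ are the fourth-moment constants of the two arrays defining the $F$-matrix). Let $F_{y_1,y_2}$ be the limiting spectral distribution of the $F$-matrix, with density $\frac{(1-y_2)\sqrt{(b'-x)(x-a')}}{2\pi x(y_1+y_2x)}$ on $[a',b']$ and, if $y_1>1$, a point mass $1-1/y_1$ at $0$; let $F_{y_2}$ be the Marchenko--Pastur law of ratio $y_2$. Let $\underline m$ and $\underline m_{y_2}$ be the Stieltjes transforms ($\int (x-z)^{-1}$) of $(1-y_1)\delta_0+y_1F_{y_1,y_2}$ and $(1-y_2)\delta_0+y_2F_{y_2}$, and put $m_0(z)=\underline m_{y_2}(-\underline m(z))$. Let $f_1,\dots,f_s$ be analytic in an open set $U\subset\mathbb C$ containing $[a',b']$. The limiting mean and covariance of the linear spectral statistics in the central limit theorem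 for $F$-matrices are given by $$\begin{aligned}\mu(f_j)={}&\frac{\kappa-1}{4\pi i}\oint f_j(z)\,d\log\frac{(1-y_2)m_0^2(z)+2m_0(z)+1-y_1}{(1-y_2)m_0^2(z)+2m_0(z)+1}+\frac{\kappa-1}{4\pi i}\oint f_j(z)\,d\log\Bigl(1-\frac{y_2m_0^2(z)}{(1+m_0(z))^2}\Bigr)\\&+\frac{\beta_xy_1}{2\pi i}\oint \frac{f_j(z)}{(1+m_0(z))^3}\,dm_0(z)+\frac{\beta_y}{4\pi i}\oint f_j(z)\Bigl(1-\frac{y_2m_0^2(z)}{(1+m_0(z))^2}\Bigr)d\log\Bigl(1-\frac{y_2m_0^2(z)}{(1+m_0(z))^2}\Bigr),\\ \upsilon(f_j,f_\ell)={}&-\frac{\kappa}{4\pi^2}\oint\!\oint\frac{f_j(z_1)f_\ell(z_2)}{(m_0(z_1)-m_0(z_2))^2}dm_0(z_1)dm_0(z_2)-\frac{\beta_xy_1+\beta_yy_2}{4\pi^2}\oint\!\oint\frac{f_j(z_1)f_\ell(z_2)\,dm_0(z_1)dm_0(z_2)}{(1+m_0(z_1))^2(1+m_0(z_2))^2}.\end{aligned}$$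 Here the contours are arbitrary closed piecewise $C^1$ curves in $U\setminus([a',b']\cup\{0\})$ that wind once, in the positive direction, around every point of $[a',b']$ and do not wind around any point outside $U$; in $\upsilon$ the $z_1$-contour and the $z_2$-contour are disjoint. Then, with $z(\xi)=\dfrac{1+h'^2+2h'\,\mathrm{Re}\,\xi}{(1-y_2)^2}$, the limits below exist, and for all $j,\ell\in\{1,\dots,s\}$ and all such contours $$\begin{aligned}\mu(f_j)={}&\lim_{\tau\downarrow1}\frac{\kappa-1}{4\pi i}\oint_{|\xi|=1}f_j(z(\xi))\Bigl[\frac1{\xi-\frac1\tau}+\frac1{\xi+\frac1\tau}-\frac2{\xi+\frac{y_2}{h'\tau}}\Bigr]d\xi\\&+\frac{\beta_xy_1(1-y_2)^2}{2\pi i\,h'^2}\oint_{|\xi|=1}\frac{f_j(z(\xi))}{(\xi+\frac{y_2}{h'})^3}\,d\xi+\frac{\beta_yy_2(1-y_2)}{2\pi i\,h'}\oint_{|\xi|=1}f_j(z(\xi))\frac{\xi+\frac1{h'}}{(\xi+\frac{y_2}{h'})^3}\,d\xi,\\ \upsilon(f_j,f_\ell)={}&-\lim_{\tau\downarrow1}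\frac{\kappa}{4\pi^2}\oint_{|\xi_1|=1}\oint_{|\xi_2|=1}\frac{f_j(z(\xi_1))f_\ell(z(\xi_2))}{(\xi_1-\tau\xi_2)^2}\,d\xi_2\,d\xi_1\\&-\frac{(\beta_xy_1+\beta_yy_2)(1-y_2)^2}{4\pi^2h'^2}\oint_{|\xi_1|=1}\frac{f_j(z(\xi_1))}{(\xi_1+\frac{y_2}{h'})^2}\,d\xi_1\oint_{|\xi_2|=1}\frac{f_\ell(z(\xi_2))}{(\xi_2+\frac{y_2}{h'})^2}\,d\xi_2.\end{aligned}$$ -/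

import Mathlib

open MeasureTheory Set Filter Topology Complex

noncomputable section

namespace FMatrixLSS

/-- `h' = √(y₁ + y₂ - y₁ y₂)`. -/
def hPrime (y₁ y₂ : ℝ) : ℝ := Real.sqrt (y₁ + y₂ - y₁ * y₂)

/-- Left edge `a' = ((1 - h') / (1 - y₂))²`. -/
def edgeA (y₁ y₂ : ℝ) : ℝ := ((1 - hPrime y₁ y₂) / (1 - y₂)) ^ 2

/-- Right edge `b' = ((1 + h') / (1 - y₂))²`. -/
def edgeB (y₁ y₂ : ℝ) : ℝ := ((1 + hPrime y₁ y₂) / (1 - y₂)) ^ 2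

/-- Density of the continuous part of the limiting spectral distribution of the F-matrix. -/
def fDensity (y₁ y₂ x : ℝ) : ℝ :=
  (Icc (edgeA y₁ y₂) (edgeB y₁ y₂)).indicator
    (fun x => (1 - y₂) * Real.sqrt ((edgeB y₁ y₂ - x) * (x - edgeA y₁ y₂)) /
      (2 * Real.pi * x * (y₁ + y₂ * x))) x

/-- The limiting spectral distribution `F_{y₁,y₂}` of the F-matrix: the density above, and a point
mass `1 - 1/y₁` at the origin if `y₁ > 1` (`ENNReal.ofReal` vanishes if `y₁ ≤ 1`). -/
def fLaw (y₁ y₂ : ℝ) : Measure ℝ :=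
  volume.withDensity (fun x => ENNReal.ofReal (fDensity y₁ y₂ x)) +
    ENNReal.ofReal (1 - 1 / y₁) • Measure.dirac 0

/-- Density of the continuous part of the Marchenko–Pastur law of ratio `y`. -/
def mpDensity (y x : ℝ) : ℝ :=
  (Icc ((1 - Real.sqrt y) ^ 2) ((1 + Real.sqrt y) ^ 2)).indicator
    (fun x => Real.sqrt (((1 + Real.sqrt y) ^ 2 - x) * (x - (1 - Real.sqrt y) ^ 2)) /
      (2 * Real.pi * x * y)) x

/-- The Marchenko–Pastur law `F_y`, the limiting spectral distribution of a sample covariance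
matrix with identity population covariance and dimension-to-sample-size ratio `y`. -/
def mpLaw (y : ℝ) : Measure ℝ :=
  volume.withDensity (fun x => ENNReal.ofReal (mpDensity y x)) +
    ENNReal.ofReal (1 - 1 / y) • Measure.dirac 0

/-- The Stieltjes transform of the (signed) companion distribution `(1 - y) δ₀ + y F`.
Here `resolventTransform F z = ∫ x, (x - z)⁻¹ ∂F` is the Stieltjes transform of `F`. -/
def companionStieltjes (y : ℝ) (F : Measure ℝ) (z : ℂ) : ℂ :=
  (1 - y) * resolventTransform (Measure.dirac (0 : ℝ)) z + y * resolventTransform F z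

/-- `m̲(z)`, the Stieltjes transform of `(1 - y₁) δ₀ + y₁ F_{y₁,y₂}`. -/
def mUnder (y₁ y₂ : ℝ) (z : ℂ) : ℂ := companionStieltjes y₁ (fLaw y₁ y₂) z

/-- `m₀(z) = m̲_{y₂}(-m̲(z))`, with `m̲_{y₂}` the Stieltjes transform of
`(1 - y₂) δ₀ + y₂ F_{y₂}`. -/
def m0 (y₁ y₂ : ℝ) (z : ℂ) : ℂ := companionStieltjes y₂ (mpLaw y₂) (-mUnder y₁ y₂ z)

/-- The contour integral `∮_γ g(z) dz` along `γ : [0, 1] → ℂ`. -/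
def contourIntegral (γ : ℝ → ℂ) (g : ℂ → ℂ) : ℂ :=
  ∫ t in (0 : ℝ)..1, g (γ t) * deriv γ t

/-- The winding number of the closed curve `γ` about a point `w` off the curve. -/
def windingNumber (γ : ℝ → ℂ) (w : ℂ) : ℂ :=
  (2 * Real.pi * I)⁻¹ * contourIntegral γ (fun z => (z - w)⁻¹)

/-- The interval `[a', b']`, the support of the continuous part of `F_{y₁,y₂}`, in `ℂ`. -/
def contSupport (y₁ y₂ : ℝ) : Set ℂ := Complex.ofReal '' Icc (edgeA y₁ y₂) (edgeB y₁ y₂)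

/-- `γ` is a positively oriented closed contour in `U` that encloses `[a', b']` (once), and whose
interior stays in `U`, i.e. it does not wind around any point outside `U`. It avoids `[a', b']`
and the origin, the points where `m̲` may fail to be defined. The parametrisation is `C¹` with
arbitrary, possibly zero, velocity, so every piecewise `C¹` contour (a rectangle, say) has such a
parametrisation. -/
structure IsContour (y₁ y₂ : ℝ) (U : Set ℂ) (γ : ℝ → ℂ) : Prop where
  contDiffOn : ContDiffOn ℝ 1 γ (Icc 0 1)
  closed : γ 0 = γ 1
  mem_domain : ∀ t ∈ Icc (0 : ℝ) 1, γ t ∈ U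
  off_support : ∀ t ∈ Icc (0 : ℝ) 1, γ t ∉ contSupport y₁ y₂
  ne_zero : ∀ t ∈ Icc (0 : ℝ) 1, γ t ≠ 0
  winding_support : ∀ w ∈ contSupport y₁ y₂, windingNumber γ w = 1
  winding_outside : ∀ w ∉ U, windingNumber γ w = 0

/-- The mean `μ(f)`, as contour integrals along `γ`; `∮ g d log Q` is `∮ g(z) Q'(z)/Q(z) dz`. -/
def limMean (κ βx βy y₁ y₂ : ℝ) (γ : ℝ → ℂ) (f : ℂ → ℂ) : ℂ :=
  (κ - 1) / (4 * Real.pi * I) * contourIntegral γ (fun z => f z *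
      logDeriv (fun w => ((1 - y₂) * m0 y₁ y₂ w ^ 2 + 2 * m0 y₁ y₂ w + 1 - y₁) /
        ((1 - y₂) * m0 y₁ y₂ w ^ 2 + 2 * m0 y₁ y₂ w + 1)) z)
  + (κ - 1) / (4 * Real.pi * I) * contourIntegral γ (fun z => f z *
      logDeriv (fun w => 1 - y₂ * m0 y₁ y₂ w ^ 2 / (1 + m0 y₁ y₂ w) ^ 2) z)
  + βx * y₁ / (2 * Real.pi * I) * contourIntegral γ (fun z =>
      f z / (1 + m0 y₁ y₂ z) ^ 3 * deriv (m0 y₁ y₂) z)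
  + βy / (4 * Real.pi * I) * contourIntegral γ (fun z =>
      f z * (1 - y₂ * m0 y₁ y₂ z ^ 2 / (1 + m0 y₁ y₂ z) ^ 2) *
      logDeriv (fun w => 1 - y₂ * m0 y₁ y₂ w ^ 2 / (1 + m0 y₁ y₂ w) ^ 2) z)

/-- The covariance `υ(f, g)`, as contour integrals with `z₁` on `γ₁` and `z₂` on `γ₂`. -/
def limCov (κ βx βy y₁ y₂ : ℝ) (γ₁ γ₂ : ℝ → ℂ) (f g : ℂ → ℂ) : ℂ :=
  -(κ / (4 * Real.pi ^ 2)) * contourIntegral γ₁ (fun z₁ => contourIntegral γ₂ (fun z₂ =>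
      f z₁ * g z₂ / (m0 y₁ y₂ z₁ - m0 y₁ y₂ z₂) ^ 2 *
        deriv (m0 y₁ y₂) z₁ * deriv (m0 y₁ y₂) z₂))
  - (βx * y₁ + βy * y₂) / (4 * Real.pi ^ 2) *
    contourIntegral γ₁ (fun z₁ => contourIntegral γ₂ (fun z₂ =>
      f z₁ * g z₂ / ((1 + m0 y₁ y₂ z₁) ^ 2 * (1 + m0 y₁ y₂ z₂) ^ 2) *
        deriv (m0 y₁ y₂) z₁ * deriv (m0 y₁ y₂) z₂))

/-- The real point `(1 + h'² + 2 h' Re ξ) / (1 - y₂)²`, as a complex number. -/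
def specPoint (y₁ y₂ : ℝ) (ξ : ℂ) : ℂ :=
  (((1 + hPrime y₁ y₂ ^ 2 + 2 * hPrime y₁ y₂ * ξ.re) / (1 - y₂) ^ 2 : ℝ) : ℂ)

end FMatrixLSS

end

/-!
Write `h = hPrime y₁ y₂`, and let `fJouk` be the map `ξ ↦ (1 + h ξ) (1 + h / ξ) / (1 - y₂)²`, an
affine image of the Joukowski map `ξ + ξ⁻¹`. It maps the unit circle onto `[a', b']`, where it
agrees with `specPoint`, and the exterior of the unit circle bijectively onto the complement of
`[a', b']`, with inverse `fInv`. In this coordinate `m0` is affine: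
`m0 (fJouk ξ) = -(1 + h ξ) / (1 - y₂)` for `1 < ‖ξ‖`, away from the zero of `fJouk` (`m0_fJouk`).
This comes from evaluating the two Stieltjes transforms. The substitution `x = c + 2 r cos θ` turns
an integral against a semicircle-type density into the integral of a rational function over the unit
circle (`integral_semicircle`), which partial fractions and Cauchy's formula evaluate. The results
are `companionStieltjes_mpLaw` and `mUnder_fJouk`.

All differential forms in the mean and the covariance thus become rational in `ξ`, and have no poles
outside the unit circle. The contours are arbitrary closed curves with prescribed winding numbers,
so Cauchy's integral formula is needed for such curves; it is proved by Dixon's argument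
(`Loop.cauchy_formula`). Writing the rational kernel as a superposition of Cauchy kernels with poles
on the curve `fJouk (‖ξ‖ = ρ)`, with `ρ > 1` close to `1`, and exchanging the two integrals, one
replaces an integral along a contour by an integral over the circle `‖ξ‖ = ρ`
(`Loop.Encloses.integral_eq_circleIntegral`).

On the other side, the integrals over the unit circle with a parameter `τ > 1` have integrands that
are holomorphic on the annulus `1 ≤ ‖ξ‖ ≤ ρ`, so they too are integrals over `‖ξ‖ = ρ`. There the
limiting integrands have no poles, and the limits `τ ↓ 1` follow by continuity (`tendsto_mean`,
`tendsto_cov`; in the covariance one variable is inverted first, which leaves `fJouk` unchanged).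
This proves the formula for the mean (`limMean_eq`).

In the covariance, the kernel `dm₀ dm₀ / (m₀(z₁) - m₀(z₂))²` equals `dξ dη / (ξ - η)²`, which is the
sum of `dz₁ dz₂ / (z₁ - z₂)²` and of `dξ dη / (ξ η - 1)²`. The first part integrates to zero: the
index of one contour is constant along the other, so Cauchy's formula reduces the double integral to
a multiple of the integral of the holomorphic function `f g'` along a contour, which vanishes. The
second part is regular outside the unit circle in both variables, and both contours can be replaced
by circles (`integral_cov`).
-/

noncomputable section

namespace FMatrixLSS

/-! ### Integrals along closed curves -/

/-- A closed `C¹` curve on `[0, 1]`, recorded as a position and a velocity that are both continuous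
on all of `ℝ`; outside of `[0, 1]` they carry no information beyond compactness of the range. -/
structure Loop where
  pt : ℝ → ℂ
  vel : ℝ → ℂ
  continuous_pt : Continuous pt
  continuous_vel : Continuous vel
  hasDerivAt : ∀ t ∈ Ioo (0 : ℝ) 1, HasDerivAt pt (vel t) t
  closed : pt 0 = pt 1
  isCompact_range : IsCompact (range pt)

namespace Loop

variable (Γ : Loop)

/-- The set of points on the curve. -/
def trace : Set ℂ := range Γ.pt

/-- The contour integral `∮_Γ g(z) dz`. -/
def integral (g : ℂ → ℂ) : ℂ := ∫ t in (0 : ℝ)..1, g (Γ.pt t) * Γ.vel t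

/-- The index of `z`, multiplied by `2πi`. -/
def index (z : ℂ) : ℂ := Γ.integral fun w => (w - z)⁻¹

variable {Γ}

lemma pt_mem (t : ℝ) : Γ.pt t ∈ Γ.trace := mem_range_self t

lemma isCompact_trace : IsCompact Γ.trace := Γ.isCompact_range

lemma isPreconnected_trace : IsPreconnected Γ.trace := isPreconnected_range Γ.continuous_pt

lemma isOpen_compl_trace : IsOpen Γ.traceᶜ := Γ.isCompact_trace.isClosed.isOpen_compl

lemma continuous_integrand {g : ℂ → ℂ} (hg : ContinuousOn g Γ.trace) :
    Continuous fun t => g (Γ.pt t) * Γ.vel t :=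
  (hg.comp_continuous Γ.continuous_pt pt_mem).mul Γ.continuous_vel

lemma integral_congr {f g : ℂ → ℂ} (h : ∀ z ∈ Γ.trace, f z = g z) :
    Γ.integral f = Γ.integral g := by
  simp only [integral, h _ (pt_mem _)]

lemma integral_add {f g : ℂ → ℂ} (hf : ContinuousOn f Γ.trace) (hg : ContinuousOn g Γ.trace) :
    Γ.integral (fun z => f z + g z) = Γ.integral f + Γ.integral g := by
  simp only [integral, add_mul]
  exact intervalIntegral.integral_add ((continuous_integrand hf).intervalIntegrable _ _)
    ((continuous_integrand hg).intervalIntegrable _ _)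

lemma integral_sub {f g : ℂ → ℂ} (hf : ContinuousOn f Γ.trace) (hg : ContinuousOn g Γ.trace) :
    Γ.integral (fun z => f z - g z) = Γ.integral f - Γ.integral g := by
  simp only [integral, sub_mul]
  exact intervalIntegral.integral_sub ((continuous_integrand hf).intervalIntegrable _ _)
    ((continuous_integrand hg).intervalIntegrable _ _)

lemma integral_const_mul (a : ℂ) (f : ℂ → ℂ) :
    Γ.integral (fun z => a * f z) = a * Γ.integral f := by
  simp only [integral, mul_assoc]
  exact intervalIntegral.integral_const_mul _ _

lemma integral_eq_zero_of_hasDerivAt {g G : ℂ → ℂ} (hg : ContinuousOn g Γ.trace)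
    (hG : ∀ z ∈ Γ.trace, HasDerivAt G (g z) z) : Γ.integral g = 0 := by
  have h := intervalIntegral.integral_eq_sub_of_hasDerivAt_of_le (f := G ∘ Γ.pt)
    (f' := fun t => g (Γ.pt t) * Γ.vel t) zero_le_one
    (fun t _ => ((hG _ (pt_mem t)).continuousAt.comp
      Γ.continuous_pt.continuousAt).continuousWithinAt)
    (fun t ht => (hG _ (pt_mem t)).comp_of_eq t (Γ.hasDerivAt t ht) rfl)
    ((continuous_integrand hg).intervalIntegrable _ _)
  rw [integral, h]
  simp [Γ.closed]

/-- The total variation bounds contour integrals. -/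
lemma norm_integral_le {g : ℂ → ℂ} {M : ℝ}
    (hM : ∀ z ∈ Γ.trace, ‖g z‖ ≤ M) :
    ‖Γ.integral g‖ ≤ M * ∫ t in (0 : ℝ)..1, ‖Γ.vel t‖ := by
  rw [← intervalIntegral.integral_const_mul]
  refine intervalIntegral.norm_integral_le_of_norm_le zero_le_one ?_
    ((Γ.continuous_vel.norm.const_mul M).intervalIntegrable _ _)
  refine .of_forall fun t _ => ?_
  rw [norm_mul]
  exact mul_le_mul_of_nonneg_right (hM _ (pt_mem t)) (norm_nonneg _)

/-- A contour integral depends holomorphically on a parameter, as soon as its integrand does and is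
bounded; the Cauchy estimate supplies the domination of the derivatives. -/
theorem hasDerivAt_integral {Φ : ℂ → ℂ → ℂ} {z₀ : ℂ} {r M : ℝ} (hr : 0 < r)
    (hcont : ∀ z ∈ Metric.ball z₀ r, ContinuousOn (Φ z) Γ.trace)
    (hdiff : ∀ w ∈ Γ.trace, DifferentiableOn ℂ (fun z => Φ z w) (Metric.ball z₀ r))
    (hM : ∀ z ∈ Metric.ball z₀ r, ∀ w ∈ Γ.trace, ‖Φ z w‖ ≤ M) :
    HasDerivAt (fun z => Γ.integral (Φ z)) (Γ.integral fun w => deriv (fun z => Φ z w) z₀) z₀ := by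
  have hda : ∀ w ∈ Γ.trace, ∀ z ∈ Metric.ball z₀ r,
      HasDerivAt (fun z => Φ z w) (deriv (fun z => Φ z w) z) z := fun w hw z hz =>
    ((hdiff w hw).differentiableAt (Metric.isOpen_ball.mem_nhds hz)).hasDerivAt
  have hz₀ : z₀ ∈ Metric.ball z₀ r := Metric.mem_ball_self hr
  have hsub : ∀ z ∈ Metric.ball z₀ (r / 2), Metric.closedBall z (r / 4) ⊆ Metric.ball z₀ r := by
    intro z hz x hx
    rw [Metric.mem_ball] at *
    rw [Metric.mem_closedBall] at hx
    linarith [dist_triangle x z z₀]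
  have hmeas : AEStronglyMeasurable (fun t => deriv (fun z => Φ z (Γ.pt t)) z₀ * Γ.vel t)
      (volume.restrict (uIoc (0 : ℝ) 1)) := by
    refine AEStronglyMeasurable.mul ?_ Γ.continuous_vel.aestronglyMeasurable
    -- the derivative is a limit of difference quotients along a sequence, each of them continuous
    set u : ℕ → ℂ := fun n => z₀ + ((r / 2 * (1 / ((n : ℝ) + 1)) : ℝ) : ℂ) with hu
    have hpos : ∀ n : ℕ, 0 < r / 2 * (1 / ((n : ℝ) + 1)) := fun n => by positivity
    have hlt : ∀ n : ℕ, r / 2 * (1 / ((n : ℝ) + 1)) < r := fun n => by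
      have : 1 / ((n : ℝ) + 1) ≤ 1 := by
        rw [div_le_one (by positivity)]; linarith [(Nat.cast_nonneg n : (0 : ℝ) ≤ n)]
      nlinarith
    have hball : ∀ n, u n ∈ Metric.ball z₀ r := fun n => by
      rw [Metric.mem_ball, dist_eq_norm, hu]
      simp only [add_sub_cancel_left, norm_real, Real.norm_eq_abs]
      rw [abs_of_pos (hpos n)]; exact hlt n
    have hne : ∀ n, u n ≠ z₀ := fun n h => by
      have : ((r / 2 * (1 / ((n : ℝ) + 1)) : ℝ) : ℂ) = 0 := by simpa [hu] using h
      exact (hpos n).ne' (ofReal_eq_zero.mp this)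
    have hlim : Tendsto u atTop (𝓝[≠] z₀) := by
      refine tendsto_nhdsWithin_iff.mpr ⟨?_, .of_forall hne⟩
      have h0 : Tendsto (fun n : ℕ => r / 2 * (1 / ((n : ℝ) + 1))) atTop (𝓝 0) := by
        simpa using tendsto_one_div_add_atTop_nhds_zero_nat.const_mul (r / 2)
      simpa [hu] using ((continuous_ofReal.tendsto 0).comp h0).const_add z₀
    refine aestronglyMeasurable_of_tendsto_ae atTop
      (f := fun n t => slope (fun z => Φ z (Γ.pt t)) z₀ (u n)) (fun n => ?_)
      (.of_forall fun t => (hasDerivAt_iff_tendsto_slope.mp (hda _ (pt_mem t) z₀ hz₀)).comp hlim)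
    refine Continuous.aestronglyMeasurable ?_
    simp only [slope_def_module]
    exact (((hcont _ (hball n)).comp_continuous Γ.continuous_pt pt_mem).sub
      ((hcont _ hz₀).comp_continuous Γ.continuous_pt pt_mem)).const_smul (u n - z₀)⁻¹
  refine (intervalIntegral.hasDerivAt_integral_of_dominated_loc_of_deriv_le
    (F := fun z t => Φ z (Γ.pt t) * Γ.vel t)
    (F' := fun z t => deriv (fun z => Φ z (Γ.pt t)) z * Γ.vel t)
    (s := Metric.ball z₀ (r / 2)) (bound := fun t => M / (r / 4) * ‖Γ.vel t‖)
    (Metric.ball_mem_nhds _ (by positivity)) ?_ ?_ hmeas ?_ ?_ ?_).2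
  · filter_upwards [Metric.ball_mem_nhds z₀ hr] with z hz
    exact (continuous_integrand (hcont z hz)).aestronglyMeasurable
  · exact (continuous_integrand (hcont z₀ hz₀)).intervalIntegrable _ _
  · refine .of_forall fun t _ z hz => ?_
    rw [norm_mul]
    refine mul_le_mul_of_nonneg_right ?_ (norm_nonneg _)
    refine norm_deriv_le_of_forall_mem_sphere_norm_le (by positivity) ?_ ?_
    · exact ((hdiff _ (pt_mem t)).mono (hsub z hz)).diffContOnCl_ball subset_rfl
    · exact fun w hw => hM _ (hsub z hz (Metric.sphere_subset_closedBall hw)) _ (pt_mem t)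
  · exact (Γ.continuous_vel.norm.const_mul _).intervalIntegrable _ _
  · refine .of_forall fun t _ z hz => ?_
    exact (hda _ (pt_mem t) z (Metric.ball_subset_ball (by linarith) hz)).mul_const _

/-! ### Cauchy transforms and the index -/

lemma continuousOn_inv_sub {z : ℂ} (hz : z ∉ Γ.trace) :
    ContinuousOn (fun w => (w - z)⁻¹) Γ.trace := by
  have : ContinuousOn (fun w => w - z) Γ.trace := by fun_prop
  exact this.inv₀ fun w hw h => hz (by rwa [← sub_eq_zero.mp h])

lemma continuousOn_inv_sub_sq {z : ℂ} (hz : z ∉ Γ.trace) :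
    ContinuousOn (fun w => ((w - z) ^ 2)⁻¹) Γ.trace := by
  simpa only [inv_pow] using (continuousOn_inv_sub hz).fun_pow 2

lemma hasDerivAt_cauchyTransform {F : ℂ → ℂ} (hF : ContinuousOn F Γ.trace) {z₀ : ℂ}
    (hz₀ : z₀ ∉ Γ.trace) :
    HasDerivAt (fun z => Γ.integral fun w => F w * (w - z)⁻¹)
      (Γ.integral fun w => F w * ((w - z₀) ^ 2)⁻¹) z₀ := by
  obtain ⟨r, hr, hball⟩ := Metric.isOpen_iff.mp isOpen_compl_trace z₀ hz₀
  have hfar : ∀ w ∈ Γ.trace, ∀ z ∈ Metric.ball z₀ (r / 2), r / 2 ≤ ‖w - z‖ := by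
    intro w hw z hz
    have h1 : r ≤ dist w z₀ := not_lt.mp fun h => hball h hw
    rw [Metric.mem_ball] at hz
    rw [← dist_eq_norm]
    linarith [dist_triangle w z z₀]
  have hne : ∀ w ∈ Γ.trace, ∀ z ∈ Metric.ball z₀ (r / 2), w - z ≠ 0 := fun w hw z hz h => by
    have := hfar w hw z hz
    rw [h, norm_zero] at this
    linarith
  obtain ⟨M, hM⟩ := isCompact_trace.exists_bound_of_continuousOn hF
  have hd : ∀ w ∈ Γ.trace, ∀ z ∈ Metric.ball z₀ (r / 2),
      HasDerivAt (fun z => F w * (w - z)⁻¹) (F w * ((w - z) ^ 2)⁻¹) z := by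
    intro w hw z hz
    have := (((hasDerivAt_id z).const_sub w).inv (hne w hw z hz)).const_mul (F w)
    simpa [div_eq_mul_inv] using this
  have := hasDerivAt_integral (Γ := Γ) (Φ := fun z w => F w * (w - z)⁻¹) (z₀ := z₀)
    (r := r / 2) (M := M * (r / 2)⁻¹) (by positivity) ?_ ?_ ?_
  · convert this using 1
    exact integral_congr fun w hw =>
      (hd w hw z₀ (Metric.mem_ball_self (by positivity))).deriv.symm
  · exact fun z hz => hF.mul (continuousOn_inv_sub fun h => hne _ h z hz (sub_self _))
  · exact fun w hw z hz => (hd w hw z hz).differentiableAt.differentiableWithinAt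
  · intro z hz w hw
    rw [norm_mul, norm_inv]
    have := hfar w hw z hz
    exact mul_le_mul (hM w hw) (by gcongr) (by positivity) ((norm_nonneg _).trans (hM w hw))

lemma tendsto_cauchyTransform {F : ℂ → ℂ} (hF : ContinuousOn F Γ.trace) :
    Tendsto (fun z => Γ.integral fun w => F w * (w - z)⁻¹) (cocompact ℂ) (𝓝 0) := by
  obtain ⟨M, hM⟩ := isCompact_trace.exists_bound_of_continuousOn hF
  obtain ⟨R, hR⟩ := isCompact_trace.isBounded.exists_norm_le
  set V := ∫ t in (0 : ℝ)..1, ‖Γ.vel t‖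
  have hnorm := tendsto_norm_cocompact_atTop (E := ℂ)
  have h0 : Tendsto (fun z : ℂ => M * (‖z‖ - R)⁻¹ * V) (cocompact ℂ) (𝓝 0) := by
    simpa [sub_eq_add_neg] using ((tendsto_inv_atTop_zero.comp
      (tendsto_atTop_add_const_right _ (-R) hnorm)).const_mul M).mul_const V
  refine squeeze_zero_norm' ?_ h0
  filter_upwards [hnorm.eventually_gt_atTop R] with z hz
  have hfar : ∀ w ∈ Γ.trace, ‖z‖ - R ≤ ‖w - z‖ := fun w hw => by
    have h1 := hR w hw
    have h2 := norm_sub_norm_le z w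
    rw [norm_sub_rev] at h2
    linarith
  have hzt : z ∉ Γ.trace := fun h => by linarith [hR z h]
  refine norm_integral_le fun w hw => ?_
  rw [norm_mul, norm_inv]
  have h3 := hfar w hw
  have h4 : 0 < ‖z‖ - R := sub_pos.mpr hz
  exact mul_le_mul (hM w hw) (by gcongr) (by positivity) ((norm_nonneg _).trans (hM w hw))

lemma integral_inv_sq_eq_zero {z : ℂ} (hz : z ∉ Γ.trace) :
    Γ.integral (fun w => ((w - z) ^ 2)⁻¹) = 0 := by
  refine integral_eq_zero_of_hasDerivAt (G := fun w => -(w - z)⁻¹) ?_ fun w hw => ?_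
  · exact continuousOn_inv_sub_sq hz
  · have hne : w - z ≠ 0 := fun h => hz (by rwa [← sub_eq_zero.mp h])
    simpa [div_eq_mul_inv] using (((hasDerivAt_id w).sub_const z).fun_inv hne).fun_neg

lemma hasDerivAt_index {z : ℂ} (hz : z ∉ Γ.trace) : HasDerivAt Γ.index 0 z := by
  have := hasDerivAt_cauchyTransform (Γ := Γ) (F := fun _ => 1) continuousOn_const hz
  simp only [one_mul] at this
  rwa [integral_inv_sq_eq_zero hz] at this

lemma index_eventually_eq {z : ℂ} (hz : z ∉ Γ.trace) : ∀ᶠ w in 𝓝 z, Γ.index w = Γ.index z := by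
  obtain ⟨r, hr, hball⟩ := Metric.isOpen_iff.mp isOpen_compl_trace z hz
  filter_upwards [Metric.ball_mem_nhds z hr] with w hw
  exact Metric.isOpen_ball.is_const_of_deriv_eq_zero (convex_ball z r).isPreconnected
    (fun x hx => (hasDerivAt_index (hball hx)).differentiableAt.differentiableWithinAt)
    (fun x hx => (hasDerivAt_index (hball hx)).deriv) hw (Metric.mem_ball_self hr)

lemma index_eq_of_isPreconnected {S : Set ℂ} (hS : IsPreconnected S) (hd : S ⊆ Γ.traceᶜ)
    {z w : ℂ} (hz : z ∈ S) (hw : w ∈ S) : Γ.index z = Γ.index w := by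
  have hlc : IsLocallyConstant fun x : S => Γ.index x :=
    (IsLocallyConstant.iff_eventually_eq _).mpr fun x =>
      continuous_subtype_val.continuousAt.eventually (index_eventually_eq (hd x.2))
  have := isPreconnected_iff_preconnectedSpace.mp hS
  exact hlc.apply_eq_of_preconnectedSpace ⟨z, hz⟩ ⟨w, hw⟩

lemma index_eq_zero_of_large : ∀ᶠ z in cocompact ℂ, Γ.index z = 0 := by
  obtain ⟨R, hR⟩ := (isCompact_trace (Γ := Γ)).isBounded.exists_norm_le
  filter_upwards [(tendsto_norm_cocompact_atTop (E := ℂ)).eventually_gt_atTop (max R 0)]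
    with z hz
  have hR' : R < ‖z‖ := (le_max_left _ _).trans_lt hz
  have hz0 : 0 < ‖z‖ := (le_max_right _ _).trans_lt hz
  -- the index is constant along the ray from `z` to infinity, where it tends to zero
  have hcont : Continuous fun t : ℝ => (t : ℂ) * z := by fun_prop
  have hconst : ∀ t : ℝ, 1 ≤ t → Γ.index (t * z) = Γ.index z := fun t ht => by
    refine index_eq_of_isPreconnected
      ((convex_Ici (1 : ℝ)).isPreconnected.image _ hcont.continuousOn) ?_
      (mem_image_of_mem _ ht) ⟨1, self_mem_Ici, by simp⟩
    rintro _ ⟨u, hu, rfl⟩ hmem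
    have h1 := hR _ hmem
    have hu' : (1 : ℝ) ≤ u := hu
    rw [norm_mul, norm_real, Real.norm_eq_abs, abs_of_pos (by linarith)] at h1
    nlinarith
  have hray : Tendsto (fun t : ℝ => (t : ℂ) * z) atTop (cocompact ℂ) := by
    rw [← Metric.cobounded_eq_cocompact, ← tendsto_norm_atTop_iff_cobounded]
    have : Tendsto (fun t : ℝ => |t| * ‖z‖) atTop atTop :=
      tendsto_abs_atTop_atTop.atTop_mul_const hz0
    simpa using this
  have h1 := (tendsto_cauchyTransform (Γ := Γ) (F := fun _ => 1) continuousOn_const).comp hray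
  simp only [one_mul] at h1
  refine tendsto_nhds_unique (Tendsto.congr' ?_ tendsto_const_nhds) h1
  filter_upwards [eventually_ge_atTop (1 : ℝ)] with t ht using (hconst t ht).symm

/-! ### Cauchy's theorem for cycles -/

/-- Difference quotients of a holomorphic function are bounded near a given point, uniformly with
respect to the other argument in a compact subset of the domain. -/
lemma exists_bound_dslope {U : Set ℂ} (hU : IsOpen U) {f : ℂ → ℂ} (hf : DifferentiableOn ℂ f U)
    {K : Set ℂ} (hK : IsCompact K) (hKU : K ⊆ U) {z₀ : ℂ} (hz₀ : z₀ ∈ U) :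
    ∃ r > 0, Metric.ball z₀ r ⊆ U ∧
      ∃ M, ∀ z ∈ Metric.ball z₀ r, ∀ w ∈ K, ‖dslope f w z‖ ≤ M := by
  obtain ⟨ρ, hρ, hball⟩ := Metric.isOpen_iff.mp hU z₀ hz₀
  have hcb : Metric.closedBall z₀ (ρ / 2) ⊆ U :=
    (Metric.closedBall_subset_ball (by linarith)).trans hball
  have hcomp := isCompact_closedBall z₀ (ρ / 2)
  obtain ⟨D, hD⟩ := hcomp.exists_bound_of_continuousOn ((hf.deriv hU).continuousOn.mono hcb)
  obtain ⟨A, hA⟩ := hcomp.exists_bound_of_continuousOn (hf.continuousOn.mono hcb)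
  obtain ⟨B, hB⟩ := hK.exists_bound_of_continuousOn (hf.continuousOn.mono hKU)
  refine ⟨ρ / 4, by positivity, (Metric.ball_subset_ball (by linarith)).trans hball,
    max D ((A + B) / (ρ / 4)), fun z hz w hw => ?_⟩
  have hz' : z ∈ Metric.closedBall z₀ (ρ / 2) :=
    Metric.ball_subset_closedBall (Metric.ball_subset_ball (by linarith) hz)
  have hdiff : ∀ x ∈ Metric.closedBall z₀ (ρ / 2), DifferentiableAt ℂ f x := fun x hx =>
    hf.differentiableAt (hU.mem_nhds (hcb hx))
  rcases eq_or_ne z w with rfl | hne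
  · rw [dslope_same]
    exact (hD z hz').trans (le_max_left _ _)
  rw [dslope_of_ne _ hne, slope_def_module, norm_smul, norm_inv]
  have hpos : 0 < ‖z - w‖ := norm_pos_iff.mpr (sub_ne_zero.mpr hne)
  by_cases hw' : w ∈ Metric.closedBall z₀ (ρ / 2)
  · refine le_trans ?_ (le_max_left _ _)
    have := (convex_closedBall z₀ (ρ / 2)).norm_image_sub_le_of_norm_deriv_le hdiff hD hw' hz'
    rw [inv_mul_le_iff₀ hpos, mul_comm]
    exact this
  · refine le_trans ?_ (le_max_right _ _)
    have hfar : ρ / 4 ≤ ‖z - w‖ := by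
      rw [Metric.mem_closedBall, not_le] at hw'
      rw [Metric.mem_ball] at hz
      rw [← dist_eq_norm]
      linarith [dist_triangle_left w z₀ z]
    have h1 : ‖f z - f w‖ ≤ A + B :=
      (norm_sub_le _ _).trans (add_le_add (hA z hz') (hB w hw))
    rw [div_eq_inv_mul]
    exact mul_le_mul (by gcongr) h1 (norm_nonneg _) (by positivity)

lemma continuousOn_dslope_snd {U : Set ℂ} (hU : IsOpen U) {f : ℂ → ℂ}
    (hf : DifferentiableOn ℂ f U) {z : ℂ} (hz : z ∈ U) :
    ContinuousOn (fun w => dslope f w z) U := by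
  have h := ((differentiableOn_dslope (hU.mem_nhds hz)).mpr hf).continuousOn
  refine h.congr fun w _ => ?_
  rcases eq_or_ne w z with rfl | hne
  · rfl
  · rw [dslope_of_ne _ hne, dslope_of_ne _ hne.symm, slope_comm]

/-- **Cauchy's integral formula** for a closed curve in `U` that does not wind around any point
outside `U`, by Dixon's argument: the integral of the difference quotient extends to an entire
function that vanishes at infinity. -/
theorem cauchy_formula {U : Set ℂ} (hU : IsOpen U) {f : ℂ → ℂ} (hf : DifferentiableOn ℂ f U)
    (hΓ : Γ.trace ⊆ U) (hind : ∀ w ∉ U, Γ.index w = 0) {z : ℂ} (hz : z ∈ U)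
    (hzΓ : z ∉ Γ.trace) :
    Γ.integral (fun w => f w * (w - z)⁻¹) = Γ.index z * f z := by
  have hfc : ContinuousOn f Γ.trace := hf.continuousOn.mono hΓ
  set h₁ : ℂ → ℂ := fun z => Γ.integral fun w => dslope f w z
  set h₂ : ℂ → ℂ := fun z => Γ.integral fun w => f w * (w - z)⁻¹
  have hrel : ∀ z ∉ Γ.trace, h₁ z = h₂ z - Γ.index z * f z := by
    intro z hz
    have : h₁ z = Γ.integral fun w => f w * (w - z)⁻¹ - f z * (w - z)⁻¹ := by
      refine integral_congr fun w hw => ?_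
      have hne : z ≠ w := fun h => hz (h ▸ hw)
      rw [dslope_of_ne _ hne, slope_def_field, ← sub_mul, ← div_eq_mul_inv,
        ← neg_sub (f w) (f z), ← neg_sub w z, neg_div_neg_eq]
    rw [this, integral_sub (hfc.fun_mul (continuousOn_inv_sub hz))
      (continuousOn_const.fun_mul (continuousOn_inv_sub hz)), integral_const_mul, mul_comm (f z)]
    rfl
  have hd₁ : ∀ z ∈ U, DifferentiableAt ℂ h₁ z := by
    intro z hz
    obtain ⟨r, hr, hball, M, hM⟩ := exists_bound_dslope hU hf isCompact_trace hΓ hz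
    exact (hasDerivAt_integral (Φ := fun z w => dslope f w z) hr
      (fun x hx => (continuousOn_dslope_snd hU hf (hball hx)).mono hΓ)
      (fun w hw => ((differentiableOn_dslope (hU.mem_nhds (hΓ hw))).mpr hf).mono hball)
      hM).differentiableAt
  classical
  set h : ℂ → ℂ := fun z => if z ∈ U then h₁ z else h₂ z
  have hV : ∀ z ∉ Γ.trace, Γ.index z = 0 → h z = h₂ z := by
    intro z hz hi
    by_cases hzU : z ∈ U
    · simp only [h, hzU, if_true, hrel z hz, hi, zero_mul, sub_zero]
    · simp only [h, hzU, if_false]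
  have hent : Differentiable ℂ h := by
    intro z
    by_cases hzU : z ∈ U
    · refine (hd₁ z hzU).congr_of_eventuallyEq ?_
      filter_upwards [hU.mem_nhds hzU] with x hx
      simp only [h, hx, if_true]
    · have hzt : z ∉ Γ.trace := fun hm => hzU (hΓ hm)
      refine (hasDerivAt_cauchyTransform hfc hzt).differentiableAt.congr_of_eventuallyEq ?_
      filter_upwards [isOpen_compl_trace.mem_nhds hzt, index_eventually_eq hzt] with x hx hx'
      exact hV x hx (hx'.trans (hind z hzU))
  have hlim : Tendsto h (cocompact ℂ) (𝓝 0) := by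
    refine (tendsto_cauchyTransform hfc).congr' ?_
    filter_upwards [index_eq_zero_of_large (Γ := Γ), isCompact_trace.compl_mem_cocompact]
      with x hx hx'
    exact (hV x hx' hx).symm
  have h0 := hent.apply_eq_of_tendsto_cocompact z hlim
  simp only [h, hz, if_true] at h0
  rw [hrel z hzΓ, sub_eq_zero] at h0
  exact h0

/-- **Cauchy's theorem** for a closed curve that does not wind around any point outside `U`. -/
theorem integral_eq_zero {U : Set ℂ} (hU : IsOpen U) {f : ℂ → ℂ} (hf : DifferentiableOn ℂ f U)
    (hΓ : Γ.trace ⊆ U) (hind : ∀ w ∉ U, Γ.index w = 0) {z : ℂ} (hz : z ∈ U)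
    (hzΓ : z ∉ Γ.trace) : Γ.integral f = 0 := by
  have h := cauchy_formula hU (f := fun w => (w - z) * f w)
    ((differentiableOn_id.sub_const z).mul hf) hΓ hind hz hzΓ
  rw [sub_self, zero_mul, mul_zero] at h
  rw [← h]
  refine integral_congr fun w hw => ?_
  have hne : w - z ≠ 0 := fun h => hzΓ (by rwa [← sub_eq_zero.mp h])
  field_simp

/-- Cauchy's integral formula for the derivative. -/
theorem cauchy_formula_deriv {U : Set ℂ} (hU : IsOpen U) {f : ℂ → ℂ}
    (hf : DifferentiableOn ℂ f U) (hΓ : Γ.trace ⊆ U) (hind : ∀ w ∉ U, Γ.index w = 0) {z : ℂ}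
    (hz : z ∈ U) (hzΓ : z ∉ Γ.trace) :
    Γ.integral (fun w => f w * ((w - z) ^ 2)⁻¹) = Γ.index z * deriv f z := by
  have h := cauchy_formula hU ((differentiableOn_dslope (hU.mem_nhds hz)).mpr hf) hΓ hind hz hzΓ
  rw [dslope_same] at h
  have hfc : ContinuousOn f Γ.trace := hf.continuousOn.mono hΓ
  have hc2 := continuousOn_inv_sub_sq hzΓ
  rw [← h, ← sub_zero (Γ.integral _), ← mul_zero (f z), ← integral_inv_sq_eq_zero hzΓ,
    ← integral_const_mul, ← integral_sub (hfc.fun_mul hc2) (continuousOn_const.fun_mul hc2)]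
  refine integral_congr fun w hw => ?_
  have hne : w - z ≠ 0 := fun h => hzΓ (by rwa [← sub_eq_zero.mp h])
  rw [dslope_of_ne _ (sub_ne_zero.mp hne), slope_def_field]
  field_simp

end Loop

end FMatrixLSS

namespace FMatrixLSS

/-! ### The Joukowski map -/

/-- The affinely normalised Joukowski map `ξ ↦ c + r (ξ + 1/ξ)`. It maps the unit circle onto the
interval `[c - 2r, c + 2r]` and `{|ξ| > 1}` conformally onto the complement of that interval. -/
def jouk (c r : ℝ) (ξ : ℂ) : ℂ := c + r * (ξ + ξ⁻¹)

variable {c r : ℝ}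

lemma jouk_inv (ξ : ℂ) : jouk c r ξ⁻¹ = jouk c r ξ := by
  simp [jouk, add_comm]

lemma jouk_sub {ξ η : ℂ} (hξ : ξ ≠ 0) (hη : η ≠ 0) :
    jouk c r ξ - jouk c r η = r * (ξ - η) * (1 - (ξ * η)⁻¹) := by
  simp only [jouk]
  field_simp
  ring

lemma ne_zero_of_one_lt_norm {ξ : ℂ} (h : 1 < ‖ξ‖) : ξ ≠ 0 := by
  rintro rfl
  norm_num at h

lemma ne_zero_of_norm_eq_one {ξ : ℂ} (h : ‖ξ‖ = 1) : ξ ≠ 0 := by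
  rintro rfl
  norm_num at h

lemma ne_of_norm_lt {ξ η : ℂ} (h : ‖ξ‖ < ‖η‖) : η - ξ ≠ 0 := by
  intro h0
  rw [sub_eq_zero.mp h0] at h
  exact lt_irrefl _ h

lemma eq_or_eq_inv_of_jouk_eq (hr : r ≠ 0) {ξ η : ℂ} (hξ : ξ ≠ 0) (hη : η ≠ 0)
    (h : jouk c r ξ = jouk c r η) : ξ = η ∨ ξ = η⁻¹ := by
  have h0 := jouk_sub (c := c) (r := r) hξ hη
  rw [h, sub_self, eq_comm, mul_eq_zero, mul_eq_zero] at h0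
  rcases h0 with (h0 | h0) | h0
  · exact absurd (ofReal_eq_zero.mp h0) hr
  · exact .inl (sub_eq_zero.mp h0)
  · refine .inr (eq_inv_of_mul_eq_one_left ?_)
    rw [sub_eq_zero, eq_comm, inv_eq_one] at h0
    exact h0

lemma jouk_injOn (hr : r ≠ 0) {ξ η : ℂ} (hξ : 1 < ‖ξ‖) (hη : 1 ≤ ‖η‖)
    (h : jouk c r ξ = jouk c r η) : ξ = η := by
  have hη0 : η ≠ 0 := fun h0 => by rw [h0, norm_zero] at hη; linarith
  refine (eq_or_eq_inv_of_jouk_eq hr (ne_zero_of_one_lt_norm hξ) hη0 h).resolve_right fun h1 => ?_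
  rw [h1, norm_inv] at hξ
  exact absurd (inv_le_one_of_one_le₀ hη) (not_le.mpr hξ)

lemma jouk_of_norm_eq_one {ξ : ℂ} (h : ‖ξ‖ = 1) : jouk c r ξ = ((c + 2 * r * ξ.re : ℝ) : ℂ) := by
  have hinv : ξ⁻¹ = (starRingEnd ℂ) ξ := by
    rw [inv_def, normSq_eq_norm_sq, h]; simp
  rw [jouk, hinv, add_conj]
  push_cast
  ring

lemma exists_norm_eq_one_of_mem_Icc (hr : 0 < r) {x : ℝ} (hx : x ∈ Icc (c - 2 * r) (c + 2 * r)) :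
    ∃ ξ : ℂ, ‖ξ‖ = 1 ∧ jouk c r ξ = x := by
  set u := (x - c) / (2 * r)
  have hu : x = c + 2 * r * u := by simp only [u]; field_simp; ring
  have h1 : -1 ≤ u := by rw [le_div_iff₀ (by positivity)]; linarith [hx.1]
  have h2 : u ≤ 1 := by rw [div_le_iff₀ (by positivity)]; linarith [hx.2]
  refine ⟨exp (Real.arccos u * I), norm_exp_ofReal_mul_I _, ?_⟩
  rw [jouk_of_norm_eq_one (norm_exp_ofReal_mul_I _), exp_ofReal_mul_I_re, Real.cos_arccos h1 h2, hu]

lemma jouk_notMem (hr : 0 < r) {ξ : ℂ} (hξ : 1 < ‖ξ‖) :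
    jouk c r ξ ∉ Complex.ofReal '' Icc (c - 2 * r) (c + 2 * r) := by
  rintro ⟨x, hx, h⟩
  obtain ⟨η, hη, hηx⟩ := exists_norm_eq_one_of_mem_Icc hr hx
  have := jouk_injOn hr.ne' hξ hη.ge (h.symm.trans hηx.symm)
  rw [this, hη] at hξ
  exact lt_irrefl _ hξ

lemma exists_jouk_eq (hr : 0 < r) {z : ℂ}
    (hz : z ∉ Complex.ofReal '' Icc (c - 2 * r) (c + 2 * r)) :
    ∃ ξ : ℂ, 1 < ‖ξ‖ ∧ jouk c r ξ = z := by
  have hr' : (r : ℂ) ≠ 0 := ofReal_ne_zero.mpr hr.ne'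
  -- a root `ξ` of `ξ² - 2uξ + 1 = 0`; the other one is `1/ξ`
  set u : ℂ := (z - c) / (2 * r)
  obtain ⟨v, hv⟩ := IsAlgClosed.exists_eq_mul_self (u ^ 2 - 1)
  have hprod : (u + v) * (u - v) = 1 := by linear_combination hv
  have h0 : u + v ≠ 0 := left_ne_zero_of_mul_eq_one hprod
  have hinv : (u + v)⁻¹ = u - v := inv_eq_of_mul_eq_one_right hprod
  have hj : jouk c r (u + v) = z := by
    rw [jouk, hinv]; simp only [u]; field_simp; ring
  rcases lt_trichotomy 1 ‖u + v‖ with h | h | h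
  · exact ⟨_, h, hj⟩
  · refine absurd ⟨c + 2 * r * (u + v).re, ?_, ?_⟩ hz
    · have := abs_le.mp ((abs_re_le_norm (u + v)).trans h.ge)
      constructor <;> nlinarith
    · rw [← jouk_of_norm_eq_one h.symm, hj]
  · refine ⟨(u + v)⁻¹, ?_, by rw [jouk_inv, hj]⟩
    rw [norm_inv]
    exact (one_lt_inv₀ (norm_pos_iff.mpr h0)).mpr h

lemma hasDerivAt_jouk {ξ : ℂ} (hξ : ξ ≠ 0) : HasDerivAt (jouk c r) (r * (1 - (ξ ^ 2)⁻¹)) ξ := by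
  have h : jouk c r = fun ξ => (c : ℂ) + r * (ξ + ξ⁻¹) := rfl
  rw [h]
  simpa [sub_eq_add_neg] using
    (((hasDerivAt_id ξ).add (hasDerivAt_inv hξ)).const_mul (r : ℂ)).const_add (c : ℂ)

/-! ### Circle integrals -/

/-- Inversion `η = 1/u` in a circle integral. -/
lemma circleIntegral_inversion (F : ℂ → ℂ) (ρ : ℝ) (hρ : ρ ≠ 0) :
    (∮ η in C(0, ρ), F η) = ∮ u in C(0, ρ⁻¹), F u⁻¹ * (u ^ 2)⁻¹ := by
  simp only [circleIntegral, deriv_circleMap, smul_eq_mul]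
  have hinv : ∀ θ : ℝ, (circleMap 0 ρ⁻¹ θ)⁻¹ = circleMap 0 ρ (-θ) := fun θ => by
    simp [circleMap, ← Complex.exp_neg, mul_comm]
  have hne : ∀ θ : ℝ, circleMap 0 ρ θ ≠ 0 := fun θ => by
    simp [circleMap, hρ]
  have hper : Function.Periodic (fun θ : ℝ => circleMap 0 ρ θ * I * F (circleMap 0 ρ θ))
      (2 * Real.pi) := fun θ => by simp only [periodic_circleMap 0 ρ θ]
  have h1 : ∀ θ : ℝ, circleMap 0 ρ⁻¹ θ * I * (F (circleMap 0 ρ⁻¹ θ)⁻¹ *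
      (circleMap 0 ρ⁻¹ θ ^ 2)⁻¹) = circleMap 0 ρ (-θ) * I * F (circleMap 0 ρ (-θ)) := fun θ => by
    have : circleMap 0 ρ⁻¹ θ = (circleMap 0 ρ (-θ))⁻¹ := by rw [← hinv, inv_inv]
    rw [this, inv_inv]
    have := hne (-θ)
    field_simp
  simp only [h1]
  rw [intervalIntegral.integral_comp_neg
    (fun θ : ℝ => circleMap 0 ρ θ * I * F (circleMap 0 ρ θ))]
  have := hper.intervalIntegral_add_eq (-(2 * Real.pi)) 0
  simpa using this.symm

/-- The Cauchy integral formula on a circle around the origin, for functions that are holomorphic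
on a slightly larger disc. -/
lemma circleIntegral_cauchy {ρ R : ℝ} (hρR : ρ < R) {F : ℂ → ℂ}
    (hF : DifferentiableOn ℂ F (Metric.ball 0 R)) {w : ℂ} (hw : ‖w‖ < ρ) :
    (∮ u in C(0, ρ), (u - w)⁻¹ * F u) = 2 * Real.pi * I * F w := by
  have := (hF.mono (Metric.closedBall_subset_ball hρR)).circleIntegral_sub_inv_smul (w := w)
    (by simpa using hw)
  simpa using this

lemma circleIntegral_eq_zero_of_ball {ρ R : ℝ} (h0 : 0 ≤ ρ) (hρR : ρ < R) {F : ℂ → ℂ}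
    (hF : DifferentiableOn ℂ F (Metric.ball 0 R)) : (∮ u in C(0, ρ), F u) = 0 :=
  ((hF.mono (Metric.closedBall_subset_ball hρR)).diffContOnCl_ball subset_rfl
    ).circleIntegral_eq_zero h0

/-- Substituting `x = c + 2r cos θ`, an integral against the semicircle profile on
`[c - 2r, c + 2r]` becomes an integral over the unit circle. -/
theorem integral_semicircle (hr : 0 < r) {g W : ℂ → ℂ}
    (hWc : ContinuousOn W (Metric.sphere 0 1))
    (hWs : ∀ ζ : ℂ, ‖ζ‖ = 1 → W ζ⁻¹ = W ζ)
    (hgW : ∀ ζ : ℂ, ‖ζ‖ = 1 → ζ ^ 2 ≠ 1 → -(r : ℂ) ^ 2 * (ζ - ζ⁻¹) ^ 2 * g (jouk c r ζ) = W ζ) :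
    IntegrableOn (fun x : ℝ =>
        (Real.sqrt ((c + 2 * r - x) * (x - (c - 2 * r))) : ℂ) * g x)
      (Ioo (c - 2 * r) (c + 2 * r)) ∧
    ∫ x in Ioo (c - 2 * r) (c + 2 * r),
        (Real.sqrt ((c + 2 * r - x) * (x - (c - 2 * r))) : ℂ) * g x
      = (2 * I)⁻¹ * ∮ ζ in C(0, 1), ζ⁻¹ * W ζ := by
  set φ : ℝ → ℝ := fun θ => c + 2 * r * Real.cos θ with hφ
  set T : ℝ → ℂ := fun θ => W (circleMap 0 1 θ) with hT
  have hnorm : ∀ θ : ℝ, ‖circleMap 0 1 θ‖ = 1 := fun θ => by simp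
  have hTc : Continuous T :=
    hWc.comp_continuous (continuous_circleMap 0 1) fun θ => by simp
  have hd : ∀ θ ∈ Ioo 0 Real.pi, HasDerivWithinAt φ (-(2 * r * Real.sin θ)) (Ioo 0 Real.pi) θ :=
    fun θ _ => by
      have := ((Real.hasDerivAt_cos θ).const_mul (2 * r)).const_add c
      rw [mul_neg] at this
      exact this.hasDerivWithinAt
  have hinj : InjOn φ (Ioo 0 Real.pi) := fun x hx y hy h =>
    Real.injOn_cos (Ioo_subset_Icc_self hx) (Ioo_subset_Icc_self hy)
      (mul_left_cancel₀ (by positivity : (2 * r : ℝ) ≠ 0) (add_left_cancel h))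
  have himg : φ '' Ioo 0 Real.pi = Ioo (c - 2 * r) (c + 2 * r) := by
    ext x
    constructor
    · rintro ⟨θ, hθ, rfl⟩
      have h1 : Real.cos θ < 1 := by
        simpa using Real.cos_lt_cos_of_nonneg_of_le_pi le_rfl hθ.2.le hθ.1
      have h2 : -1 < Real.cos θ := by
        simpa using Real.cos_lt_cos_of_nonneg_of_le_pi hθ.1.le le_rfl hθ.2
      constructor <;> simp only [hφ] <;> nlinarith
    · intro hx
      have h1 : -1 < (x - c) / (2 * r) := by rw [lt_div_iff₀ (by positivity)]; linarith [hx.1]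
      have h2 : (x - c) / (2 * r) < 1 := by rw [div_lt_iff₀ (by positivity)]; linarith [hx.2]
      refine ⟨Real.arccos ((x - c) / (2 * r)),
        ⟨Real.arccos_pos.mpr h2, (Real.arccos_lt_pi.mpr h1)⟩, ?_⟩
      simp only [hφ]
      rw [Real.cos_arccos h1.le h2.le]
      field_simp
      ring
  have hpt : ∀ θ ∈ Ioo 0 Real.pi, |(-(2 * r * Real.sin θ))| •
      ((Real.sqrt ((c + 2 * r - φ θ) * (φ θ - (c - 2 * r))) : ℂ) * g (φ θ)) = T θ := by
    intro θ hθ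
    have hs : 0 < Real.sin θ := Real.sin_pos_of_mem_Ioo hθ
    have hsq : (c + 2 * r - φ θ) * (φ θ - (c - 2 * r)) = (2 * r * Real.sin θ) ^ 2 := by
      simp only [hφ]
      linear_combination (-4 * r ^ 2) * Real.sin_sq_add_cos_sq θ
    rw [hsq, Real.sqrt_sq (by positivity), abs_neg, abs_of_pos (by positivity)]
    set ζ := circleMap 0 1 θ with hζ
    have hre : ζ.re = Real.cos θ := by
      simp [hζ, circleMap, exp_ofReal_mul_I_re]
    have hζs : ζ - ζ⁻¹ = 2 * I * Real.sin θ := by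
      have : ζ⁻¹ = (starRingEnd ℂ) ζ := by
        rw [inv_def, normSq_eq_norm_sq, hnorm]; simp
      rw [this, sub_conj]
      simp [hζ, circleMap, exp_ofReal_mul_I_im]
      ring
    have hne : ζ ^ 2 ≠ 1 := fun h => by
      have h0 := ne_zero_of_norm_eq_one (hnorm θ)
      have : ζ - ζ⁻¹ = 0 := by
        field_simp
        rw [h]; ring
      rw [hζs] at this
      simp at this
      exact hs.ne' (by exact_mod_cast this)
    have := hgW ζ (hnorm θ) hne
    rw [jouk_of_norm_eq_one (hnorm θ), hre, hζs] at this
    simp only [hT, ← hζ, ← this, hφ, real_smul]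
    push_cast
    linear_combination (4 * (r : ℂ) ^ 2 * Complex.sin θ ^ 2 *
      g (c + 2 * r * Complex.cos θ)) * I_sq
  have hcongr := MeasureTheory.setIntegral_congr_fun (μ := volume) measurableSet_Ioo hpt
  constructor
  · rw [← himg, integrableOn_image_iff_integrableOn_abs_deriv_smul measurableSet_Ioo hd hinj]
    exact ((hTc.integrableOn_Icc (a := 0) (b := Real.pi)).mono_set Ioo_subset_Icc_self).congr_fun
      (fun θ hθ => (hpt θ hθ).symm) measurableSet_Ioo
  · rw [← himg, integral_image_eq_integral_abs_deriv_smul measurableSet_Ioo hd hinj]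
    refine hcongr.trans ?_
    rw [← integral_Ioc_eq_integral_Ioo, ← intervalIntegral.integral_of_le Real.pi_pos.le]
    -- the reflection `θ ↦ 2π - θ` shows that both halves of the circle contribute equally
    have hrefl : ∫ θ in Real.pi..(2 * Real.pi), T θ = ∫ θ in (0 : ℝ)..Real.pi, T θ := by
      have h1 : ∀ θ, T (2 * Real.pi - θ) = T θ := fun θ => by
        have : circleMap 0 1 (2 * Real.pi - θ) = (circleMap 0 1 θ)⁻¹ := by
          rw [sub_eq_neg_add, periodic_circleMap 0 1 (-θ)]
          simp [circleMap, ← Complex.exp_neg]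
        simp only [hT, this, hWs _ (hnorm θ)]
      have h2 := intervalIntegral.integral_comp_sub_left (a := 0) (b := Real.pi) T (2 * Real.pi)
      simp only [h1, sub_zero] at h2
      rw [h2]
      congr 1
      ring
    have hsplit := intervalIntegral.integral_add_adjacent_intervals
      (hTc.intervalIntegrable (μ := volume) 0 Real.pi)
      (hTc.intervalIntegrable (μ := volume) Real.pi (2 * Real.pi))
    rw [hrefl] at hsplit
    have hcirc : (∮ ζ in C(0, 1), ζ⁻¹ * W ζ) = I * ∫ θ in (0 : ℝ)..(2 * Real.pi), T θ := by
      rw [← intervalIntegral.integral_const_mul]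
      simp only [circleIntegral, deriv_circleMap, smul_eq_mul]
      refine intervalIntegral.integral_congr fun θ _ => ?_
      have := ne_zero_of_norm_eq_one (hnorm θ)
      simp only [hT]
      field_simp
    rw [hcirc, ← hsplit]
    field_simp
    ring

end FMatrixLSS

namespace FMatrixLSS

/-! ### Stieltjes transforms of semicircle-type densities -/

variable {c r : ℝ}

lemma norm_inv_lt_one {q : ℂ} (hq : 1 < ‖q‖) : ‖q⁻¹‖ < 1 := by
  rw [norm_inv]; exact inv_lt_one_of_one_lt₀ hq

lemma mul_sub_one_ne_zero {q ζ : ℂ} (hq : 1 < ‖q‖) (hζ : 1 ≤ ‖ζ‖) : q * ζ - 1 ≠ 0 := by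
  refine ne_of_norm_lt ?_
  rw [norm_one, norm_mul]
  nlinarith

lemma circleIntegral_cross {q₁ q₂ : ℂ} (h₁ : 1 < ‖q₁‖) (h₂ : 1 < ‖q₂‖) :
    (∮ ζ in C(0, 1), ((q₁ - ζ) * (q₂ * ζ - 1))⁻¹) = 2 * Real.pi * I / (q₁ * q₂ - 1) := by
  have hq₂ := ne_zero_of_one_lt_norm h₂
  have hq₁₂ := mul_sub_one_ne_zero h₁ h₂.le
  have hd : DifferentiableOn ℂ (fun ζ => (q₂ * (q₁ - ζ))⁻¹) (Metric.ball 0 ‖q₁‖) := by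
    intro ζ hζ
    have : q₁ - ζ ≠ 0 := ne_of_norm_lt (by simpa using hζ)
    exact DifferentiableAt.differentiableWithinAt (by fun_prop (disch := simp [*]))
  have h := circleIntegral_cauchy h₁ hd (norm_inv_lt_one h₂)
  have hval : (q₂ * (q₁ - q₂⁻¹)) = q₁ * q₂ - 1 := by field_simp
  rw [hval, ← div_eq_mul_inv] at h
  rw [← h]
  congr 1
  ext ζ
  rw [← mul_inv]
  congr 1
  field_simp

/-- The two-pole integral against the semicircle profile. It suffices for both laws, whose densities
are this profile divided by `x` or by `x (y₁ + y₂ x)`: partial fractions reduce the resolvent of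
either to products of two simple poles. -/
lemma integral_semicircle_two_poles (hr : 0 < r) {q₁ q₂ : ℂ} (h₁ : 1 < ‖q₁‖) (h₂ : 1 < ‖q₂‖) :
    IntegrableOn (fun x : ℝ =>
        (Real.sqrt ((c + 2 * r - x) * (x - (c - 2 * r))) : ℂ) *
          ((x - jouk c r q₁) * (x - jouk c r q₂))⁻¹)
      (Ioo (c - 2 * r) (c + 2 * r)) ∧
    ∫ x in Ioo (c - 2 * r) (c + 2 * r),
        (Real.sqrt ((c + 2 * r - x) * (x - (c - 2 * r))) : ℂ) *
          ((x - jouk c r q₁) * (x - jouk c r q₂))⁻¹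
      = 2 * Real.pi / (q₁ * q₂ - 1) := by
  have hr' : (r : ℂ) ≠ 0 := ofReal_ne_zero.mpr hr.ne'
  have hq₁ := ne_zero_of_one_lt_norm h₁
  have hq₂ := ne_zero_of_one_lt_norm h₂
  have hA : ∀ {q ζ : ℂ}, 1 < ‖q‖ → ‖ζ‖ = 1 → q - ζ ≠ 0 := fun hq hζ =>
    ne_of_norm_lt (by rwa [hζ])
  have hB : ∀ {q ζ : ℂ}, 1 < ‖q‖ → ‖ζ‖ = 1 → q * ζ - 1 ≠ 0 := fun hq hζ =>
    mul_sub_one_ne_zero hq hζ.ge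
  -- each factor of the kernel splits into a part holomorphic inside and one holomorphic outside
  set E : ℂ → ℂ → ℂ := fun q ζ => ζ * (q - ζ)⁻¹ - (q * ζ - 1)⁻¹ with hE
  have hEc : ∀ q, 1 < ‖q‖ → ContinuousOn (E q) (Metric.sphere 0 1) := by
    intro q hq ζ hζ
    have hζ' : ‖ζ‖ = 1 := by simpa using hζ
    have a := hA hq hζ'
    have b := hB hq hζ'
    exact ContinuousAt.continuousWithinAt (by simp only [hE]; fun_prop (disch := assumption))
  have hEinv : ∀ q ζ : ℂ, 1 < ‖q‖ → ‖ζ‖ = 1 → E q ζ⁻¹ = -E q ζ := by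
    intro q ζ hq hζ
    have hζ0 := ne_zero_of_norm_eq_one hζ
    have e1 : q - ζ⁻¹ = (q * ζ - 1) * ζ⁻¹ := by field_simp
    have e2 : q * ζ⁻¹ - 1 = (q - ζ) * ζ⁻¹ := by field_simp
    simp only [hE, e1, e2, mul_inv, inv_inv]
    field_simp
    ring
  have hEj : ∀ q ζ : ℂ, 1 < ‖q‖ → ‖ζ‖ = 1 →
      r * (ζ - ζ⁻¹) * (jouk c r ζ - jouk c r q)⁻¹ = -E q ζ := by
    intro q ζ hq hζ
    have hζ0 := ne_zero_of_norm_eq_one hζ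
    have hq0 := ne_zero_of_one_lt_norm hq
    have a := hA hq hζ
    have b := hB hq hζ
    have hj : jouk c r ζ - jouk c r q = -(r * (q - ζ) * (q * ζ - 1) * (q * ζ)⁻¹) := by
      rw [jouk_sub hζ0 hq0]; field_simp; ring
    have b' : ζ * q - 1 ≠ 0 := by rwa [mul_comm]
    rw [hj, hE]
    field_simp
    ring
  have key := integral_semicircle (c := c) hr
    (g := fun x => ((x - jouk c r q₁) * (x - jouk c r q₂))⁻¹)
    (W := fun ζ => -(E q₁ ζ * E q₂ ζ)) ((hEc q₁ h₁).mul (hEc q₂ h₂)).neg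
    (fun ζ hζ => by rw [hEinv _ _ h₁ hζ, hEinv _ _ h₂ hζ]; ring)
    (fun ζ hζ _ => by
      rw [← neg_mul_neg (E q₁ ζ), ← hEj _ _ h₁ hζ, ← hEj _ _ h₂ hζ, mul_inv]; ring)
  refine ⟨key.1, key.2.trans ?_⟩
  set A : ℂ → ℂ := fun ζ => ζ * ((q₁ - ζ) * (q₂ - ζ))⁻¹ with hAdef
  set B : ℂ → ℂ → ℂ → ℂ := fun q q' ζ => ((q - ζ) * (q' * ζ - 1))⁻¹ with hBdef
  set D : ℂ → ℂ := fun ζ => ζ⁻¹ * ((q₁ * ζ - 1) * (q₂ * ζ - 1))⁻¹ with hDdef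
  have hcongr : (∮ ζ in C(0, 1), ζ⁻¹ * -(E q₁ ζ * E q₂ ζ)) =
      ∮ ζ in C(0, 1), (B q₁ q₂ ζ + B q₂ q₁ ζ) - (A ζ + D ζ) := by
    refine circleIntegral.integral_congr zero_le_one fun ζ hζ => ?_
    have hζ' : ‖ζ‖ = 1 := by simpa using hζ
    have hζ0 := ne_zero_of_norm_eq_one hζ'
    simp only [hE, hAdef, hBdef, hDdef, mul_inv]
    generalize (q₁ - ζ)⁻¹ = a₁
    generalize (q₂ - ζ)⁻¹ = a₂
    generalize (q₁ * ζ - 1)⁻¹ = b₁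
    generalize (q₂ * ζ - 1)⁻¹ = b₂
    field_simp
    ring
  have iA : CircleIntegrable A 0 1 := by
    refine ContinuousOn.circleIntegrable zero_le_one fun ζ hζ => ?_
    have hζ' : ‖ζ‖ = 1 := by simpa using hζ
    have := mul_ne_zero (hA h₁ hζ') (hA h₂ hζ')
    exact ContinuousAt.continuousWithinAt (by simp only [hAdef]; fun_prop (disch := assumption))
  have iB : ∀ q q' : ℂ, 1 < ‖q‖ → 1 < ‖q'‖ → CircleIntegrable (B q q') 0 1 := by
    intro q q' hq hq'
    refine ContinuousOn.circleIntegrable zero_le_one fun ζ hζ => ?_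
    have hζ' : ‖ζ‖ = 1 := by simpa using hζ
    have := mul_ne_zero (hA hq hζ') (hB hq' hζ')
    exact ContinuousAt.continuousWithinAt (by simp only [hBdef]; fun_prop (disch := assumption))
  have iD : CircleIntegrable D 0 1 := by
    refine ContinuousOn.circleIntegrable zero_le_one fun ζ hζ => ?_
    have hζ' : ‖ζ‖ = 1 := by simpa using hζ
    have hζ0 := ne_zero_of_norm_eq_one hζ'
    have := mul_ne_zero (hB h₁ hζ') (hB h₂ hζ')
    exact ContinuousAt.continuousWithinAt (by simp only [hDdef]; fun_prop (disch := assumption))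
  have vA : (∮ ζ in C(0, 1), A ζ) = 0 := by
    refine circleIntegral_eq_zero_of_ball zero_le_one (lt_min h₁ h₂) fun ζ hζ => ?_
    have hζ' : ‖ζ‖ < min ‖q₁‖ ‖q₂‖ := by simpa using hζ
    have : (q₁ - ζ) * (q₂ - ζ) ≠ 0 := mul_ne_zero
      (ne_of_norm_lt (hζ'.trans_le (min_le_left _ _)))
      (ne_of_norm_lt (hζ'.trans_le (min_le_right _ _)))
    exact DifferentiableAt.differentiableWithinAt
      (by simp only [hAdef]; fun_prop (disch := assumption))
  have vD : (∮ ζ in C(0, 1), D ζ) = 0 := by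
    rw [circleIntegral_inversion _ _ one_ne_zero, inv_one]
    refine Eq.trans ?_ vA
    refine circleIntegral.integral_congr zero_le_one fun ζ hζ => ?_
    have hζ' : ‖ζ‖ = 1 := by simpa using hζ
    have hζ0 := ne_zero_of_norm_eq_one hζ'
    have e2 : ∀ q, q * ζ⁻¹ - 1 = (q - ζ) * ζ⁻¹ := fun q => by field_simp
    simp only [hAdef, hDdef, e2, mul_inv, inv_inv]
    field_simp
  rw [hcongr, circleIntegral.integral_sub (f := fun ζ => B q₁ q₂ ζ + B q₂ q₁ ζ) (g := fun ζ => A ζ + D ζ)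
      ((iB _ _ h₁ h₂).add (iB _ _ h₂ h₁)) (iA.add iD),
    circleIntegral.integral_add (iB _ _ h₁ h₂) (iB _ _ h₂ h₁), circleIntegral.integral_add iA iD,
    vA, vD, circleIntegral_cross h₁ h₂, circleIntegral_cross h₂ h₁, mul_comm q₂ q₁]
  have := mul_sub_one_ne_zero h₁ h₂.le
  field_simp
  ring

/-- The degenerate case in which one of the two poles is the left edge of the interval. -/
lemma integral_semicircle_edge_pole (hr : 0 < r) {q : ℂ} (hq : 1 < ‖q‖) :
    IntegrableOn (fun x : ℝ =>
        (Real.sqrt ((c + 2 * r - x) * (x - (c - 2 * r))) : ℂ) *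
          ((x - jouk c r (-1)) * (x - jouk c r q))⁻¹)
      (Ioo (c - 2 * r) (c + 2 * r)) ∧
    ∫ x in Ioo (c - 2 * r) (c + 2 * r),
        (Real.sqrt ((c + 2 * r - x) * (x - (c - 2 * r))) : ℂ) *
          ((x - jouk c r (-1)) * (x - jouk c r q))⁻¹
      = 2 * Real.pi / (-1 * q - 1) := by
  have hr' : (r : ℂ) ≠ 0 := ofReal_ne_zero.mpr hr.ne'
  have hq0 := ne_zero_of_one_lt_norm hq
  have hA : ∀ {ζ : ℂ}, ‖ζ‖ = 1 → q - ζ ≠ 0 := fun hζ => ne_of_norm_lt (by rwa [hζ])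
  have hB : ∀ {ζ : ℂ}, ‖ζ‖ = 1 → q * ζ - 1 ≠ 0 := fun hζ => mul_sub_one_ne_zero hq hζ.ge
  set W : ℂ → ℂ := fun ζ => (ζ - 1) ^ 2 * q * ((q - ζ) * (q * ζ - 1))⁻¹ with hW
  have key := integral_semicircle (c := c) hr
    (g := fun x => ((x - jouk c r (-1)) * (x - jouk c r q))⁻¹) (W := W) ?_ ?_ ?_
  · refine ⟨key.1, key.2.trans ?_⟩
    set F : ℂ → ℂ := fun ζ => (ζ - 1) ^ 2 * q * (q - ζ)⁻¹ with hF
    have hd : DifferentiableOn ℂ F (Metric.ball 0 ‖q‖) := by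
      intro ζ hζ
      have : q - ζ ≠ 0 := ne_of_norm_lt (by simpa using hζ)
      exact DifferentiableAt.differentiableWithinAt
        (by simp only [hF]; fun_prop (disch := assumption))
    have hcongr : (∮ ζ in C(0, 1), ζ⁻¹ * W ζ) =
        ∮ ζ in C(0, 1), (ζ - q⁻¹)⁻¹ * F ζ - (ζ - 0)⁻¹ * F ζ := by
      refine circleIntegral.integral_congr zero_le_one fun ζ hζ => ?_
      have hζ' : ‖ζ‖ = 1 := by simpa using hζ
      have hζ0 := ne_zero_of_norm_eq_one hζ'
      have a := hA hζ'
      have b := hB hζ'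
      have e : ζ - q⁻¹ = (q * ζ - 1) * q⁻¹ := by field_simp
      have b' : ζ * q - 1 ≠ 0 := by rwa [mul_comm]
      simp only [hW, hF, e, sub_zero]
      field_simp
      ring
    have hint : ∀ p : ℂ, ‖p‖ < 1 → CircleIntegrable (fun ζ => (ζ - p)⁻¹ * F ζ) 0 1 := by
      intro p hp
      refine ContinuousOn.circleIntegrable zero_le_one fun ζ hζ => ?_
      have hζ' : ‖ζ‖ = 1 := by simpa using hζ
      have a := hA hζ'
      have b : ζ - p ≠ 0 := ne_of_norm_lt (by rwa [hζ'])
      exact ContinuousAt.continuousWithinAt (by simp only [hF]; fun_prop (disch := assumption))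
    have h0 : ‖(0 : ℂ)‖ < 1 := by simp
    rw [hcongr, circleIntegral.integral_sub (hint _ (norm_inv_lt_one hq)) (hint _ h0),
      circleIntegral_cauchy hq hd (norm_inv_lt_one hq), circleIntegral_cauchy hq hd h0]
    have h3 : q + 1 ≠ 0 := by simpa using ne_of_norm_lt (ξ := -1) (η := q) (by simpa using hq)
    have h4 : q - 1 ≠ 0 := by simpa using ne_of_norm_lt (ξ := 1) (η := q) (by simpa using hq)
    have h5 : -1 * q - 1 = -(q + 1) := by ring
    have h6 : q - q⁻¹ = (q - 1) * (q + 1) * q⁻¹ := by field_simp; ring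
    simp only [hF, h5, h6]
    field_simp
    ring
  · intro ζ hζ
    have hζ' : ‖ζ‖ = 1 := by simpa using hζ
    have := mul_ne_zero (hA hζ') (hB hζ')
    exact ContinuousAt.continuousWithinAt (by simp only [hW]; fun_prop (disch := assumption))
  · intro ζ hζ
    have hζ0 := ne_zero_of_norm_eq_one hζ
    have e1 : q - ζ⁻¹ = (q * ζ - 1) * ζ⁻¹ := by field_simp
    have e2 : q * ζ⁻¹ - 1 = (q - ζ) * ζ⁻¹ := by field_simp
    simp only [hW, e1, e2, mul_inv, inv_inv]
    field_simp
    ring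
  · intro ζ hζ hζ2
    have hζ0 := ne_zero_of_norm_eq_one hζ
    have a := hA hζ
    have b := hB hζ
    have h1 : ζ + 1 ≠ 0 := fun h => hζ2 (by linear_combination (ζ - 1) * h)
    have hj : jouk c r ζ - jouk c r q = -(r * (q - ζ) * (q * ζ - 1) * (q * ζ)⁻¹) := by
      rw [jouk_sub hζ0 hq0]; field_simp; ring
    have hj1 : jouk c r ζ - jouk c r (-1) = r * (ζ + 1) ^ 2 * ζ⁻¹ := by
      rw [jouk_sub hζ0 (by norm_num)]; field_simp; ring
    have b' : ζ * q - 1 ≠ 0 := by rwa [mul_comm]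
    rw [hj, hj1, hW]
    field_simp
    ring

/-- Integration of the resolvent against a law given by a density on an interval. -/
lemma resolvent_withDensity {a b : ℝ} {k d : ℝ → ℝ} (hd : d = (Icc a b).indicator k)
    (hk : ∀ x ∈ Icc a b, 0 ≤ k x) (hm : Measurable k) {z : ℂ}
    (hint : IntegrableOn (fun x : ℝ => (k x : ℂ) * ((x : ℂ) - z)⁻¹) (Ioo a b)) :
    Integrable (fun x : ℝ => resolvent z x) (volume.withDensity fun x => ENNReal.ofReal (d x)) ∧
    ∫ x, resolvent z x ∂(volume.withDensity fun x => ENNReal.ofReal (d x)) =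
      ∫ x in Ioo a b, (k x : ℂ) * ((x : ℂ) - z)⁻¹ := by
  have hdm : Measurable fun x => ENNReal.ofReal (d x) := by
    rw [hd]; exact (hm.indicator measurableSet_Icc).ennreal_ofReal
  have hlt : ∀ᵐ x ∂(volume : Measure ℝ), ENNReal.ofReal (d x) < ⊤ :=
    .of_forall fun _ => ENNReal.ofReal_lt_top
  have hres : ∀ x : ℝ, resolvent z x = ((x : ℂ) - z)⁻¹ := fun x => by
    simp [resolvent]
  have hfun : (fun x : ℝ => (ENNReal.ofReal (d x)).toReal • resolvent z x) =
      (Icc a b).indicator fun x : ℝ => (k x : ℂ) * ((x : ℂ) - z)⁻¹ := by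
    ext x
    by_cases hx : x ∈ Icc a b
    · simp [hd, hx, ENNReal.toReal_ofReal (hk x hx), hres]
    · simp [hd, hx]
  constructor
  · rw [integrable_withDensity_iff_integrable_smul' hdm hlt, hfun,
      integrable_indicator_iff measurableSet_Icc, integrableOn_Icc_iff_integrableOn_Ioo]
    exact hint
  · rw [integral_withDensity_eq_integral_toReal_smul hdm hlt, hfun,
      integral_indicator measurableSet_Icc, integral_Icc_eq_integral_Ioo]

lemma companionStieltjes_eq {a b y : ℝ} {k d : ℝ → ℝ} (hd : d = (Icc a b).indicator k)
    (hk : ∀ x ∈ Icc a b, 0 ≤ k x) (hm : Measurable k) {z : ℂ}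
    (hint : IntegrableOn (fun x : ℝ => (k x : ℂ) * ((x : ℂ) - z)⁻¹) (Ioo a b)) :
    companionStieltjes y (volume.withDensity (fun x => ENNReal.ofReal (d x)) +
        ENNReal.ofReal (1 - 1 / y) • Measure.dirac 0) z =
      -(1 - y) * z⁻¹ + y * ((∫ x in Ioo a b, (k x : ℂ) * ((x : ℂ) - z)⁻¹) -
        (max (1 - 1 / y) 0 : ℝ) * z⁻¹) := by
  obtain ⟨h1, h2⟩ := resolvent_withDensity hd hk hm hint
  have h3 : Integrable (fun x : ℝ => resolvent z x)
      (ENNReal.ofReal (1 - 1 / y) • Measure.dirac (0 : ℝ)) :=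
    (integrable_dirac (by simp)).smul_measure ENNReal.ofReal_ne_top
  have h4 : ∫ x, resolvent z x ∂(ENNReal.ofReal (1 - 1 / y) • Measure.dirac (0 : ℝ)) =
      -((max (1 - 1 / y) 0 : ℝ) * z⁻¹) := by
    rw [integral_smul_measure, integral_dirac, ENNReal.toReal_ofReal']
    simp [resolvent]
  rw [companionStieltjes, resolventTransform_dirac, resolventTransform_apply,
    integral_add_measure h1 h3, h2, h4]
  simp [resolvent]
  ring

end FMatrixLSS

namespace FMatrixLSS

/-! ### The Marchenko–Pastur law -/

lemma integral_semicircle_pole_pair {c r : ℝ} (hr : 0 < r) {q₁ q₂ : ℂ} (h₁ : 1 < ‖q₁‖ ∨ q₁ = -1)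
    (h₂ : 1 < ‖q₂‖) :
    IntegrableOn (fun x : ℝ =>
        (Real.sqrt ((c + 2 * r - x) * (x - (c - 2 * r))) : ℂ) *
          ((x - jouk c r q₁) * (x - jouk c r q₂))⁻¹)
      (Ioo (c - 2 * r) (c + 2 * r)) ∧
    ∫ x in Ioo (c - 2 * r) (c + 2 * r),
        (Real.sqrt ((c + 2 * r - x) * (x - (c - 2 * r))) : ℂ) *
          ((x - jouk c r q₁) * (x - jouk c r q₂))⁻¹
      = 2 * Real.pi / (q₁ * q₂ - 1) := by
  rcases h₁ with h₁ | rfl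
  · exact integral_semicircle_two_poles hr h₁ h₂
  · exact integral_semicircle_edge_pole hr h₂

/-- The companion Stieltjes transform of the Marchenko–Pastur law in the Joukowski coordinate
`z = (1 + √y η)(1 + √y/η)`, `|η| > 1`. -/
theorem companionStieltjes_mpLaw {y : ℝ} (hy : 0 < y) (hy' : y < 1) {η : ℂ} (hη : 1 < ‖η‖)
    (hne : 1 + Real.sqrt y * η ≠ 0) :
    companionStieltjes y (mpLaw y) (jouk (1 + y) (Real.sqrt y) η) =
      -(1 + Real.sqrt y * η)⁻¹ := by
  set s := Real.sqrt y with hs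
  have hs0 : 0 < s := Real.sqrt_pos.mpr hy
  have hss : s ^ 2 = y := Real.sq_sqrt hy.le
  have hs1 : s < 1 := by nlinarith
  have hsC : (s : ℂ) ≠ 0 := ofReal_ne_zero.mpr hs0.ne'
  have hssC : (y : ℂ) = s ^ 2 := by rw [← hss]; push_cast; rfl
  have hη0 := ne_zero_of_one_lt_norm hη
  have hηs : η + s ≠ 0 := by
    simpa using ne_of_norm_lt (ξ := -(s : ℂ)) (η := η)
      (by rw [norm_neg, norm_real, Real.norm_eq_abs, abs_of_pos hs0]; linarith)
  have hb : (1 + s) ^ 2 = 1 + y + 2 * s := by rw [← hss]; ring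
  have ha : (1 - s) ^ 2 = 1 + y - 2 * s := by rw [← hss]; ring
  set q : ℂ := -(s : ℂ)⁻¹ with hq
  have hqn : 1 < ‖q‖ := by
    rw [hq, norm_neg, norm_inv, norm_real, Real.norm_eq_abs, abs_of_pos hs0]
    exact (one_lt_inv₀ hs0).mpr hs1
  have hq0 : jouk (1 + y) s q = 0 := by
    rw [jouk, hq]; push_cast; rw [hssC]; field_simp; ring
  set z := jouk (1 + y) s η with hz
  have hzval : z = (1 + s * η) * (η + s) * η⁻¹ := by
    rw [hz, jouk]; push_cast; rw [hssC]; field_simp; ring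
  obtain ⟨hint, hval⟩ := integral_semicircle_pole_pair (c := 1 + y) hs0 (.inl hqn) hη
  rw [hq0, ← hz] at hint hval
  set k : ℝ → ℝ := fun x => Real.sqrt ((1 + y + 2 * s - x) * (x - (1 + y - 2 * s))) /
    (2 * Real.pi * x * y) with hk
  have hkeq : (fun x : ℝ => (k x : ℂ) * ((x : ℂ) - z)⁻¹) = fun x : ℝ =>
      (2 * Real.pi * y : ℂ)⁻¹ *
        ((Real.sqrt ((1 + y + 2 * s - x) * (x - (1 + y - 2 * s))) : ℂ) *
          ((x - 0) * (x - z))⁻¹) := by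
    ext x
    simp only [hk, ofReal_div, ofReal_mul, ofReal_ofNat]
    simp only [div_eq_mul_inv, mul_inv, sub_zero]
    ring
  have hcomp := companionStieltjes_eq (y := y) (a := 1 + y - 2 * s) (b := 1 + y + 2 * s)
    (k := k) (d := mpDensity y) (z := z) ?_ ?_ ?_ ?_
  · rw [mpLaw, hcomp, hkeq, integral_const_mul, hval, hzval, hssC]
    have hmax : max (1 - 1 / y) 0 = 0 :=
      max_eq_right (sub_nonpos.mpr ((one_le_div hy).mpr hy'.le))
    have hπ : (Real.pi : ℂ) ≠ 0 := ofReal_ne_zero.mpr Real.pi_pos.ne'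
    have hqη : q * η - 1 = -((η + s) * (s : ℂ)⁻¹) := by rw [hq]; field_simp; ring
    rw [hmax, hqη, ofReal_zero]
    field_simp
    ring
  · ext x
    rw [mpDensity, ← hs, hb, ha]
  · intro x hx
    have : 0 ≤ x := le_trans (ha ▸ sq_nonneg _) hx.1
    positivity
  · fun_prop
  · rw [hkeq]
    exact hint.const_mul _

/-! ### The limiting law of the F-matrix -/

section Parameters

variable {y₁ y₂ : ℝ}

lemma sq_hPrime (hy₁ : 0 < y₁) (hy₂ : 0 < y₂) (hy₂' : y₂ < 1) :
    hPrime y₁ y₂ ^ 2 = y₁ + y₂ - y₁ * y₂ :=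
  Real.sq_sqrt (by nlinarith)

lemma hPrime_pos (hy₁ : 0 < y₁) (hy₂ : 0 < y₂) (hy₂' : y₂ < 1) : 0 < hPrime y₁ y₂ :=
  Real.sqrt_pos.mpr (by nlinarith)

lemma lt_sq_hPrime (hy₁ : 0 < y₁) (hy₂ : 0 < y₂) (hy₂' : y₂ < 1) : y₂ < hPrime y₁ y₂ ^ 2 := by
  rw [sq_hPrime hy₁ hy₂ hy₂']; nlinarith

lemma lt_hPrime (hy₁ : 0 < y₁) (hy₂ : 0 < y₂) (hy₂' : y₂ < 1) : y₂ < hPrime y₁ y₂ := by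
  have h1 := hPrime_pos hy₁ hy₂ hy₂'
  have h2 := lt_sq_hPrime hy₁ hy₂ hy₂'
  nlinarith

/-- The Joukowski map `ξ ↦ (1 + h'ξ)(1 + h'/ξ)/(1 - y₂)²` whose image of the unit circle is the
support `[a', b']`. -/
def fJouk (y₁ y₂ : ℝ) : ℂ → ℂ :=
  jouk ((1 + hPrime y₁ y₂ ^ 2) / (1 - y₂) ^ 2) (hPrime y₁ y₂ / (1 - y₂) ^ 2)

lemma edgeA_eq : edgeA y₁ y₂ =
    (1 + hPrime y₁ y₂ ^ 2) / (1 - y₂) ^ 2 - 2 * (hPrime y₁ y₂ / (1 - y₂) ^ 2) := by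
  rw [edgeA, div_pow]; ring

lemma edgeB_eq : edgeB y₁ y₂ =
    (1 + hPrime y₁ y₂ ^ 2) / (1 - y₂) ^ 2 + 2 * (hPrime y₁ y₂ / (1 - y₂) ^ 2) := by
  rw [edgeB, div_pow]; ring

lemma fJouk_eq (hy₂' : y₂ < 1) {ξ : ℂ} (hξ : ξ ≠ 0) :
    fJouk y₁ y₂ ξ =
      (1 + hPrime y₁ y₂ * ξ) * (ξ + hPrime y₁ y₂) * (ξ * (1 - y₂) ^ 2)⁻¹ := by
  have h1 : (1 - y₂ : ℂ) ≠ 0 := by exact_mod_cast (sub_pos.mpr hy₂').ne'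
  rw [fJouk, jouk]
  push_cast
  field_simp
  ring

lemma radius_pos (hy₁ : 0 < y₁) (hy₂ : 0 < y₂) (hy₂' : y₂ < 1) :
    0 < hPrime y₁ y₂ / (1 - y₂) ^ 2 :=
  div_pos (hPrime_pos hy₁ hy₂ hy₂') (pow_pos (sub_pos.mpr hy₂') 2)

lemma y₂_add_ne_zero (hy₁ : 0 < y₁) (hy₂ : 0 < y₂) (hy₂' : y₂ < 1) {ξ : ℂ} (hξ : 1 ≤ ‖ξ‖) :
    (y₂ + hPrime y₁ y₂ * ξ : ℂ) ≠ 0 := by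
  have h := hPrime_pos hy₁ hy₂ hy₂'
  have h1 := lt_hPrime hy₁ hy₂ hy₂'
  rw [add_comm, ← sub_neg_eq_add]
  refine ne_of_norm_lt ?_
  rw [norm_neg, norm_mul, norm_real, norm_real, Real.norm_eq_abs, Real.norm_eq_abs,
    abs_of_pos hy₂, abs_of_pos h]
  nlinarith

lemma one_add_ne_zero_of_fJouk_ne_zero (hy₂' : y₂ < 1) {ξ : ℂ} (hξ : ξ ≠ 0)
    (hz : fJouk y₁ y₂ ξ ≠ 0) :
    (1 + hPrime y₁ y₂ * ξ : ℂ) ≠ 0 ∧ ξ + (hPrime y₁ y₂ : ℂ) ≠ 0 := by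
  rw [fJouk_eq hy₂' hξ] at hz
  exact ⟨left_ne_zero_of_mul (left_ne_zero_of_mul hz),
    right_ne_zero_of_mul (left_ne_zero_of_mul hz)⟩

/-- The companion Stieltjes transform of the F-law in the Joukowski coordinate. The origin
corresponds to `ξ = -1/h'` if `y₁ ≤ 1` and to `ξ = -h'` if `y₁ ≥ 1`; the mass at the origin makes
both cases lead to the same formula. -/
theorem mUnder_fJouk (hy₁ : 0 < y₁) (hy₂ : 0 < y₂) (hy₂' : y₂ < 1) {ξ : ℂ} (hξ : 1 < ‖ξ‖)
    (hz : fJouk y₁ y₂ ξ ≠ 0) :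
    mUnder y₁ y₂ (fJouk y₁ y₂ ξ) = -(hPrime y₁ y₂ * ξ * (1 - y₂) ^ 2 *
      ((1 + hPrime y₁ y₂ * ξ) * (y₂ + hPrime y₁ y₂ * ξ))⁻¹) := by
  have hh := hPrime_pos hy₁ hy₂ hy₂'
  have hsq := sq_hPrime hy₁ hy₂ hy₂'
  have hlt := lt_hPrime hy₁ hy₂ hy₂'
  have hr := radius_pos hy₁ hy₂ hy₂'
  have hξ0 := ne_zero_of_one_lt_norm hξ
  obtain ⟨hne1, hne2⟩ := one_add_ne_zero_of_fJouk_ne_zero hy₂' hξ0 hz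
  have hne3 := y₂_add_ne_zero hy₁ hy₂ hy₂' hξ.le
  have hJ := fJouk_eq (y₁ := y₁) hy₂' hξ0
  have ha0 : 0 ≤ edgeA y₁ y₂ := sq_nonneg _
  have hzK : fJouk y₁ y₂ ξ ∉ Complex.ofReal '' Icc (edgeA y₁ y₂) (edgeB y₁ y₂) := by
    rw [edgeA_eq, edgeB_eq]; exact jouk_notMem hr hξ
  have hsqC : (hPrime y₁ y₂ : ℂ) ^ 2 = y₁ + y₂ - y₁ * y₂ := by exact_mod_cast hsq
  set h := hPrime y₁ y₂ with hh_def
  have hhC : (h : ℂ) ≠ 0 := ofReal_ne_zero.mpr hh.ne'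
  have hy₁C : (y₁ : ℂ) ≠ 0 := ofReal_ne_zero.mpr hy₁.ne'
  have hy₂C : (y₂ : ℂ) ≠ 0 := ofReal_ne_zero.mpr hy₂.ne'
  have h1C : (1 - y₂ : ℂ) ≠ 0 := by exact_mod_cast (sub_pos.mpr hy₂').ne'
  have hπ : (Real.pi : ℂ) ≠ 0 := ofReal_ne_zero.mpr Real.pi_pos.ne'
  -- the pole of the density at `-y₁/y₂`
  set q₁ : ℂ := -(h / y₂ : ℂ) with hq₁
  have hq₁n : 1 < ‖q₁‖ := by
    rw [hq₁, norm_neg, norm_div, norm_real, norm_real, Real.norm_eq_abs, Real.norm_eq_abs,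
      abs_of_pos hh, abs_of_pos hy₂]
    exact (one_lt_div hy₂).mpr hlt
  have hJq₁ : fJouk y₁ y₂ q₁ = -(y₁ / y₂ : ℂ) := by
    rw [fJouk_eq hy₂' (ne_zero_of_one_lt_norm hq₁n), ← hh_def, hq₁]
    field_simp
    linear_combination -(1 - y₂ : ℂ) * hsqC
  -- the origin, in the Joukowski coordinate
  obtain ⟨q₀, hq₀n, hJq₀, hq₀v⟩ : ∃ q₀ : ℂ, (1 < ‖q₀‖ ∨ q₀ = -1) ∧ fJouk y₁ y₂ q₀ = 0 ∧
      (y₁ : ℂ) * (((1 - y₂) / y₂) * (q₀ * q₁ - 1)⁻¹ + (max (1 - 1 / y₁) 0 : ℝ)) = y₁ := by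
    rcases le_or_gt y₁ 1 with hy | hy
    · have hh1 : h ≤ 1 := by nlinarith
      refine ⟨-(h : ℂ)⁻¹, ?_, ?_, ?_⟩
      · rcases hh1.lt_or_eq with hlt1 | heq
        · left
          rw [norm_neg, norm_inv, norm_real, Real.norm_eq_abs, abs_of_pos hh]
          exact (one_lt_inv₀ hh).mpr hlt1
        · right
          rw [heq]; simp
      · rw [fJouk_eq hy₂' (neg_ne_zero.mpr (inv_ne_zero hhC)), ← hh_def]
        simp [hhC]
      · have hmax : max (1 - 1 / y₁) 0 = 0 :=
          max_eq_right (sub_nonpos.mpr ((one_le_div hy₁).mpr hy))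
        have : -(h : ℂ)⁻¹ * q₁ - 1 = (1 - y₂) / y₂ := by rw [hq₁]; field_simp
        rw [hmax, this, ofReal_zero]
        field_simp
        ring
    · have hh1 : 1 < h := by nlinarith
      refine ⟨-(h : ℂ), .inl ?_, ?_, ?_⟩
      · rw [norm_neg, norm_real, Real.norm_eq_abs, abs_of_pos hh]
        exact hh1
      · rw [fJouk_eq hy₂' (neg_ne_zero.mpr hhC), ← hh_def]
        simp
      · have hmax : max (1 - 1 / y₁) 0 = 1 - 1 / y₁ :=
          max_eq_left (sub_nonneg.mpr ((div_le_one hy₁).mpr hy.le))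
        have : -(h : ℂ) * q₁ - 1 = y₁ * (1 - y₂) / y₂ := by
          rw [hq₁]; field_simp; linear_combination hsqC
        rw [hmax, this]
        push_cast
        field_simp
        ring
  set z := fJouk y₁ y₂ ξ with hz_def
  obtain ⟨hint₁, hval₁⟩ := integral_semicircle_pole_pair
    (c := (1 + h ^ 2) / (1 - y₂) ^ 2) hr (.inl hq₁n) hξ
  obtain ⟨hint₀, hval₀⟩ := integral_semicircle_pole_pair
    (c := (1 + h ^ 2) / (1 - y₂) ^ 2) hr hq₀n hq₁n
  rw [← edgeA_eq, ← edgeB_eq] at hint₁ hval₁ hint₀ hval₀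
  simp only [fJouk, ← hh_def] at hJq₀ hJq₁ hz_def
  rw [hJq₁, ← hz_def] at hint₁ hval₁
  rw [hJq₁, hJq₀] at hint₀ hval₀
  set k : ℝ → ℝ := fun x => (1 - y₂) * Real.sqrt ((edgeB y₁ y₂ - x) * (x - edgeA y₁ y₂)) /
    (2 * Real.pi * x * (y₁ + y₂ * x)) with hk
  have hkeq : EqOn (fun x : ℝ => (k x : ℂ) * ((x : ℂ) - z)⁻¹) (fun x : ℝ =>
      ((1 - y₂) / (2 * Real.pi * y₂) * z⁻¹ : ℂ) *
        ((Real.sqrt ((edgeB y₁ y₂ - x) * (x - edgeA y₁ y₂)) : ℂ) *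
            ((x - -(y₁ / y₂ : ℂ)) * (x - z))⁻¹ -
          (Real.sqrt ((edgeB y₁ y₂ - x) * (x - edgeA y₁ y₂)) : ℂ) *
            ((x - 0) * (x - -(y₁ / y₂ : ℂ)))⁻¹)) (Ioo (edgeA y₁ y₂) (edgeB y₁ y₂)) := by
    intro x hx
    have hx0 : 0 < x := ha0.trans_lt hx.1
    have hxC : (x : ℂ) ≠ 0 := ofReal_ne_zero.mpr hx0.ne'
    have hxz : (x : ℂ) - z ≠ 0 := fun h0 =>
      hzK ⟨x, Ioo_subset_Icc_self hx, sub_eq_zero.mp h0⟩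
    have hxp : (y₁ + y₂ * x : ℂ) ≠ 0 := by
      have : 0 < y₁ + y₂ * x := by positivity
      exact_mod_cast this.ne'
    have hxe : (x : ℂ) - -(y₁ / y₂ : ℂ) = (y₁ + y₂ * x) / y₂ := by field_simp; ring
    simp only [hk, ofReal_div, ofReal_mul, ofReal_add, ofReal_sub, ofReal_one, ofReal_ofNat, hxe,
      sub_zero]
    generalize (Real.sqrt _ : ℂ) = S
    field_simp
    ring
  have hcomp := companionStieltjes_eq (y := y₁) (a := edgeA y₁ y₂) (b := edgeB y₁ y₂)
    (k := k) (d := fDensity y₁ y₂) (z := z) ?_ ?_ ?_ ?_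
  · rw [mUnder, fLaw, hcomp, setIntegral_congr_fun measurableSet_Ioo hkeq, integral_const_mul,
      integral_sub hint₁ hint₀, hval₁, hval₀]
    have hqξ : q₁ * ξ - 1 = -((y₂ + h * ξ) / y₂) := by rw [hq₁]; field_simp; ring
    rw [hqξ]
    have hstep : -(1 - (y₁ : ℂ)) * z⁻¹ + y₁ * ((1 - y₂) / (2 * Real.pi * y₂) * z⁻¹ *
        (2 * Real.pi / -((y₂ + h * ξ) / y₂) - 2 * Real.pi / (q₀ * q₁ - 1)) -
        (max (1 - 1 / y₁) 0 : ℝ) * z⁻¹) =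
        z⁻¹ * (-(1 - (y₁ : ℂ)) - y₁ * (1 - y₂) / (y₂ + h * ξ) -
          y₁ * (((1 - y₂) / y₂) * (q₀ * q₁ - 1)⁻¹ + (max (1 - 1 / y₁) 0 : ℝ))) := by
      generalize ((max (1 - 1 / y₁) 0 : ℝ) : ℂ) = M
      rw [div_eq_mul_inv _ (q₀ * q₁ - 1)]
      generalize (q₀ * q₁ - 1)⁻¹ = Q
      generalize z⁻¹ = Z
      field_simp
      ring
    rw [hstep, hq₀v, hJ]
    field_simp
    linear_combination hsqC
  · ext x; rfl
  · intro x hx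
    have : 0 ≤ x := ha0.trans hx.1
    have := sub_pos.mpr hy₂'
    positivity
  · fun_prop
  · exact IntegrableOn.congr_fun ((hint₁.sub hint₀).const_mul _) hkeq.symm measurableSet_Ioo

/-- In the Joukowski coordinate, `m₀` is an affine function. -/
theorem m0_fJouk (hy₁ : 0 < y₁) (hy₂ : 0 < y₂) (hy₂' : y₂ < 1) {ξ : ℂ} (hξ : 1 < ‖ξ‖)
    (hz : fJouk y₁ y₂ ξ ≠ 0) :
    m0 y₁ y₂ (fJouk y₁ y₂ ξ) = -(1 + hPrime y₁ y₂ * ξ) / (1 - y₂) := by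
  have hh := hPrime_pos hy₁ hy₂ hy₂'
  have hlt := lt_sq_hPrime hy₁ hy₂ hy₂'
  have hξ0 := ne_zero_of_one_lt_norm hξ
  obtain ⟨hne1, hne2⟩ := one_add_ne_zero_of_fJouk_ne_zero hy₂' hξ0 hz
  have hne3 := y₂_add_ne_zero hy₁ hy₂ hy₂' hξ.le
  rw [m0, mUnder_fJouk hy₁ hy₂ hy₂' hξ hz, neg_neg]
  set h := hPrime y₁ y₂
  set s := Real.sqrt y₂ with hs
  have hs0 : 0 < s := Real.sqrt_pos.mpr hy₂
  have hss : s ^ 2 = y₂ := Real.sq_sqrt hy₂.le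
  have hsC : (s : ℂ) ≠ 0 := ofReal_ne_zero.mpr hs0.ne'
  have hssC : (y₂ : ℂ) = s ^ 2 := by rw [← hss]; push_cast; rfl
  have hhC : (h : ℂ) ≠ 0 := ofReal_ne_zero.mpr hh.ne'
  have h1C : (1 - y₂ : ℂ) ≠ 0 := by exact_mod_cast (sub_pos.mpr hy₂').ne'
  set η : ℂ := -((y₂ + h * ξ) / (s * (1 + h * ξ))) with hη
  have hηn : 1 < ‖η‖ := by
    rw [hη, norm_neg, norm_div, one_lt_div (norm_pos_iff.mpr (mul_ne_zero hsC hne1))]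
    refine lt_of_pow_lt_pow_left₀ 2 (norm_nonneg _) ?_
    have hξ2 : 1 < ξ.re ^ 2 + ξ.im ^ 2 := by
      have : ‖ξ‖ ^ 2 = ξ.re ^ 2 + ξ.im ^ 2 := by
        rw [← normSq_eq_norm_sq, normSq_apply]; ring
      nlinarith
    have e1 : ‖(s * (1 + h * ξ) : ℂ)‖ ^ 2 =
        y₂ * ((1 + h * ξ.re) ^ 2 + (h * ξ.im) ^ 2) := by
      rw [norm_mul, mul_pow, norm_real, Real.norm_eq_abs, sq_abs, hss, ← normSq_eq_norm_sq,
        normSq_apply]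
      simp
      ring_nf
      tauto
    have e2 : ‖(y₂ + h * ξ : ℂ)‖ ^ 2 = (y₂ + h * ξ.re) ^ 2 + (h * ξ.im) ^ 2 := by
      rw [← normSq_eq_norm_sq, normSq_apply]
      simp
      ring
    rw [e1, e2]
    have h3 : y₂ < h ^ 2 * (ξ.re ^ 2 + ξ.im ^ 2) := by nlinarith
    nlinarith [mul_pos (sub_pos.mpr hy₂') (sub_pos.mpr h3)]
  have hsη : 1 + s * η = (1 - y₂) / (1 + h * ξ) := by
    rw [hη]; field_simp; ring
  have hJη : jouk (1 + y₂) s η =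
      h * ξ * (1 - y₂) ^ 2 * ((1 + h * ξ) * (y₂ + h * ξ))⁻¹ := by
    rw [jouk, hη]
    push_cast
    rw [hssC] at hne3 ⊢
    field_simp
    ring
  rw [← hJη, companionStieltjes_mpLaw hy₂ hy₂' hηn (by
    rw [← hs, hsη]; exact div_ne_zero h1C hne1), ← hs, hsη, inv_div, neg_div]

end Parameters

end FMatrixLSS

namespace FMatrixLSS

/-! ### The inverse of the Joukowski map -/

/-- The branch of the inverse of the Joukowski map with values in `{|ξ| > 1}`, on the complement of
`[c - 2r, c + 2r]`; it takes the junk value `0` on that interval. -/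
def joukInv (c r : ℝ) (z : ℂ) : ℂ :=
  open Classical in if h : ∃ ξ : ℂ, 1 < ‖ξ‖ ∧ jouk c r ξ = z then h.choose else 0

/-- The interval `[c - 2r, c + 2r]`, as a subset of `ℂ`. -/
def slit (c r : ℝ) : Set ℂ := Complex.ofReal '' Icc (c - 2 * r) (c + 2 * r)

variable {c r : ℝ}

lemma isCompact_slit : IsCompact (slit c r) := isCompact_Icc.image continuous_ofReal

lemma joukInv_spec (hr : 0 < r) {z : ℂ} (hz : z ∉ slit c r) :
    1 < ‖joukInv c r z‖ ∧ jouk c r (joukInv c r z) = z := by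
  have h := exists_jouk_eq hr hz
  rw [joukInv, dif_pos h]
  exact h.choose_spec

lemma joukInv_jouk (hr : 0 < r) {ξ : ℂ} (hξ : 1 < ‖ξ‖) : joukInv c r (jouk c r ξ) = ξ := by
  obtain ⟨h1, h2⟩ := joukInv_spec hr (jouk_notMem (c := c) hr hξ)
  exact jouk_injOn hr.ne' h1 hξ.le h2

lemma one_sub_inv_sq_ne_zero {ξ : ℂ} (hξ : 1 < ‖ξ‖) : (1 - (ξ ^ 2)⁻¹ : ℂ) ≠ 0 := by
  refine ne_of_norm_lt ?_
  rw [norm_inv, norm_pow, norm_one]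
  exact inv_lt_one_of_one_lt₀ (one_lt_pow₀ hξ two_ne_zero)

/-- The derivative of `joukInv`, as a function of `ξ = joukInv z`. -/
def joukInvDeriv (r : ℝ) (ξ : ℂ) : ℂ := (r * (1 - (ξ ^ 2)⁻¹))⁻¹

lemma hasDerivAt_joukInv (hr : 0 < r) {z : ℂ} (hz : z ∉ slit c r) :
    HasDerivAt (joukInv c r) (joukInvDeriv r (joukInv c r z)) z := by
  obtain ⟨h1, h2⟩ := joukInv_spec hr hz
  set ξ := joukInv c r z with hξ
  have hξ0 := ne_zero_of_one_lt_norm h1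
  have hd : (r * (1 - (ξ ^ 2)⁻¹) : ℂ) ≠ 0 :=
    mul_ne_zero (ofReal_ne_zero.mpr hr.ne') (one_sub_inv_sq_ne_zero h1)
  have hs : HasStrictDerivAt (jouk c r) (r * (1 - (ξ ^ 2)⁻¹)) ξ := by
    have h : jouk c r = fun ξ => (c : ℂ) + r * (ξ + ξ⁻¹) := rfl
    rw [h]
    simpa [sub_eq_add_neg] using
      (((hasStrictDerivAt_id ξ).add (hasStrictDerivAt_inv hξ0)).const_mul (r : ℂ)).const_add (c : ℂ)
  have hcont : ContinuousAt (joukInv c r) z := by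
    rw [ContinuousAt, ← hξ]
    nth_rewrite 1 [← h2]
    rw [← hs.map_nhds_eq hd, tendsto_map'_iff]
    refine Tendsto.congr' ?_ tendsto_id
    filter_upwards [(isOpen_lt continuous_const continuous_norm).mem_nhds h1] with x hx
    exact (joukInv_jouk hr hx).symm
  refine hs.hasDerivAt.of_local_left_inverse hcont hd ?_
  filter_upwards [isCompact_slit.isClosed.isOpen_compl.mem_nhds hz] with x hx
  exact (joukInv_spec hr hx).2

lemma continuousOn_joukInv (hr : 0 < r) : ContinuousOn (joukInv c r) (slit c r)ᶜ :=
  fun _ hz => (hasDerivAt_joukInv hr hz).continuousAt.continuousWithinAt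

lemma continuousOn_joukInvDeriv (hr : 0 < r) : ContinuousOn (joukInvDeriv r) {ξ | 1 < ‖ξ‖} := by
  intro ξ hξ
  have h1 : (ξ ^ 2 : ℂ) ≠ 0 := pow_ne_zero 2 (ne_zero_of_one_lt_norm hξ)
  have h2 := mul_ne_zero (ofReal_ne_zero.mpr hr.ne') (one_sub_inv_sq_ne_zero hξ)
  refine ContinuousAt.continuousWithinAt ?_
  unfold joukInvDeriv
  fun_prop (disch := assumption)

lemma continuousOn_jouk : ContinuousOn (jouk c r) {ξ | ξ ≠ 0} := fun _ h =>
  (hasDerivAt_jouk h).continuousAt.continuousWithinAt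

lemma mem_slit_of_norm_eq_one (hr : 0 < r) {ξ : ℂ} (h : ‖ξ‖ = 1) : jouk c r ξ ∈ slit c r := by
  refine ⟨c + 2 * r * ξ.re, ?_, (jouk_of_norm_eq_one h).symm⟩
  have := abs_le.mp ((abs_re_le_norm ξ).trans h.le)
  constructor <;> nlinarith

/-- The images of thin closed annuli `1 ≤ |ξ| ≤ ρ` stay in any given neighbourhood of the slit. -/
lemma exists_radius (hr : 0 < r) {U : Set ℂ} (hU : IsOpen U) (hKU : slit c r ⊆ U) :
    ∃ ρ₀ > 1, ∀ ρ < ρ₀, ∀ ξ : ℂ, 1 ≤ ‖ξ‖ → ‖ξ‖ ≤ ρ → jouk c r ξ ∈ U := by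
  have hopen : IsOpen ({ξ : ℂ | ξ ≠ 0} ∩ jouk c r ⁻¹' U) :=
    continuousOn_jouk.isOpen_inter_preimage isOpen_ne hU
  obtain ⟨δ, hδ, hsub⟩ := (isCompact_sphere (0 : ℂ) 1).exists_thickening_subset_open hopen
    (fun ξ hξ => by
      have hξ' : ‖ξ‖ = 1 := by simpa using hξ
      exact ⟨ne_zero_of_norm_eq_one hξ', hKU (mem_slit_of_norm_eq_one hr hξ')⟩)
  refine ⟨1 + δ, by linarith, fun ρ hρ ξ h1 h2 => (hsub ?_).2⟩
  have h0 : 0 < ‖ξ‖ := by linarith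
  have h0' : (‖ξ‖ : ℂ) ≠ 0 := ofReal_ne_zero.mpr h0.ne'
  rw [Metric.mem_thickening_iff]
  refine ⟨ξ / ‖ξ‖, by simp [h0.ne'], ?_⟩
  have : ξ - ξ / ‖ξ‖ = ξ / ‖ξ‖ * ((‖ξ‖ - 1 : ℝ) : ℂ) := by
    push_cast; field_simp
  rw [dist_eq_norm, this, norm_mul, norm_div, norm_real, norm_norm, div_self h0.ne', one_mul,
    norm_real, Real.norm_eq_abs, abs_of_nonneg (by linarith)]
  linarith

/-! ### Circle integrals with parameters -/

lemma continuous_circleIntegral {X : Type*} [TopologicalSpace X] [FirstCountableTopology X]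
    {ρ : ℝ} {Φ : X → ℂ → ℂ}
    (hΦ : Continuous fun p : X × ℝ => Φ p.1 (circleMap 0 ρ p.2)) :
    Continuous fun x => ∮ η in C(0, ρ), Φ x η := by
  simp only [circleIntegral, deriv_circleMap, smul_eq_mul]
  refine intervalIntegral.continuous_parametric_intervalIntegral_of_continuous' ?_ _ _
  simp only [Function.uncurry_def]
  have := (continuous_circleMap 0 ρ).comp (continuous_snd (X := X) (Y := ℝ))
  exact (this.mul continuous_const).mul hΦ

lemma intervalIntegral_swap {F : ℝ → ℝ → ℂ} (hF : Continuous (Function.uncurry F)) (a b a' b' : ℝ)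
    (hab' : a' ≤ b') :
    ∫ x in a..b, ∫ y in a'..b', F x y = ∫ y in a'..b', ∫ x in a..b, F x y := by
  simp only [intervalIntegral.integral_of_le hab']
  refine intervalIntegral_integral_swap ?_
  have h := (hF.continuousOn (s := uIcc a b ×ˢ Icc a' b')).integrableOn_compact
    (μ := volume.prod volume) (isCompact_uIcc.prod isCompact_Icc)
  have h' := h.mono_set (prod_mono uIoc_subset_uIcc Ioc_subset_Icc_self)
  rwa [IntegrableOn, ← Measure.prod_restrict] at h'

lemma Loop.integral_circleIntegral_swap {Γ : Loop} {ρ : ℝ} (hρ : 0 ≤ ρ) {Φ : ℂ → ℂ → ℂ}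
    (hΦ : ContinuousOn (Function.uncurry Φ) (Γ.trace ×ˢ Metric.sphere 0 ρ)) :
    (Γ.integral fun z => ∮ η in C(0, ρ), Φ z η) = ∮ η in C(0, ρ), Γ.integral fun z => Φ z η := by
  have hc : Continuous fun p : ℝ × ℝ => Φ (Γ.pt p.1) (circleMap 0 ρ p.2) :=
    hΦ.comp_continuous (f := fun p : ℝ × ℝ => (Γ.pt p.1, circleMap 0 ρ p.2))
      ((Γ.continuous_pt.comp continuous_fst).prodMk
        ((continuous_circleMap 0 ρ).comp continuous_snd))
      fun p => ⟨Loop.pt_mem _, circleMap_mem_sphere 0 hρ _⟩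
  have h := intervalIntegral_swap
    (F := fun t θ => circleMap 0 ρ θ * I * Φ (Γ.pt t) (circleMap 0 ρ θ) * Γ.vel t) (by
      simp only [Function.uncurry_def]
      exact ((((continuous_circleMap 0 ρ).comp continuous_snd).mul continuous_const).mul hc).mul
        (Γ.continuous_vel.comp continuous_fst)) 0 1 0 (2 * Real.pi) Real.two_pi_pos.le
  simp only [Loop.integral, circleIntegral, deriv_circleMap, smul_eq_mul,
    ← intervalIntegral.integral_mul_const, ← intervalIntegral.integral_const_mul]
  rw [h]
  simp only [mul_assoc]

lemma circleIntegral_swap {ρ ρ' : ℝ} (hρ : 0 ≤ ρ) (hρ' : 0 ≤ ρ') {Φ : ℂ → ℂ → ℂ}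
    (hΦ : ContinuousOn (Function.uncurry Φ) (Metric.sphere 0 ρ ×ˢ Metric.sphere 0 ρ')) :
    (∮ ξ in C(0, ρ), ∮ η in C(0, ρ'), Φ ξ η) = ∮ η in C(0, ρ'), ∮ ξ in C(0, ρ), Φ ξ η := by
  have hc : Continuous fun p : ℝ × ℝ => Φ (circleMap 0 ρ p.1) (circleMap 0 ρ' p.2) :=
    hΦ.comp_continuous (f := fun p : ℝ × ℝ => (circleMap 0 ρ p.1, circleMap 0 ρ' p.2))
      (((continuous_circleMap 0 ρ).comp continuous_fst).prodMk
        ((continuous_circleMap 0 ρ').comp continuous_snd))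
      fun p => ⟨circleMap_mem_sphere 0 hρ _, circleMap_mem_sphere 0 hρ' _⟩
  have h := intervalIntegral_swap
    (F := fun s t => circleMap 0 ρ s * I * (circleMap 0 ρ' t * I *
      Φ (circleMap 0 ρ s) (circleMap 0 ρ' t))) (by
      simp only [Function.uncurry_def]
      exact (((continuous_circleMap 0 ρ).comp continuous_fst).mul continuous_const).mul
        ((((continuous_circleMap 0 ρ').comp continuous_snd).mul continuous_const).mul hc))
      0 (2 * Real.pi) 0 (2 * Real.pi) Real.two_pi_pos.le
  simp only [circleIntegral, deriv_circleMap, smul_eq_mul,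
    ← intervalIntegral.integral_const_mul]
  rw [h]
  simp only [mul_left_comm]

/-- Deformation of the unit circle to a circle of radius `ρ`. -/
lemma circleIntegral_deform {ρ : ℝ} (hρ : 1 ≤ ρ) {F : ℂ → ℂ}
    (hF : ∀ ξ : ℂ, 1 ≤ ‖ξ‖ → ‖ξ‖ ≤ ρ → DifferentiableAt ℂ F ξ) :
    (∮ ξ in C(0, 1), F ξ) = ∮ ξ in C(0, ρ), F ξ := by
  refine (circleIntegral_eq_of_differentiable_on_annulus_off_countable one_pos hρ countable_empty
    (fun ξ hξ => (hF ξ ?_ ?_).continuousAt.continuousWithinAt) fun ξ hξ => hF ξ ?_ ?_).symm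
  · simpa using hξ.2
  · simpa using hξ.1
  · have : 1 < ‖ξ‖ := by simpa using hξ.1.2
    exact this.le
  · have : ‖ξ‖ < ρ := by simpa using hξ.1.1
    exact this.le

/-- A circle integral depends continuously on a parameter `τ ∈ [1, 2]`. -/
lemma tendsto_circleIntegral {ρ : ℝ} (hρ : 0 ≤ ρ) {F : ℝ → ℂ → ℂ}
    (hF : ContinuousOn (Function.uncurry F) (Icc 1 2 ×ˢ Metric.sphere 0 ρ)) :
    Tendsto (fun τ => ∮ ξ in C(0, ρ), F τ ξ) (𝓝[>] 1) (𝓝 (∮ ξ in C(0, ρ), F 1 ξ)) := by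
  have h12 : (1 : ℝ) ≤ 2 := one_le_two
  have hc : Continuous fun p : ℝ × ℝ => F (projIcc 1 2 h12 p.1) (circleMap 0 ρ p.2) :=
    hF.comp_continuous (f := fun p : ℝ × ℝ => ((projIcc 1 2 h12 p.1 : ℝ), circleMap 0 ρ p.2))
      (((continuous_subtype_val.comp continuous_projIcc).comp continuous_fst).prodMk
        ((continuous_circleMap 0 ρ).comp continuous_snd))
      fun p => ⟨(projIcc 1 2 h12 p.1).2, circleMap_mem_sphere 0 hρ _⟩
  have h := (continuous_circleIntegral (Φ := fun τ : ℝ => F (projIcc 1 2 h12 τ)) hc).tendsto 1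
  have hproj : ∀ τ ∈ Icc (1 : ℝ) 2, (projIcc 1 2 h12 τ : ℝ) = τ := fun τ hτ => by
    rw [projIcc_of_mem h12 hτ]
  simp only [hproj 1 ⟨le_rfl, h12⟩] at h
  refine (h.mono_left nhdsWithin_le_nhds).congr' ?_
  filter_upwards [Ioo_mem_nhdsGT (one_lt_two : (1 : ℝ) < 2)] with τ hτ
  rw [hproj τ (Ioo_subset_Icc_self hτ)]

/-! ### From contours around the slit to circles -/

/-- The Cauchy kernel, integrated against a function that is holomorphic outside the unit disc and
vanishes at infinity; such functions are written as `H(1/η)/η`. The inversion `η = 1/u` turns the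
claim into Cauchy's formula at `1/ξ` in the disc `|u| ≤ 1/ρ`. -/
lemma circleIntegral_exterior_cauchy (hr : 0 < r) {H : ℂ → ℂ}
    (hH : DifferentiableOn ℂ H (Metric.ball 0 1)) {ρ : ℝ} (hρ : 1 < ρ) {ξ : ℂ} (hξ : ρ < ‖ξ‖) :
    (∮ η in C(0, ρ), H η⁻¹ * η⁻¹ * (jouk c r ξ - jouk c r η)⁻¹) =
      2 * Real.pi * I * (H ξ⁻¹ * ξ⁻¹ * joukInvDeriv r ξ) := by
  have hr' : (r : ℂ) ≠ 0 := ofReal_ne_zero.mpr hr.ne'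
  have hξ1 : 1 < ‖ξ‖ := hρ.trans hξ
  have hξ0 := ne_zero_of_one_lt_norm hξ1
  have hρ0 : 0 < ρ := by linarith
  have hρi : ρ⁻¹ < 1 := inv_lt_one_of_one_lt₀ hρ
  set F : ℂ → ℂ := fun u => H u * (r * (ξ - u))⁻¹ with hF
  have hFd : DifferentiableOn ℂ F (Metric.ball 0 1) := by
    refine hH.fun_mul fun u hu => ?_
    have : (r * (ξ - u) : ℂ) ≠ 0 :=
      mul_ne_zero hr' (ne_of_norm_lt (lt_trans (by simpa using hu) hξ1))
    exact DifferentiableAt.differentiableWithinAt (by fun_prop (disch := assumption))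
  have hcirc := circleIntegral_cauchy hρi hFd (w := ξ⁻¹) (by
    rw [norm_inv]; exact (inv_lt_inv₀ (by linarith) hρ0).mpr hξ)
  rw [circleIntegral_inversion _ _ hρ0.ne']
  refine Eq.trans ?_ (hcirc.trans ?_)
  · refine circleIntegral.integral_congr (inv_nonneg.mpr hρ0.le) fun u hu => ?_
    have hun : ‖u‖ = ρ⁻¹ := by simpa using hu
    have hu0 : u ≠ 0 := by
      rintro rfl
      rw [norm_zero] at hun
      exact (inv_pos.mpr hρ0).ne hun
    have e : u - ξ⁻¹ = (1 - (ξ * u)⁻¹ : ℂ) * u := by field_simp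
    rw [e]
    simp only [inv_inv, jouk_inv, jouk_sub hξ0 hu0, hF, mul_inv]
    field_simp
  · have e : (1 - (ξ ^ 2)⁻¹ : ℂ) = (ξ - ξ⁻¹) * ξ⁻¹ := by field_simp
    simp only [hF, joukInvDeriv, e, mul_inv, inv_inv]
    field_simp

/-- `Γ` is a closed curve in `U` that winds once around the slit, and not at all around points
outside `U`. -/
structure Loop.Encloses (Γ : Loop) (c r : ℝ) (U : Set ℂ) : Prop where
  trace_subset : Γ.trace ⊆ U
  trace_disjoint : ∀ z ∈ Γ.trace, z ∉ slit c r
  index_slit : ∀ w ∈ slit c r, Γ.index w = 2 * Real.pi * I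
  index_outside : ∀ w ∉ U, Γ.index w = 0

namespace Loop.Encloses

variable {Γ : Loop} {U : Set ℂ}

lemma one_lt_norm (h : Γ.Encloses c r U) (hr : 0 < r) {z : ℂ} (hz : z ∈ Γ.trace) :
    1 < ‖joukInv c r z‖ :=
  (joukInv_spec hr (h.trace_disjoint z hz)).1

lemma continuousOn_joukInv (h : Γ.Encloses c r U) (hr : 0 < r) :
    ContinuousOn (joukInv c r) Γ.trace :=
  (FMatrixLSS.continuousOn_joukInv hr).mono h.trace_disjoint

lemma continuousOn_joukInvDeriv (h : Γ.Encloses c r U) (hr : 0 < r) :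
    ContinuousOn (fun z => joukInvDeriv r (joukInv c r z)) Γ.trace :=
  (FMatrixLSS.continuousOn_joukInvDeriv hr).comp (h.continuousOn_joukInv hr)
    fun _ hz => h.one_lt_norm hr hz

/-- The curve stays outside the image of a thin annulus around the unit circle. -/
lemma exists_lt_norm (h : Γ.Encloses c r U) (hr : 0 < r) :
    ∃ ρ₁ > 1, ∀ ρ < ρ₁, ∀ z ∈ Γ.trace, ρ < ‖joukInv c r z‖ := by
  obtain ⟨z₀, hz₀, hmin⟩ := isCompact_trace.exists_isMinOn ⟨_, pt_mem (Γ := Γ) 0⟩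
    (h.continuousOn_joukInv hr).norm
  exact ⟨_, h.one_lt_norm hr hz₀, fun ρ hρ z hz => hρ.trans_le (hmin hz)⟩

lemma jouk_notMem_trace (h : Γ.Encloses c r U) (hr : 0 < r) {ρ : ℝ}
    (hlt : ∀ z ∈ Γ.trace, ρ < ‖joukInv c r z‖) {ξ : ℂ} (h1 : 1 ≤ ‖ξ‖) (h2 : ‖ξ‖ ≤ ρ) :
    jouk c r ξ ∉ Γ.trace := by
  intro hm
  rcases h1.eq_or_lt with h1 | h1
  · exact h.trace_disjoint _ hm (mem_slit_of_norm_eq_one hr h1.symm)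
  · have := hlt _ hm
    rw [joukInv_jouk hr h1] at this
    linarith

lemma index_jouk (h : Γ.Encloses c r U) (hr : 0 < r) {ρ : ℝ}
    (hlt : ∀ z ∈ Γ.trace, ρ < ‖joukInv c r z‖) {ξ : ℂ} (h1 : 1 ≤ ‖ξ‖) (h2 : ‖ξ‖ ≤ ρ) :
    Γ.index (jouk c r ξ) = 2 * Real.pi * I := by
  have h0 : 0 < ‖ξ‖ := by linarith
  -- a radial segment connects `ξ` to the unit circle within the annulus
  set seg : ℝ → ℂ := fun t => (t : ℂ) * (ξ / ‖ξ‖)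
  have hnorm : ∀ t ∈ Icc 1 ρ, ‖seg t‖ = t := fun t ht => by
    have ht0 : 0 ≤ t := by linarith [ht.1]
    simp only [seg]
    rw [norm_mul, norm_div, norm_real, norm_real, norm_norm, div_self h0.ne', mul_one,
      Real.norm_of_nonneg ht0]
  have hcont : ContinuousOn (fun t => jouk c r (seg t)) (Icc 1 ρ) := by
    refine continuousOn_jouk.comp (by fun_prop) fun t ht h0 => ?_
    have := hnorm t ht
    rw [h0, norm_zero] at this
    linarith [ht.1]
  have hpre := isPreconnected_Icc.image _ hcont
  have hsub : (fun t => jouk c r (seg t)) '' Icc 1 ρ ⊆ Γ.traceᶜ := by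
    rintro _ ⟨t, ht, rfl⟩
    exact h.jouk_notMem_trace hr hlt (by rw [hnorm t ht]; exact ht.1)
      (by rw [hnorm t ht]; exact ht.2)
  have hξseg : seg ‖ξ‖ = ξ := by
    have : (‖ξ‖ : ℂ) ≠ 0 := ofReal_ne_zero.mpr h0.ne'
    simp only [seg]
    field_simp
  have h1ρ : (1 : ℝ) ∈ Icc 1 ρ := ⟨le_rfl, h1.trans h2⟩
  have heq := index_eq_of_isPreconnected hpre hsub (mem_image_of_mem _ ⟨h1, h2⟩)
    (mem_image_of_mem _ h1ρ)
  simp only [hξseg] at heq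
  rw [heq]
  exact h.index_slit _ (mem_slit_of_norm_eq_one hr (hnorm 1 h1ρ))

/-- A contour integral of `f` against a kernel that is holomorphic off the slit equals an integral
over a circle in the Joukowski coordinate: the kernel is a superposition of Cauchy kernels with
poles on the image of the circle, and Cauchy's formula evaluates `f` at these poles. -/
theorem integral_eq_circleIntegral (h : Γ.Encloses c r U) (hr : 0 < r) (hU : IsOpen U) {f : ℂ → ℂ}
    (hf : DifferentiableOn ℂ f U) {H G : ℂ → ℂ} (hH : DifferentiableOn ℂ H (Metric.ball 0 1))
    (hG : ∀ η : ℂ, 1 < ‖η‖ → G η = H η⁻¹ * η⁻¹) {ρ : ℝ} (hρ : 1 < ρ)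
    (hρU : ∀ ξ : ℂ, 1 ≤ ‖ξ‖ → ‖ξ‖ ≤ ρ → jouk c r ξ ∈ U)
    (hlt : ∀ z ∈ Γ.trace, ρ < ‖joukInv c r z‖) :
    Γ.integral (fun z => f z * (G (joukInv c r z) * joukInvDeriv r (joukInv c r z))) =
      ∮ η in C(0, ρ), f (jouk c r η) * G η := by
  have hρ0 : 0 < ρ := by linarith
  have h2πI : (2 * Real.pi * I : ℂ) ≠ 0 := two_pi_I_ne_zero
  have hsph : ∀ {η : ℂ}, η ∈ Metric.sphere (0 : ℂ) ρ → ‖η‖ = ρ := fun hη => by simpa using hη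
  set Φ : ℂ → ℂ → ℂ := fun z η =>
    H η⁻¹ * η⁻¹ * (2 * Real.pi * I)⁻¹ * (f z * (z - jouk c r η)⁻¹) with hΦ
  have hcont : ContinuousOn (Function.uncurry Φ) (Γ.trace ×ˢ Metric.sphere 0 ρ) := by
    rintro ⟨z, η⟩ ⟨hz, hη⟩
    have hηn := hsph hη
    have hη1 : 1 < ‖η‖ := by rw [hηn]; exact hρ
    have hη0 := ne_zero_of_one_lt_norm hη1
    have hne : z - jouk c r η ≠ 0 := fun h0 =>
      h.jouk_notMem_trace hr hlt hη1.le hηn.le (sub_eq_zero.mp h0 ▸ hz)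
    have c1 : ContinuousAt (fun p : ℂ × ℂ => H p.2⁻¹) (z, η) := by
      have hinv : η⁻¹ ∈ Metric.ball (0 : ℂ) 1 := by simpa using norm_inv_lt_one hη1
      exact ContinuousAt.comp_of_eq
        (hH.differentiableAt (Metric.isOpen_ball.mem_nhds hinv)).continuousAt
        (continuousAt_snd.inv₀ hη0) rfl
    have c2 : ContinuousAt (fun p : ℂ × ℂ => f p.1) (z, η) :=
      ContinuousAt.comp_of_eq
        (hf.differentiableAt (hU.mem_nhds (h.trace_subset hz))).continuousAt continuousAt_fst rfl
    have c3 : ContinuousAt (fun p : ℂ × ℂ => jouk c r p.2) (z, η) :=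
      ContinuousAt.comp_of_eq (g := jouk c r) (hasDerivAt_jouk hη0).continuousAt
        continuousAt_snd rfl
    have c4 : ContinuousAt (fun p : ℂ × ℂ => p.2⁻¹) (z, η) := continuousAt_snd.inv₀ hη0
    exact (((c1.mul c4).mul continuousAt_const).mul
      (c2.mul ((continuousAt_fst.sub c3).inv₀ hne))).continuousWithinAt
  calc Γ.integral (fun z => f z * (G (joukInv c r z) * joukInvDeriv r (joukInv c r z)))
      = Γ.integral fun z => ∮ η in C(0, ρ), Φ z η := by
        refine integral_congr fun z hz => ?_
        obtain ⟨h1, h2⟩ := joukInv_spec hr (h.trace_disjoint z hz)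
        have key := circleIntegral_exterior_cauchy (c := c) hr hH hρ (hlt z hz)
        rw [h2] at key
        have : (∮ η in C(0, ρ), Φ z η) = f z * (2 * Real.pi * I)⁻¹ *
            ∮ η in C(0, ρ), H η⁻¹ * η⁻¹ * (z - jouk c r η)⁻¹ := by
          rw [← circleIntegral.integral_const_mul]
          congr 1
          ext η
          simp only [hΦ]
          ring
        rw [this, key, hG _ h1]
        field_simp
    _ = ∮ η in C(0, ρ), Γ.integral fun z => Φ z η := integral_circleIntegral_swap hρ0.le hcont
    _ = ∮ η in C(0, ρ), f (jouk c r η) * G η := by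
        refine circleIntegral.integral_congr hρ0.le fun η hη => ?_
        have hηn := hsph hη
        have hη1 : 1 < ‖η‖ := by rw [hηn]; exact hρ
        simp only [hΦ, integral_const_mul]
        rw [cauchy_formula hU hf h.trace_subset h.index_outside (hρU η hη1.le hηn.le)
          (h.jouk_notMem_trace hr hlt hη1.le hηn.le), h.index_jouk hr hlt hη1.le hηn.le, hG η hη1]
        field_simp

end Loop.Encloses

end FMatrixLSS

namespace FMatrixLSS

/-! ### Contours as loops -/

/-- A closed curve that is `C¹` on `[0, 1]` can be replaced by a `Loop` with the same contour
integrals. The values of `deriv γ` at the end points, which may be junk, do not matter. -/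
lemma exists_loop {γ : ℝ → ℂ} (hγ : ContDiffOn ℝ 1 γ (Icc 0 1)) (hcl : γ 0 = γ 1) :
    ∃ Γ : Loop, Γ.trace = γ '' Icc 0 1 ∧ ∀ g, contourIntegral γ g = Γ.integral g := by
  have h01 : (0 : ℝ) ≤ 1 := zero_le_one
  have hc := hγ.continuousOn
  have hd := hγ.continuousOn_derivWithin (uniqueDiffOn_Icc one_pos) le_rfl
  have hrange : range (IccExtend h01 (fun t : Icc (0 : ℝ) 1 => γ t)) = γ '' Icc 0 1 := by
    rw [IccExtend_range, ← image_eq_range]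
  have hder : ∀ t ∈ Ioo (0 : ℝ) 1, HasDerivAt γ (derivWithin γ (Icc 0 1) t) t := fun t ht =>
    ((hγ.differentiableOn one_ne_zero t (Ioo_subset_Icc_self ht)).hasDerivWithinAt).hasDerivAt
      (Icc_mem_nhds ht.1 ht.2)
  refine ⟨{ pt := IccExtend h01 (fun t : Icc (0 : ℝ) 1 => γ t)
            vel := IccExtend h01 (fun t : Icc (0 : ℝ) 1 => derivWithin γ (Icc 0 1) t)
            continuous_pt := (continuousOn_iff_continuous_domRestrict.mp hc).Icc_extend'
            continuous_vel := (continuousOn_iff_continuous_domRestrict.mp hd).Icc_extend'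
            hasDerivAt := fun t ht => ?_
            closed := by simpa using hcl
            isCompact_range := by rw [hrange]; exact isCompact_Icc.image_of_continuousOn hc },
    hrange, fun g => ?_⟩
  · rw [IccExtend_of_mem _ _ (Ioo_subset_Icc_self ht)]
    refine (hder t ht).congr_of_eventuallyEq ?_
    filter_upwards [Icc_mem_nhds ht.1 ht.2] with x hx
    rw [IccExtend_of_mem _ _ hx]
  · simp only [contourIntegral, Loop.integral, intervalIntegral.integral_of_le h01,
      integral_Ioc_eq_integral_Ioo]
    refine setIntegral_congr_fun measurableSet_Ioo fun t ht => ?_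
    simp only [IccExtend_of_mem h01 _ (Ioo_subset_Icc_self ht), (hder t ht).deriv]

section Parameters

variable {y₁ y₂ : ℝ}

/-- The midpoint of the support `[a', b']`. -/
def fCenter (y₁ y₂ : ℝ) : ℝ := (1 + hPrime y₁ y₂ ^ 2) / (1 - y₂) ^ 2

/-- A quarter of the length of the support `[a', b']`. -/
def fRadius (y₁ y₂ : ℝ) : ℝ := hPrime y₁ y₂ / (1 - y₂) ^ 2

lemma fRadius_pos (hy₁ : 0 < y₁) (hy₂ : 0 < y₂) (hy₂' : y₂ < 1) : 0 < fRadius y₁ y₂ :=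
  radius_pos hy₁ hy₂ hy₂'

/-- The coordinate `ξ` with `|ξ| > 1` of a point off the support. -/
def fInv (y₁ y₂ : ℝ) (z : ℂ) : ℂ := joukInv (fCenter y₁ y₂) (fRadius y₁ y₂) z

/-- The derivative of the coordinate `ξ`. -/
def fInvDeriv (y₁ y₂ : ℝ) (z : ℂ) : ℂ := joukInvDeriv (fRadius y₁ y₂) (fInv y₁ y₂ z)

lemma contSupport_eq : contSupport y₁ y₂ = slit (fCenter y₁ y₂) (fRadius y₁ y₂) := by
  rw [contSupport, edgeA_eq, edgeB_eq, slit, fCenter, fRadius]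

lemma IsContour.exists_encloses {U : Set ℂ} {γ : ℝ → ℂ} (h : IsContour y₁ y₂ U γ) :
    ∃ Γ : Loop, Γ.Encloses (fCenter y₁ y₂) (fRadius y₁ y₂) U ∧ Γ.trace = γ '' Icc 0 1 ∧
      (∀ z ∈ Γ.trace, z ≠ 0) ∧ ∀ g, contourIntegral γ g = Γ.integral g := by
  obtain ⟨Γ, htr, hint⟩ := exists_loop h.contDiffOn h.closed
  have hindex : ∀ w, Γ.index w = 2 * Real.pi * I * windingNumber γ w := fun w => by
    rw [windingNumber, hint, mul_inv_cancel_left₀ two_pi_I_ne_zero]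
    rfl
  refine ⟨Γ, ⟨?_, ?_, fun w hw => ?_, fun w hw => ?_⟩, htr, ?_, hint⟩
  · rw [htr]
    rintro _ ⟨t, ht, rfl⟩
    exact h.mem_domain t ht
  · rw [htr, ← contSupport_eq]
    rintro _ ⟨t, ht, rfl⟩
    exact h.off_support t ht
  · rw [← contSupport_eq] at hw
    rw [hindex, h.winding_support w hw, mul_one]
  · rw [hindex, h.winding_outside w hw, mul_zero]
  · rw [htr]
    rintro _ ⟨t, ht, rfl⟩
    exact h.ne_zero t ht

/-! ### The integrands in the Joukowski coordinate -/

lemma one_lt_norm_fInv (hy₁ : 0 < y₁) (hy₂ : 0 < y₂) (hy₂' : y₂ < 1) {z : ℂ}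
    (hz : z ∉ contSupport y₁ y₂) : 1 < ‖fInv y₁ y₂ z‖ := by
  rw [contSupport_eq] at hz
  exact (joukInv_spec (fRadius_pos hy₁ hy₂ hy₂') hz).1

lemma hasDerivAt_fInv (hy₁ : 0 < y₁) (hy₂ : 0 < y₂) (hy₂' : y₂ < 1) {z : ℂ}
    (hz : z ∉ contSupport y₁ y₂) : HasDerivAt (fInv y₁ y₂) (fInvDeriv y₁ y₂ z) z := by
  rw [contSupport_eq] at hz
  exact hasDerivAt_joukInv (fRadius_pos hy₁ hy₂ hy₂') hz

lemma m0_eq (hy₁ : 0 < y₁) (hy₂ : 0 < y₂) (hy₂' : y₂ < 1) {z : ℂ}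
    (hz : z ∉ contSupport y₁ y₂) (hz0 : z ≠ 0) :
    m0 y₁ y₂ z = -(1 + hPrime y₁ y₂ * fInv y₁ y₂ z) / (1 - y₂) := by
  rw [contSupport_eq] at hz
  obtain ⟨h1, h2⟩ := joukInv_spec (fRadius_pos hy₁ hy₂ hy₂') hz
  have h3 : fJouk y₁ y₂ (fInv y₁ y₂ z) = z := h2
  have := m0_fJouk hy₁ hy₂ hy₂' h1 (h3.trans_ne hz0)
  rwa [show joukInv _ _ z = fInv y₁ y₂ z from rfl, h3] at this

lemma m0_eventuallyEq (hy₁ : 0 < y₁) (hy₂ : 0 < y₂) (hy₂' : y₂ < 1) {z : ℂ}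
    (hz : z ∉ contSupport y₁ y₂) (hz0 : z ≠ 0) :
    ∀ᶠ w in 𝓝 z, m0 y₁ y₂ w = -(1 + hPrime y₁ y₂ * fInv y₁ y₂ w) / (1 - y₂) ∧
      1 < ‖fInv y₁ y₂ w‖ := by
  have hcl : IsClosed (contSupport y₁ y₂) := contSupport_eq ▸ isCompact_slit.isClosed
  filter_upwards [hcl.isOpen_compl.mem_nhds hz, isOpen_ne.mem_nhds hz0] with w hw hw0
  exact ⟨m0_eq hy₁ hy₂ hy₂' hw hw0, one_lt_norm_fInv hy₁ hy₂ hy₂' hw⟩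

lemma deriv_m0 (hy₁ : 0 < y₁) (hy₂ : 0 < y₂) (hy₂' : y₂ < 1) {z : ℂ}
    (hz : z ∉ contSupport y₁ y₂) (hz0 : z ≠ 0) :
    deriv (m0 y₁ y₂) z = -(hPrime y₁ y₂ / (1 - y₂)) * fInvDeriv y₁ y₂ z := by
  have h1 : m0 y₁ y₂ =ᶠ[𝓝 z] fun w => -(1 + hPrime y₁ y₂ * fInv y₁ y₂ w) / (1 - y₂) :=
    (m0_eventuallyEq hy₁ hy₂ hy₂' hz hz0).mono fun w hw => hw.1
  rw [h1.deriv_eq]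
  have := ((((hasDerivAt_fInv hy₁ hy₂ hy₂' hz).const_mul (hPrime y₁ y₂ : ℂ)).const_add 1).fun_neg
    ).div_const (1 - y₂ : ℂ)
  rw [this.deriv]
  ring

lemma logDeriv_comp_fInv (hy₁ : 0 < y₁) (hy₂ : 0 < y₂) (hy₂' : y₂ < 1) {z : ℂ}
    (hz : z ∉ contSupport y₁ y₂) {F R : ℂ → ℂ} {R' : ℂ}
    (hF : ∀ᶠ w in 𝓝 z, F w = R (fInv y₁ y₂ w)) (hR : HasDerivAt R R' (fInv y₁ y₂ z)) :
    logDeriv F z = R' / R (fInv y₁ y₂ z) * fInvDeriv y₁ y₂ z := by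
  have h1 : F =ᶠ[𝓝 z] R ∘ fInv y₁ y₂ := hF
  rw [logDeriv_apply, h1.deriv_eq, h1.eq_of_nhds,
    (hR.comp z (hasDerivAt_fInv hy₁ hy₂ hy₂' hz)).deriv, Function.comp_apply]
  ring

lemma sq_sub_ne_zero (hy₁ : 0 < y₁) (hy₂ : 0 < y₂) (hy₂' : y₂ < 1) {ξ : ℂ} (hξ : 1 < ‖ξ‖) :
    (hPrime y₁ y₂ : ℂ) ^ 2 * ξ ^ 2 - y₂ ≠ 0 := by
  refine ne_of_norm_lt ?_
  have h := hPrime_pos hy₁ hy₂ hy₂'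
  have h1 := lt_sq_hPrime hy₁ hy₂ hy₂'
  rw [norm_mul, norm_pow, norm_pow, norm_real, norm_real, Real.norm_of_nonneg h.le,
    Real.norm_of_nonneg hy₂.le]
  have : 1 < ‖ξ‖ ^ 2 := one_lt_pow₀ hξ two_ne_zero
  nlinarith

lemma one_add_m0 (hy₂' : y₂ < 1) (h : ℂ) (ξ : ℂ) :
    1 + -(1 + h * ξ) / (1 - y₂ : ℂ) = -(y₂ + h * ξ) / (1 - y₂) := by
  have h1C : (1 - y₂ : ℂ) ≠ 0 := by exact_mod_cast (sub_pos.mpr hy₂').ne'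
  field_simp
  ring

/-- The first logarithmic derivative in the mean. -/
lemma logDeriv_ratio (hy₁ : 0 < y₁) (hy₂ : 0 < y₂) (hy₂' : y₂ < 1) {z : ℂ}
    (hz : z ∉ contSupport y₁ y₂) (hz0 : z ≠ 0) :
    logDeriv (fun w => ((1 - y₂) * m0 y₁ y₂ w ^ 2 + 2 * m0 y₁ y₂ w + 1 - y₁) /
        ((1 - y₂) * m0 y₁ y₂ w ^ 2 + 2 * m0 y₁ y₂ w + 1)) z =
      ((fInv y₁ y₂ z - 1)⁻¹ + (fInv y₁ y₂ z + 1)⁻¹ -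
        2 * fInv y₁ y₂ z * (fInv y₁ y₂ z ^ 2 - y₂ / hPrime y₁ y₂ ^ 2)⁻¹) *
        fInvDeriv y₁ y₂ z := by
  have h1C : (1 - y₂ : ℂ) ≠ 0 := by exact_mod_cast (sub_pos.mpr hy₂').ne'
  have hhC : (hPrime y₁ y₂ : ℂ) ≠ 0 := ofReal_ne_zero.mpr (hPrime_pos hy₁ hy₂ hy₂').ne'
  have hsqC : (hPrime y₁ y₂ : ℂ) ^ 2 = y₁ + y₂ - y₁ * y₂ := by
    exact_mod_cast sq_hPrime hy₁ hy₂ hy₂'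
  have hξ := one_lt_norm_fInv hy₁ hy₂ hy₂' hz
  have hne := sq_sub_ne_zero hy₁ hy₂ hy₂' hξ
  set h : ℂ := (hPrime y₁ y₂ : ℂ)
  have hF : ∀ᶠ w in 𝓝 z, ((1 - y₂) * m0 y₁ y₂ w ^ 2 + 2 * m0 y₁ y₂ w + 1 - y₁) /
        ((1 - y₂) * m0 y₁ y₂ w ^ 2 + 2 * m0 y₁ y₂ w + 1) =
      (fun ξ : ℂ => h ^ 2 * (ξ ^ 2 - 1) / (h ^ 2 * ξ ^ 2 - y₂)) (fInv y₁ y₂ w) := by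
    filter_upwards [m0_eventuallyEq hy₁ hy₂ hy₂' hz hz0] with w hw
    have hne' := sq_sub_ne_zero hy₁ hy₂ hy₂' hw.2
    rw [hw.1]
    have e1 : (1 - y₂ : ℂ) * (-(1 + h * fInv y₁ y₂ w) / (1 - y₂)) ^ 2 +
        2 * (-(1 + h * fInv y₁ y₂ w) / (1 - y₂)) + 1 =
        (h ^ 2 * fInv y₁ y₂ w ^ 2 - y₂) / (1 - y₂) := by
      field_simp; ring
    have e2 : (h ^ 2 * fInv y₁ y₂ w ^ 2 - y₂) / (1 - y₂) - y₁ =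
        h ^ 2 * (fInv y₁ y₂ w ^ 2 - 1) / (1 - y₂) := by
      field_simp; linear_combination hsqC
    rw [e1, e2, div_div_div_cancel_right₀ h1C]
  set ξ := fInv y₁ y₂ z with hξdef
  have hd1 : HasDerivAt (fun ξ : ℂ => h ^ 2 * (ξ ^ 2 - 1)) (h ^ 2 * (2 * ξ)) ξ := by
    simpa using ((hasDerivAt_pow 2 ξ).sub_const 1).const_mul (h ^ 2)
  have hd2 : HasDerivAt (fun ξ : ℂ => h ^ 2 * ξ ^ 2 - y₂) (h ^ 2 * (2 * ξ)) ξ := by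
    simpa using ((hasDerivAt_pow 2 ξ).const_mul (h ^ 2)).sub_const (y₂ : ℂ)
  rw [logDeriv_comp_fInv hy₁ hy₂ hy₂' hz hF (hd1.fun_div hd2 hne), ← hξdef]
  have h3 : ξ - 1 ≠ 0 := ne_of_norm_lt (by rwa [norm_one])
  have h4 : ξ + 1 ≠ 0 := by simpa using ne_of_norm_lt (ξ := -1) (η := ξ) (by simpa using hξ)
  have e5 : ξ ^ 2 - 1 = (ξ - 1) * (ξ + 1) := by ring
  have e6 : ξ ^ 2 - y₂ / h ^ 2 = (h ^ 2 * ξ ^ 2 - y₂) / h ^ 2 := by field_simp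
  rw [e6, e5]
  congr 1
  field_simp
  ring

/-- The factor `1 - y₂ m₀²/(1 + m₀)²` in the Joukowski coordinate. -/
def fFactor (y₁ y₂ : ℝ) (ξ : ℂ) : ℂ :=
  (1 - y₂) * (hPrime y₁ y₂ ^ 2 * ξ ^ 2 - y₂) / (y₂ + hPrime y₁ y₂ * ξ) ^ 2

lemma factor_eq (hy₁ : 0 < y₁) (hy₂ : 0 < y₂) (hy₂' : y₂ < 1) {ξ : ℂ} (hξ : 1 < ‖ξ‖) :
    1 - y₂ * (-(1 + hPrime y₁ y₂ * ξ) / (1 - y₂)) ^ 2 /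
      (1 + -(1 + hPrime y₁ y₂ * ξ) / (1 - y₂)) ^ 2 = fFactor y₁ y₂ ξ := by
  have h1C : (1 - y₂ : ℂ) ≠ 0 := by exact_mod_cast (sub_pos.mpr hy₂').ne'
  have h3 := y₂_add_ne_zero hy₁ hy₂ hy₂' hξ.le
  rw [one_add_m0 hy₂', fFactor]
  field_simp
  ring

lemma fFactor_ne_zero (hy₁ : 0 < y₁) (hy₂ : 0 < y₂) (hy₂' : y₂ < 1) {ξ : ℂ} (hξ : 1 < ‖ξ‖) :
    fFactor y₁ y₂ ξ ≠ 0 := by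
  have h1C : (1 - y₂ : ℂ) ≠ 0 := by exact_mod_cast (sub_pos.mpr hy₂').ne'
  exact div_ne_zero (mul_ne_zero h1C (sq_sub_ne_zero hy₁ hy₂ hy₂' hξ))
    (pow_ne_zero 2 (y₂_add_ne_zero hy₁ hy₂ hy₂' hξ.le))

lemma hasDerivAt_fFactor (hy₁ : 0 < y₁) (hy₂ : 0 < y₂) (hy₂' : y₂ < 1) {ξ : ℂ} (hξ : 1 < ‖ξ‖) :
    HasDerivAt (fFactor y₁ y₂) (2 * (y₂ * (1 - y₂) / hPrime y₁ y₂) *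
      ((ξ + 1 / hPrime y₁ y₂) / (ξ + y₂ / hPrime y₁ y₂) ^ 3)) ξ := by
  have hhC : (hPrime y₁ y₂ : ℂ) ≠ 0 := ofReal_ne_zero.mpr (hPrime_pos hy₁ hy₂ hy₂').ne'
  have h3 := y₂_add_ne_zero hy₁ hy₂ hy₂' hξ.le
  set h : ℂ := (hPrime y₁ y₂ : ℂ) with hh
  have hd1 : HasDerivAt (fun ξ : ℂ => (1 - y₂ : ℂ) * (h ^ 2 * ξ ^ 2 - y₂))
      ((1 - y₂) * (h ^ 2 * (2 * ξ))) ξ := by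
    simpa using (((hasDerivAt_pow 2 ξ).const_mul (h ^ 2)).sub_const (y₂ : ℂ)).const_mul (1 - y₂ : ℂ)
  have hd2 : HasDerivAt (fun ξ : ℂ => (y₂ + h * ξ) ^ 2) (2 * (y₂ + h * ξ) * h) ξ := by
    simpa using (((hasDerivAt_id ξ).const_mul h).const_add (y₂ : ℂ)).fun_pow 2
  have hd := hd1.fun_div hd2 (pow_ne_zero 2 h3)
  have hfun : fFactor y₁ y₂ = fun ξ : ℂ => (1 - y₂ : ℂ) * (h ^ 2 * ξ ^ 2 - y₂) / (y₂ + h * ξ) ^ 2 :=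
    rfl
  rw [hfun]
  refine hd.congr_deriv ?_
  have e1 : ξ + y₂ / h = (y₂ + h * ξ) / h := by field_simp; ring
  rw [e1]
  field_simp
  ring

lemma factor_eventuallyEq (hy₁ : 0 < y₁) (hy₂ : 0 < y₂) (hy₂' : y₂ < 1) {z : ℂ}
    (hz : z ∉ contSupport y₁ y₂) (hz0 : z ≠ 0) :
    ∀ᶠ w in 𝓝 z, 1 - y₂ * m0 y₁ y₂ w ^ 2 / (1 + m0 y₁ y₂ w) ^ 2 =
      fFactor y₁ y₂ (fInv y₁ y₂ w) := by
  filter_upwards [m0_eventuallyEq hy₁ hy₂ hy₂' hz hz0] with w hw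
  rw [hw.1, factor_eq hy₁ hy₂ hy₂' hw.2]

/-- The second logarithmic derivative in the mean. -/
lemma logDeriv_factor (hy₁ : 0 < y₁) (hy₂ : 0 < y₂) (hy₂' : y₂ < 1) {z : ℂ}
    (hz : z ∉ contSupport y₁ y₂) (hz0 : z ≠ 0) :
    logDeriv (fun w => 1 - y₂ * m0 y₁ y₂ w ^ 2 / (1 + m0 y₁ y₂ w) ^ 2) z =
      (2 * fInv y₁ y₂ z * (fInv y₁ y₂ z ^ 2 - y₂ / hPrime y₁ y₂ ^ 2)⁻¹ -
        2 * (fInv y₁ y₂ z + y₂ / hPrime y₁ y₂)⁻¹) * fInvDeriv y₁ y₂ z := by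
  have h1C : (1 - y₂ : ℂ) ≠ 0 := by exact_mod_cast (sub_pos.mpr hy₂').ne'
  have hhC : (hPrime y₁ y₂ : ℂ) ≠ 0 := ofReal_ne_zero.mpr (hPrime_pos hy₁ hy₂ hy₂').ne'
  have hξ := one_lt_norm_fInv hy₁ hy₂ hy₂' hz
  have hne := sq_sub_ne_zero hy₁ hy₂ hy₂' hξ
  have h3 := y₂_add_ne_zero hy₁ hy₂ hy₂' hξ.le
  rw [logDeriv_comp_fInv hy₁ hy₂ hy₂' hz (factor_eventuallyEq hy₁ hy₂ hy₂' hz hz0)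
    (hasDerivAt_fFactor hy₁ hy₂ hy₂' hξ), fFactor]
  set h : ℂ := (hPrime y₁ y₂ : ℂ)
  set ξ := fInv y₁ y₂ z
  have e1 : ξ + y₂ / h = (y₂ + h * ξ) / h := by field_simp; ring
  have e6 : ξ ^ 2 - y₂ / h ^ 2 = (h ^ 2 * ξ ^ 2 - y₂) / h ^ 2 := by field_simp
  rw [e1, e6]
  congr 1
  field_simp
  ring

/-- The integrand of the `β_y`-term of the mean: `Q d log Q = dQ`. -/
lemma factor_mul_logDeriv (hy₁ : 0 < y₁) (hy₂ : 0 < y₂) (hy₂' : y₂ < 1) {z : ℂ}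
    (hz : z ∉ contSupport y₁ y₂) (hz0 : z ≠ 0) :
    (1 - y₂ * m0 y₁ y₂ z ^ 2 / (1 + m0 y₁ y₂ z) ^ 2) *
      logDeriv (fun w => 1 - y₂ * m0 y₁ y₂ w ^ 2 / (1 + m0 y₁ y₂ w) ^ 2) z =
    2 * (y₂ * (1 - y₂) / hPrime y₁ y₂) *
      ((fInv y₁ y₂ z + 1 / hPrime y₁ y₂) / (fInv y₁ y₂ z + y₂ / hPrime y₁ y₂) ^ 3 *
        fInvDeriv y₁ y₂ z) := by
  have hξ := one_lt_norm_fInv hy₁ hy₂ hy₂' hz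
  have hev := factor_eventuallyEq hy₁ hy₂ hy₂' hz hz0
  rw [logDeriv_comp_fInv hy₁ hy₂ hy₂' hz hev (hasDerivAt_fFactor hy₁ hy₂ hy₂' hξ),
    hev.self_of_nhds, ← mul_assoc, mul_div_cancel₀ _ (fFactor_ne_zero hy₁ hy₂ hy₂' hξ)]
  ring

/-- Powers of `1 + m₀` in the Joukowski coordinate. -/
lemma deriv_m0_div_pow (hy₁ : 0 < y₁) (hy₂ : 0 < y₂) (hy₂' : y₂ < 1) {z : ℂ}
    (hz : z ∉ contSupport y₁ y₂) (hz0 : z ≠ 0) (n : ℕ) :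
    ((1 + m0 y₁ y₂ z) ^ (n + 1))⁻¹ * deriv (m0 y₁ y₂) z =
      (-((1 - y₂) / hPrime y₁ y₂)) ^ n *
        (1 / (fInv y₁ y₂ z + y₂ / hPrime y₁ y₂) ^ (n + 1) * fInvDeriv y₁ y₂ z) := by
  have h1C : (1 - y₂ : ℂ) ≠ 0 := by exact_mod_cast (sub_pos.mpr hy₂').ne'
  have hhC : (hPrime y₁ y₂ : ℂ) ≠ 0 := ofReal_ne_zero.mpr (hPrime_pos hy₁ hy₂ hy₂').ne'
  have hξ := one_lt_norm_fInv hy₁ hy₂ hy₂' hz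
  have h3 := y₂_add_ne_zero hy₁ hy₂ hy₂' hξ.le
  rw [deriv_m0 hy₁ hy₂ hy₂' hz hz0, m0_eq hy₁ hy₂ hy₂' hz hz0, one_add_m0 hy₂']
  set h : ℂ := (hPrime y₁ y₂ : ℂ)
  set ξ := fInv y₁ y₂ z
  have e1 : -(y₂ + h * ξ) / (1 - y₂) = -(h / (1 - y₂)) * (ξ + y₂ / h) := by field_simp; ring
  have e2 : (-((1 - y₂) / h) : ℂ) = (-(h / (1 - y₂)))⁻¹ := by
    rw [inv_neg, inv_div]
  have h4 : -(h / (1 - y₂ : ℂ)) ≠ 0 := neg_ne_zero.mpr (div_ne_zero hhC h1C)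
  rw [e1, e2, mul_pow, mul_inv, inv_pow]
  generalize -(h / (1 - y₂ : ℂ)) = K at *
  rw [one_div, pow_succ K]
  field_simp

/-- The singular part of the covariance kernel is the square of a Cauchy kernel in `z`; the
remainder is regular, since `ξ₁ξ₂ ≠ 1` off the support. -/
lemma covariance_kernel (hy₁ : 0 < y₁) (hy₂ : 0 < y₂) (hy₂' : y₂ < 1) {z₁ z₂ : ℂ}
    (hz₁ : z₁ ∉ contSupport y₁ y₂) (hz₁0 : z₁ ≠ 0) (hz₂ : z₂ ∉ contSupport y₁ y₂) (hz₂0 : z₂ ≠ 0)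
    (hne : z₁ ≠ z₂) :
    ((m0 y₁ y₂ z₁ - m0 y₁ y₂ z₂) ^ 2)⁻¹ * deriv (m0 y₁ y₂) z₁ * deriv (m0 y₁ y₂) z₂ =
      ((z₂ - z₁) ^ 2)⁻¹ + ((fInv y₁ y₂ z₁ * fInv y₁ y₂ z₂ - 1) ^ 2)⁻¹ *
        fInvDeriv y₁ y₂ z₁ * fInvDeriv y₁ y₂ z₂ := by
  have h1C : (1 - y₂ : ℂ) ≠ 0 := by exact_mod_cast (sub_pos.mpr hy₂').ne'
  have hhC : (hPrime y₁ y₂ : ℂ) ≠ 0 := ofReal_ne_zero.mpr (hPrime_pos hy₁ hy₂ hy₂').ne'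
  have hr := fRadius_pos hy₁ hy₂ hy₂'
  have hrC : (fRadius y₁ y₂ : ℂ) ≠ 0 := ofReal_ne_zero.mpr hr.ne'
  have hξ₁ := one_lt_norm_fInv hy₁ hy₂ hy₂' hz₁
  have hξ₂ := one_lt_norm_fInv hy₁ hy₂ hy₂' hz₂
  rw [deriv_m0 hy₁ hy₂ hy₂' hz₁ hz₁0, deriv_m0 hy₁ hy₂ hy₂' hz₂ hz₂0,
    m0_eq hy₁ hy₂ hy₂' hz₁ hz₁0, m0_eq hy₁ hy₂ hy₂' hz₂ hz₂0]
  rw [contSupport_eq] at hz₁ hz₂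
  have e₁ : jouk (fCenter y₁ y₂) (fRadius y₁ y₂) (fInv y₁ y₂ z₁) = z₁ := (joukInv_spec hr hz₁).2
  have e₂ : jouk (fCenter y₁ y₂) (fRadius y₁ y₂) (fInv y₁ y₂ z₂) = z₂ := (joukInv_spec hr hz₂).2
  simp only [fInvDeriv, joukInvDeriv]
  set h : ℂ := (hPrime y₁ y₂ : ℂ)
  set ξ₁ := fInv y₁ y₂ z₁
  set ξ₂ := fInv y₁ y₂ z₂
  have h10 := ne_zero_of_one_lt_norm hξ₁
  have h20 := ne_zero_of_one_lt_norm hξ₂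
  have h12 : ξ₁ - ξ₂ ≠ 0 := fun h0 => hne (by rw [← e₁, ← e₂, sub_eq_zero.mp h0])
  have hprod : ξ₁ * ξ₂ - 1 ≠ 0 := mul_sub_one_ne_zero hξ₁ hξ₂.le
  have hsq : ∀ {ξ : ℂ}, 1 < ‖ξ‖ → ξ ^ 2 - 1 ≠ 0 := fun {ξ} h => by
    rw [sq]; exact mul_sub_one_ne_zero h h.le
  have hs₁ := hsq hξ₁
  have hs₂ := hsq hξ₂
  have hz : z₂ - z₁ = -(fRadius y₁ y₂ * (ξ₁ - ξ₂) * (ξ₁ * ξ₂ - 1) / (ξ₁ * ξ₂)) := by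
    rw [← neg_sub, ← e₁, ← e₂, jouk_sub h10 h20]; field_simp
  have hm : -(1 + h * ξ₁) / (1 - y₂ : ℂ) - -(1 + h * ξ₂) / (1 - y₂) =
      -(h / (1 - y₂)) * (ξ₁ - ξ₂) := by ring
  have hi : ∀ {ξ : ℂ}, ξ ≠ 0 → 1 - (ξ ^ 2)⁻¹ = (ξ ^ 2 - 1) / ξ ^ 2 := fun h0 => by field_simp
  have h4 : -(h / (1 - y₂ : ℂ)) ≠ 0 := neg_ne_zero.mpr (div_ne_zero hhC h1C)
  rw [hz, hm, hi h10, hi h20]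
  generalize -(h / (1 - y₂ : ℂ)) = K at *
  field_simp
  ring

end Parameters

end FMatrixLSS

namespace FMatrixLSS

section Parameters

variable {y₁ y₂ : ℝ}

/-! ### The mean -/

lemma fJouk_def : fJouk y₁ y₂ = jouk (fCenter y₁ y₂) (fRadius y₁ y₂) := rfl

lemma specPoint_eq {ξ : ℂ} (hξ : ‖ξ‖ = 1) : specPoint y₁ y₂ ξ = fJouk y₁ y₂ ξ := by
  rw [fJouk_def, jouk_of_norm_eq_one hξ, specPoint, fCenter, fRadius]
  congr 1
  ring

lemma norm_ratio_lt_one (hy₁ : 0 < y₁) (hy₂ : 0 < y₂) (hy₂' : y₂ < 1) :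
    ‖(y₂ / hPrime y₁ y₂ : ℂ)‖ < 1 := by
  have h := hPrime_pos hy₁ hy₂ hy₂'
  rw [norm_div, norm_real, norm_real, Real.norm_of_nonneg h.le, Real.norm_of_nonneg hy₂.le,
    div_lt_one h]
  exact lt_hPrime hy₁ hy₂ hy₂'

lemma norm_ratio_sq_lt_one (hy₁ : 0 < y₁) (hy₂ : 0 < y₂) (hy₂' : y₂ < 1) :
    ‖(y₂ / hPrime y₁ y₂ ^ 2 : ℂ)‖ < 1 := by
  have h := hPrime_pos hy₁ hy₂ hy₂'
  rw [norm_div, norm_pow, norm_real, norm_real, Real.norm_of_nonneg h.le,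
    Real.norm_of_nonneg hy₂.le, div_lt_one (by positivity)]
  exact lt_sq_hPrime hy₁ hy₂ hy₂'

lemma add_ne_zero_of_norm_lt {a ξ : ℂ} (h : ‖a‖ < ‖ξ‖) : ξ + a ≠ 0 := by
  simpa using ne_of_norm_lt (ξ := -a) (η := ξ) (by rwa [norm_neg])

lemma one_add_mul_ne_zero {a u : ℂ} (ha : ‖a‖ ≤ 1) (hu : ‖u‖ < 1) : 1 + a * u ≠ 0 := by
  refine add_ne_zero_of_norm_lt ?_
  rw [norm_mul, norm_one]
  nlinarith [norm_nonneg a, norm_nonneg u]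

lemma differentiableAt_comp_fJouk {U : Set ℂ} (hU : IsOpen U) {f : ℂ → ℂ}
    (hf : DifferentiableOn ℂ f U) {ξ : ℂ} (hξ : ξ ≠ 0) (hξU : fJouk y₁ y₂ ξ ∈ U) :
    DifferentiableAt ℂ (fun ξ => f (fJouk y₁ y₂ ξ)) ξ :=
  (hf.differentiableAt (hU.mem_nhds hξU)).comp ξ (hasDerivAt_jouk hξ).differentiableAt

/-- Integrals over the support, given by the unit circle, can be moved to a larger circle as long as
no poles are crossed. -/
lemma circleIntegral_specPoint {U : Set ℂ} (hU : IsOpen U) {f : ℂ → ℂ}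
    (hf : DifferentiableOn ℂ f U) {ρ : ℝ} (hρ : 1 ≤ ρ)
    (hρU : ∀ ξ : ℂ, 1 ≤ ‖ξ‖ → ‖ξ‖ ≤ ρ → fJouk y₁ y₂ ξ ∈ U) {G : ℂ → ℂ}
    (hG : ∀ ξ : ℂ, 1 ≤ ‖ξ‖ → DifferentiableAt ℂ G ξ) :
    (∮ ξ in C(0, 1), f (specPoint y₁ y₂ ξ) * G ξ) =
      ∮ ξ in C(0, ρ), f (fJouk y₁ y₂ ξ) * G ξ := by
  rw [← circleIntegral_deform (F := fun ξ => f (fJouk y₁ y₂ ξ) * G ξ) hρ fun ξ h1 h2 =>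
    (differentiableAt_comp_fJouk hU hf (norm_pos_iff.mp (by linarith)) (hρU ξ h1 h2)).fun_mul
      (hG ξ h1)]
  refine circleIntegral.integral_congr zero_le_one fun ξ hξ => ?_
  simp only [specPoint_eq (show ‖ξ‖ = 1 by simpa using hξ)]

/-- The limit `τ ↓ 1` in the mean: after a deformation to a larger circle the poles at `±1/τ` stay
away from the path of integration. -/
lemma tendsto_mean (hy₁ : 0 < y₁) (hy₂ : 0 < y₂) (hy₂' : y₂ < 1) {U : Set ℂ} (hU : IsOpen U)
    {f : ℂ → ℂ} (hf : DifferentiableOn ℂ f U) {ρ : ℝ} (hρ : 1 < ρ)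
    (hρU : ∀ ξ : ℂ, 1 ≤ ‖ξ‖ → ‖ξ‖ ≤ ρ → fJouk y₁ y₂ ξ ∈ U) :
    Tendsto (fun τ : ℝ => ∮ ξ in C(0, 1), f (specPoint y₁ y₂ ξ) *
        (1 / (ξ - 1 / (τ : ℂ)) + 1 / (ξ + 1 / (τ : ℂ))
          - 2 / (ξ + y₂ / (hPrime y₁ y₂ * (τ : ℂ))))) (𝓝[>] 1)
      (𝓝 (∮ ξ in C(0, ρ), f (fJouk y₁ y₂ ξ) *
        (1 / (ξ - 1) + 1 / (ξ + 1) - 2 / (ξ + y₂ / hPrime y₁ y₂)))) := by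
  have hhC : (hPrime y₁ y₂ : ℂ) ≠ 0 := ofReal_ne_zero.mpr (hPrime_pos hy₁ hy₂ hy₂').ne'
  have hc := norm_ratio_lt_one hy₁ hy₂ hy₂'
  -- for `τ ≥ 1` all poles have modulus at most `1/τ`
  have hpoles : ∀ τ : ℝ, 1 ≤ τ → ∀ ξ : ℂ, 1 < ‖ξ‖ ∨ 1 < τ ∧ 1 ≤ ‖ξ‖ →
      ξ - 1 / (τ : ℂ) ≠ 0 ∧ ξ + 1 / (τ : ℂ) ≠ 0 ∧ ξ + y₂ / (hPrime y₁ y₂ * (τ : ℂ)) ≠ 0 := by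
    intro τ hτ ξ hξ
    have hτ0 : 0 < τ := by linarith
    have h1 : ‖(1 / (τ : ℂ))‖ < ‖ξ‖ := by
      rw [norm_div, norm_one, norm_real, Real.norm_of_nonneg hτ0.le, div_lt_iff₀ hτ0]
      rcases hξ with hξ | ⟨h1, h2⟩ <;> nlinarith
    have h2 : ‖(y₂ / (hPrime y₁ y₂ * (τ : ℂ)) : ℂ)‖ < ‖ξ‖ := by
      rw [← div_div, ← mul_one_div, norm_mul]
      have := norm_nonneg (1 / (τ : ℂ))
      nlinarith
    exact ⟨ne_of_norm_lt h1, add_ne_zero_of_norm_lt h1, add_ne_zero_of_norm_lt h2⟩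
  have hlim := tendsto_circleIntegral (ρ := ρ) (by linarith) (F := fun τ ξ =>
    f (fJouk y₁ y₂ ξ) * (1 / (ξ - 1 / (τ : ℂ)) + 1 / (ξ + 1 / (τ : ℂ))
          - 2 / (ξ + y₂ / (hPrime y₁ y₂ * (τ : ℂ))))) ?_
  · simp only [ofReal_one, div_one, mul_one] at hlim
    refine hlim.congr' ?_
    filter_upwards [self_mem_nhdsWithin] with τ hτ
    have hτ1 : 1 < τ := hτ
    refine (circleIntegral_specPoint hU hf hρ.le hρU fun ξ hξ => ?_).symm
    obtain ⟨h1, h2, h3⟩ := hpoles τ hτ1.le ξ (.inr ⟨hτ1, hξ⟩)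
    fun_prop (disch := assumption)
  · rintro ⟨τ, ξ⟩ ⟨hτ, hξ⟩
    have hξn : ‖ξ‖ = ρ := by simpa using hξ
    have hξ1 : 1 < ‖ξ‖ := by rw [hξn]; exact hρ
    obtain ⟨h1, h2, h3⟩ := hpoles τ hτ.1 ξ (.inl hξ1)
    have hτ0 : (τ : ℂ) ≠ 0 := ofReal_ne_zero.mpr (by linarith [hτ.1])
    have h4 := mul_ne_zero hhC hτ0
    have c1 : ContinuousAt (fun p : ℝ × ℂ => f (fJouk y₁ y₂ p.2)) (τ, ξ) :=
      ContinuousAt.comp_of_eq (g := fun ξ => f (fJouk y₁ y₂ ξ))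
        (differentiableAt_comp_fJouk hU hf (ne_zero_of_one_lt_norm hξ1)
          (hρU ξ hξ1.le hξn.le)).continuousAt continuousAt_snd rfl
    simp only [Function.uncurry_def]
    exact ContinuousAt.continuousWithinAt (c1.mul (by fun_prop (disch := assumption)))

/-- `z ↦ G(ξ(z)) ξ'(z)` with `G(η) = (η + c)^{-(n+1)}`: the pole of `G` lies inside the unit disc. -/
lemma integral_pow (hy₁ : 0 < y₁) (hy₂ : 0 < y₂) (hy₂' : y₂ < 1) {U : Set ℂ} (hU : IsOpen U)
    {f : ℂ → ℂ} (hf : DifferentiableOn ℂ f U) {Γ : Loop}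
    (hΓ : Γ.Encloses (fCenter y₁ y₂) (fRadius y₁ y₂) U) {ρ : ℝ} (hρ : 1 < ρ)
    (hρU : ∀ ξ : ℂ, 1 ≤ ‖ξ‖ → ‖ξ‖ ≤ ρ → fJouk y₁ y₂ ξ ∈ U)
    (hlt : ∀ z ∈ Γ.trace, ρ < ‖fInv y₁ y₂ z‖) (n : ℕ) :
    Γ.integral (fun z => f z *
        (1 / (fInv y₁ y₂ z + y₂ / hPrime y₁ y₂) ^ (n + 1) * fInvDeriv y₁ y₂ z)) =
      ∮ η in C(0, ρ), f (fJouk y₁ y₂ η) * (1 / (η + y₂ / hPrime y₁ y₂) ^ (n + 1)) := by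
  have hc := norm_ratio_lt_one hy₁ hy₂ hy₂'
  set c : ℂ := y₂ / hPrime y₁ y₂
  refine hΓ.integral_eq_circleIntegral (fRadius_pos hy₁ hy₂ hy₂') hU hf
    (H := fun u => u ^ n / (1 + c * u) ^ (n + 1)) (G := fun η => 1 / (η + c) ^ (n + 1))
    (fun u hu => ?_) (fun η hη => ?_) hρ hρU hlt
  · have := pow_ne_zero (n + 1) (one_add_mul_ne_zero hc.le (by simpa using hu : ‖u‖ < 1))
    exact DifferentiableAt.differentiableWithinAt (by fun_prop (disch := assumption))
  · have h0 := ne_zero_of_one_lt_norm hη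
    have h1 : η + c ≠ 0 := add_ne_zero_of_norm_lt (hc.trans hη)
    have e : 1 + c * η⁻¹ = (η + c) * η⁻¹ := by field_simp
    rw [e, mul_pow, pow_succ η⁻¹]
    field_simp

/-- The mean as a sum of integrals over a circle in the Joukowski coordinate. -/
theorem limMean_eq (hy₁ : 0 < y₁) (hy₂ : 0 < y₂) (hy₂' : y₂ < 1) (κ βx βy : ℝ) {U : Set ℂ}
    (hU : IsOpen U) {f : ℂ → ℂ} (hf : DifferentiableOn ℂ f U) {γ : ℝ → ℂ} {Γ : Loop}
    (hΓ : Γ.Encloses (fCenter y₁ y₂) (fRadius y₁ y₂) U) (hΓ0 : ∀ z ∈ Γ.trace, z ≠ 0)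
    (hγ : ∀ g, contourIntegral γ g = Γ.integral g) {ρ : ℝ} (hρ : 1 < ρ)
    (hρU : ∀ ξ : ℂ, 1 ≤ ‖ξ‖ → ‖ξ‖ ≤ ρ → fJouk y₁ y₂ ξ ∈ U)
    (hlt : ∀ z ∈ Γ.trace, ρ < ‖fInv y₁ y₂ z‖) :
    limMean κ βx βy y₁ y₂ γ f =
      (κ - 1) / (4 * Real.pi * I) * (∮ ξ in C(0, ρ), f (fJouk y₁ y₂ ξ) *
        (1 / (ξ - 1) + 1 / (ξ + 1) - 2 / (ξ + y₂ / hPrime y₁ y₂)))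
      + βx * y₁ * (1 - y₂) ^ 2 / (2 * Real.pi * I * hPrime y₁ y₂ ^ 2) *
        (∮ ξ in C(0, 1), f (specPoint y₁ y₂ ξ) * (1 / (ξ + y₂ / hPrime y₁ y₂) ^ 3))
      + βy * y₂ * (1 - y₂) / (2 * Real.pi * I * hPrime y₁ y₂) *
        (∮ ξ in C(0, 1), f (specPoint y₁ y₂ ξ) *
          ((ξ + 1 / hPrime y₁ y₂) / (ξ + y₂ / hPrime y₁ y₂) ^ 3)) := by
  have hr := fRadius_pos hy₁ hy₂ hy₂'
  have hhC : (hPrime y₁ y₂ : ℂ) ≠ 0 := ofReal_ne_zero.mpr (hPrime_pos hy₁ hy₂ hy₂').ne'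
  have hπ : (Real.pi : ℂ) ≠ 0 := ofReal_ne_zero.mpr Real.pi_pos.ne'
  have hc := norm_ratio_lt_one hy₁ hy₂ hy₂'
  have hk := norm_ratio_sq_lt_one hy₁ hy₂ hy₂'
  have hoff : ∀ z ∈ Γ.trace, z ∉ contSupport y₁ y₂ := fun z hz => by
    rw [contSupport_eq]; exact hΓ.trace_disjoint z hz
  have hdisc : ∀ u ∈ Metric.ball (0 : ℂ) 1, ‖u‖ < 1 := fun u hu => by simpa using hu
  have hkne : ∀ {u : ℂ}, ‖u‖ < 1 →
      1 + (-(y₂ / hPrime y₁ y₂ ^ 2 : ℂ) * u) * u ≠ 0 := fun {u} hu => by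
    refine one_add_mul_ne_zero ?_ hu
    rw [norm_mul, norm_neg]
    nlinarith [norm_nonneg u, norm_nonneg (y₂ / hPrime y₁ y₂ ^ 2 : ℂ)]
  -- the four contour integrals
  have T1 : contourIntegral γ (fun z => f z *
      logDeriv (fun w => ((1 - y₂) * m0 y₁ y₂ w ^ 2 + 2 * m0 y₁ y₂ w + 1 - y₁) /
        ((1 - y₂) * m0 y₁ y₂ w ^ 2 + 2 * m0 y₁ y₂ w + 1)) z) =
      ∮ η in C(0, ρ), f (fJouk y₁ y₂ η) *
        ((η - 1)⁻¹ + (η + 1)⁻¹ - 2 * η * (η ^ 2 - y₂ / hPrime y₁ y₂ ^ 2)⁻¹) := by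
    rw [hγ]
    refine (Loop.integral_congr fun z hz => ?_).trans (hΓ.integral_eq_circleIntegral hr hU hf
      (H := fun u => (1 + (-1) * u)⁻¹ + (1 + 1 * u)⁻¹ -
        2 * (1 + (-(y₂ / hPrime y₁ y₂ ^ 2 : ℂ) * u) * u)⁻¹)
      (G := fun η => (η - 1)⁻¹ + (η + 1)⁻¹ - 2 * η * (η ^ 2 - y₂ / hPrime y₁ y₂ ^ 2)⁻¹)
      (fun u hu => ?_) (fun η hη => ?_) hρ hρU hlt)
    · simp only [logDeriv_ratio hy₁ hy₂ hy₂' (hoff z hz) (hΓ0 z hz)]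
      rfl
    · have h1 := one_add_mul_ne_zero (a := -1) (by simp) (hdisc u hu)
      have h2 := one_add_mul_ne_zero (a := 1) (by simp) (hdisc u hu)
      have h3 := hkne (hdisc u hu)
      exact DifferentiableAt.differentiableWithinAt (by fun_prop (disch := assumption))
    · have h0 := ne_zero_of_one_lt_norm hη
      have e1 : 1 + (-1) * η⁻¹ = (η - 1) * η⁻¹ := by field_simp; ring
      have e2 : 1 + 1 * η⁻¹ = (η + 1) * η⁻¹ := by field_simp
      have e3 : 1 + (-(y₂ / hPrime y₁ y₂ ^ 2 : ℂ) * η⁻¹) * η⁻¹ =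
          (η ^ 2 - y₂ / hPrime y₁ y₂ ^ 2) * (η ^ 2)⁻¹ := by field_simp; ring
      rw [e1, e2, e3]
      simp only [mul_inv, inv_inv]
      generalize (η - 1)⁻¹ = A
      generalize (η + 1)⁻¹ = B
      generalize (η ^ 2 - y₂ / hPrime y₁ y₂ ^ 2 : ℂ)⁻¹ = C
      field_simp
  have T2 : contourIntegral γ (fun z => f z *
      logDeriv (fun w => 1 - y₂ * m0 y₁ y₂ w ^ 2 / (1 + m0 y₁ y₂ w) ^ 2) z) =
      ∮ η in C(0, ρ), f (fJouk y₁ y₂ η) *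
        (2 * η * (η ^ 2 - y₂ / hPrime y₁ y₂ ^ 2)⁻¹ - 2 * (η + y₂ / hPrime y₁ y₂)⁻¹) := by
    rw [hγ]
    refine (Loop.integral_congr fun z hz => ?_).trans (hΓ.integral_eq_circleIntegral hr hU hf
      (H := fun u => 2 * (1 + (-(y₂ / hPrime y₁ y₂ ^ 2 : ℂ) * u) * u)⁻¹ -
        2 * (1 + (y₂ / hPrime y₁ y₂ : ℂ) * u)⁻¹)
      (G := fun η => 2 * η * (η ^ 2 - y₂ / hPrime y₁ y₂ ^ 2)⁻¹ - 2 * (η + y₂ / hPrime y₁ y₂)⁻¹)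
      (fun u hu => ?_) (fun η hη => ?_) hρ hρU hlt)
    · simp only [logDeriv_factor hy₁ hy₂ hy₂' (hoff z hz) (hΓ0 z hz)]
      rfl
    · have h1 := one_add_mul_ne_zero hc.le (hdisc u hu)
      have h3 := hkne (hdisc u hu)
      exact DifferentiableAt.differentiableWithinAt (by fun_prop (disch := assumption))
    · have h0 := ne_zero_of_one_lt_norm hη
      have e2 : 1 + (y₂ / hPrime y₁ y₂ : ℂ) * η⁻¹ = (η + y₂ / hPrime y₁ y₂) * η⁻¹ := by
        field_simp
      have e3 : 1 + (-(y₂ / hPrime y₁ y₂ ^ 2 : ℂ) * η⁻¹) * η⁻¹ =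
          (η ^ 2 - y₂ / hPrime y₁ y₂ ^ 2) * (η ^ 2)⁻¹ := by field_simp; ring
      rw [e2, e3]
      simp only [mul_inv, inv_inv]
      generalize (η + y₂ / hPrime y₁ y₂ : ℂ)⁻¹ = B
      generalize (η ^ 2 - y₂ / hPrime y₁ y₂ ^ 2 : ℂ)⁻¹ = C
      field_simp
  have T3 : contourIntegral γ (fun z => f z / (1 + m0 y₁ y₂ z) ^ 3 * deriv (m0 y₁ y₂) z) =
      (-((1 - y₂) / hPrime y₁ y₂)) ^ 2 * ∮ η in C(0, ρ), f (fJouk y₁ y₂ η) *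
        (1 / (η + y₂ / hPrime y₁ y₂) ^ 3) := by
    rw [hγ, ← integral_pow hy₁ hy₂ hy₂' hU hf hΓ hρ hρU hlt 2, ← Loop.integral_const_mul]
    refine Loop.integral_congr fun z hz => ?_
    rw [div_eq_mul_inv, mul_assoc, deriv_m0_div_pow hy₁ hy₂ hy₂' (hoff z hz) (hΓ0 z hz) 2]
    ring
  have T4 : contourIntegral γ (fun z =>
      f z * (1 - y₂ * m0 y₁ y₂ z ^ 2 / (1 + m0 y₁ y₂ z) ^ 2) *
      logDeriv (fun w => 1 - y₂ * m0 y₁ y₂ w ^ 2 / (1 + m0 y₁ y₂ w) ^ 2) z) =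
      2 * (y₂ * (1 - y₂) / hPrime y₁ y₂) * ∮ η in C(0, ρ), f (fJouk y₁ y₂ η) *
        ((η + 1 / hPrime y₁ y₂) / (η + y₂ / hPrime y₁ y₂) ^ 3) := by
    rw [hγ]
    refine (Loop.integral_congr fun z hz => ?_).trans ((Loop.integral_const_mul _ _).trans
      (congrArg _ (hΓ.integral_eq_circleIntegral hr hU hf
      (H := fun u => u * (1 + u / hPrime y₁ y₂) / (1 + (y₂ / hPrime y₁ y₂ : ℂ) * u) ^ 3)
      (G := fun η => (η + 1 / hPrime y₁ y₂) / (η + y₂ / hPrime y₁ y₂) ^ 3)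
      (fun u hu => ?_) (fun η hη => ?_) hρ hρU hlt)))
    · simp only [mul_assoc (f z), factor_mul_logDeriv hy₁ hy₂ hy₂' (hoff z hz) (hΓ0 z hz)]
      exact mul_left_comm _ _ _
    · have h1 := pow_ne_zero 3 (one_add_mul_ne_zero hc.le (hdisc u hu))
      exact DifferentiableAt.differentiableWithinAt (by fun_prop (disch := assumption))
    · have h0 := ne_zero_of_one_lt_norm hη
      have h1 := add_ne_zero_of_norm_lt (hc.trans hη)
      have e2 : 1 + (y₂ / hPrime y₁ y₂ : ℂ) * η⁻¹ = (η + y₂ / hPrime y₁ y₂) * η⁻¹ := by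
        field_simp
      rw [e2]
      generalize (η + y₂ / hPrime y₁ y₂ : ℂ) = B at *
      field_simp
  have hdiffc : ∀ ξ : ℂ, 1 ≤ ‖ξ‖ → (ξ + y₂ / hPrime y₁ y₂ : ℂ) ^ 3 ≠ 0 := fun ξ hξ =>
    pow_ne_zero 3 (add_ne_zero_of_norm_lt (hc.trans_le hξ))
  rw [limMean, T1, T2, T3, T4,
    circleIntegral_specPoint hU hf hρ.le hρU (G := fun ξ => 1 / (ξ + y₂ / hPrime y₁ y₂) ^ 3)
      (fun ξ hξ => by have := hdiffc ξ hξ; fun_prop (disch := assumption)),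
    circleIntegral_specPoint hU hf hρ.le hρU
      (G := fun ξ => (ξ + 1 / hPrime y₁ y₂) / (ξ + y₂ / hPrime y₁ y₂) ^ 3)
      (fun ξ hξ => by have := hdiffc ξ hξ; fun_prop (disch := assumption)), ← mul_add,
    ← circleIntegral.integral_add]
  · congr 1
    · congr 1
      · congr 2
        ext ξ
        ring
      · field_simp
    · field_simp
      ring
  all_goals
    refine ContinuousOn.circleIntegrable (by linarith) fun ξ hξ => ?_
    have hξn : ‖ξ‖ = ρ := by simpa using hξ
    have hξ1 : 1 < ‖ξ‖ := by rw [hξn]; exact hρ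
    have c1 := (differentiableAt_comp_fJouk hU hf (ne_zero_of_one_lt_norm hξ1)
          (hρU ξ hξ1.le hξn.le)).continuousAt
    have h1 : ξ - 1 ≠ 0 := ne_of_norm_lt (by rwa [norm_one])
    have h2 : ξ + 1 ≠ 0 := add_ne_zero_of_norm_lt (by rwa [norm_one])
    have h3 : (ξ + y₂ / hPrime y₁ y₂ : ℂ) ≠ 0 := add_ne_zero_of_norm_lt (hc.trans hξ1)
    have h4 : (ξ ^ 2 - y₂ / hPrime y₁ y₂ ^ 2 : ℂ) ≠ 0 := by
      refine ne_of_norm_lt (hk.trans ?_)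
      rw [norm_pow]
      exact one_lt_pow₀ hξ1 two_ne_zero
    exact ContinuousAt.continuousWithinAt (c1.mul (by fun_prop (disch := assumption)))

end Parameters

end FMatrixLSS

namespace FMatrixLSS

section Parameters

variable {y₁ y₂ : ℝ}

/-! ### The covariance -/

lemma continuousOn_circleIntegral {X : Type*} [TopologicalSpace X] [FirstCountableTopology X]
    {S : Set X} {ρ : ℝ} (hρ : 0 ≤ ρ) {Φ : X → ℂ → ℂ}
    (hΦ : ContinuousOn (Function.uncurry Φ) (S ×ˢ Metric.sphere 0 ρ)) :
    ContinuousOn (fun x => ∮ η in C(0, ρ), Φ x η) S := by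
  rw [continuousOn_iff_continuous_domRestrict]
  refine continuous_circleIntegral (X := S) (Φ := fun x => Φ x) ?_
  exact hΦ.comp_continuous (f := fun p : S × ℝ => ((p.1 : X), circleMap 0 ρ p.2))
    ((continuous_subtype_val.comp continuous_fst).prodMk
      ((continuous_circleMap 0 ρ).comp continuous_snd))
    fun p => ⟨p.1.2, circleMap_mem_sphere 0 hρ _⟩

lemma mul_mul_sub_one_ne_zero {τ : ℝ} (hτ : 1 ≤ τ) {ξ η : ℂ} (hξ : 1 ≤ ‖ξ‖) (hη : 1 ≤ ‖η‖)
    (h : 1 < τ ∨ 1 < ‖η‖) : (τ : ℂ) * ξ * η - 1 ≠ 0 := by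
  have hτ0 : 0 < τ := by linarith
  refine ne_of_norm_lt ?_
  rw [norm_one, norm_mul, norm_mul, norm_real, Real.norm_of_nonneg hτ0.le]
  have h1 : 1 ≤ τ * ‖ξ‖ := by nlinarith
  rcases h with h | h <;> nlinarith

/-- The inversion `ξ₁ ↦ 1/ξ₁` replaces the kernel `(ξ₁ - τξ₂)⁻²` by `(τξ₁ξ₂ - 1)⁻²`, which is
holomorphic outside the unit disc in both variables, so that both circles can be enlarged. -/
lemma circleIntegral_cov_deform {U : Set ℂ} (hU : IsOpen U) {f g : ℂ → ℂ}
    (hf : DifferentiableOn ℂ f U) (hg : DifferentiableOn ℂ g U) {ρ : ℝ} (hρ : 1 < ρ)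
    (hρU : ∀ ξ : ℂ, 1 ≤ ‖ξ‖ → ‖ξ‖ ≤ ρ → fJouk y₁ y₂ ξ ∈ U) {τ : ℝ} (hτ : 1 < τ) :
    (∮ ξ₁ in C(0, 1), ∮ ξ₂ in C(0, 1), f (specPoint y₁ y₂ ξ₁) * g (specPoint y₁ y₂ ξ₂) /
        (ξ₁ - (τ : ℂ) * ξ₂) ^ 2) =
      ∮ η in C(0, ρ), ∮ ξ in C(0, ρ), g (fJouk y₁ y₂ η) * (f (fJouk y₁ y₂ ξ) *
        (1 / (τ * ξ * η - 1) ^ 2)) := by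
  have hsph : ∀ {ξ : ℂ}, ξ ∈ Metric.sphere (0 : ℂ) 1 → ‖ξ‖ = 1 := fun h => by simpa using h
  have hne : ∀ {ξ η : ℂ}, 1 ≤ ‖ξ‖ → 1 ≤ ‖η‖ → ((τ : ℂ) * ξ * η - 1) ^ 2 ≠ 0 := fun hξ hη =>
    pow_ne_zero 2 (mul_mul_sub_one_ne_zero hτ.le hξ hη (.inl hτ))
  have hdf : ∀ {ξ : ℂ}, 1 ≤ ‖ξ‖ → ‖ξ‖ ≤ ρ →
      DifferentiableAt ℂ (fun ξ => f (fJouk y₁ y₂ ξ)) ξ := fun h1 h2 =>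
    differentiableAt_comp_fJouk hU hf (norm_pos_iff.mp (by linarith)) (hρU _ h1 h2)
  have hdg : ∀ {ξ : ℂ}, 1 ≤ ‖ξ‖ → ‖ξ‖ ≤ ρ →
      DifferentiableAt ℂ (fun ξ => g (fJouk y₁ y₂ ξ)) ξ := fun h1 h2 =>
    differentiableAt_comp_fJouk hU hg (norm_pos_iff.mp (by linarith)) (hρU _ h1 h2)
  set Φ : ℂ → ℂ → ℂ := fun ξ η => g (fJouk y₁ y₂ η) * (f (fJouk y₁ y₂ ξ) *
        (1 / (τ * ξ * η - 1) ^ 2)) with hΦ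
  calc (∮ ξ₁ in C(0, 1), ∮ ξ₂ in C(0, 1), f (specPoint y₁ y₂ ξ₁) * g (specPoint y₁ y₂ ξ₂) /
        (ξ₁ - (τ : ℂ) * ξ₂) ^ 2)
      = ∮ ξ in C(0, 1), ∮ η in C(0, 1), Φ ξ η := by
        rw [circleIntegral_inversion _ _ one_ne_zero, inv_one]
        refine circleIntegral.integral_congr zero_le_one fun ξ hξ => ?_
        have hξ0 := ne_zero_of_norm_eq_one (hsph hξ)
        have hξi : ‖ξ⁻¹‖ = 1 := by rw [norm_inv, hsph hξ, inv_one]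
        rw [mul_comm, ← circleIntegral.integral_const_mul]
        refine circleIntegral.integral_congr zero_le_one fun η hη => ?_
        have hη0 := hsph hη
        have h1 := hne (hsph hξ).ge hη0.ge
        have e : ξ⁻¹ - (τ : ℂ) * η = -((τ * ξ * η - 1) * ξ⁻¹) := by field_simp; ring
        simp only [hΦ, specPoint_eq hξi, specPoint_eq hη0, e, fJouk_def, jouk_inv]
        rw [neg_sq, mul_pow]
        field_simp
    _ = ∮ ξ in C(0, 1), ∮ η in C(0, ρ), Φ ξ η := by
        refine circleIntegral.integral_congr zero_le_one fun ξ hξ => ?_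
        refine circleIntegral_deform hρ.le fun η h1 h2 => ?_
        have := hne (hsph hξ).ge h1
        exact (hdg h1 h2).fun_mul (by fun_prop (disch := assumption))
    _ = ∮ η in C(0, ρ), ∮ ξ in C(0, 1), Φ ξ η := by
        refine circleIntegral_swap zero_le_one (by linarith) ?_
        rintro ⟨ξ, η⟩ ⟨hξ, hη⟩
        have hξ1 : ‖ξ‖ = 1 := hsph hξ
        have hηρ : ‖η‖ = ρ := by simpa using hη
        have h1 := hne hξ1.ge (hηρ ▸ hρ.le)
        have c1 : ContinuousAt (fun p : ℂ × ℂ => g (fJouk y₁ y₂ p.2)) (ξ, η) :=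
          ContinuousAt.comp_of_eq (g := fun ξ => g (fJouk y₁ y₂ ξ))
            (hdg (hηρ ▸ hρ.le) hηρ.le).continuousAt continuousAt_snd rfl
        have c2 : ContinuousAt (fun p : ℂ × ℂ => f (fJouk y₁ y₂ p.1)) (ξ, η) :=
          ContinuousAt.comp_of_eq (g := fun ξ => f (fJouk y₁ y₂ ξ))
            (hdf hξ1.ge (hξ1 ▸ hρ.le)).continuousAt continuousAt_fst rfl
        exact ContinuousAt.continuousWithinAt
          (c1.mul (c2.mul (by fun_prop (disch := assumption))))
    _ = ∮ η in C(0, ρ), ∮ ξ in C(0, ρ), Φ ξ η := by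
        refine circleIntegral.integral_congr (by linarith) fun η hη => ?_
        have hηρ : ‖η‖ = ρ := by simpa using hη
        refine circleIntegral_deform hρ.le fun ξ h1 h2 => ?_
        have := hne h1 (hηρ ▸ hρ.le)
        exact ((hdf h1 h2).fun_mul (by fun_prop (disch := assumption))).const_mul _

/-- The limit `τ ↓ 1` in the covariance. -/
lemma tendsto_cov {U : Set ℂ} (hU : IsOpen U) {f g : ℂ → ℂ}
    (hf : DifferentiableOn ℂ f U) (hg : DifferentiableOn ℂ g U) {ρ : ℝ} (hρ : 1 < ρ)
    (hρU : ∀ ξ : ℂ, 1 ≤ ‖ξ‖ → ‖ξ‖ ≤ ρ → fJouk y₁ y₂ ξ ∈ U) :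
    Tendsto (fun τ : ℝ => ∮ ξ₁ in C(0, 1), ∮ ξ₂ in C(0, 1),
        f (specPoint y₁ y₂ ξ₁) * g (specPoint y₁ y₂ ξ₂) / (ξ₁ - (τ : ℂ) * ξ₂) ^ 2) (𝓝[>] 1)
      (𝓝 (∮ η in C(0, ρ), ∮ ξ in C(0, ρ), g (fJouk y₁ y₂ η) * (f (fJouk y₁ y₂ ξ) *
        (1 / (ξ * η - 1) ^ 2)))) := by
  have hρ0 : 0 ≤ ρ := by linarith
  have hlim := tendsto_circleIntegral hρ0 (F := fun τ η => ∮ ξ in C(0, ρ),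
    g (fJouk y₁ y₂ η) * (f (fJouk y₁ y₂ ξ) * (1 / (τ * ξ * η - 1) ^ 2))) ?_
  · simp only [ofReal_one, one_mul] at hlim
    refine hlim.congr' ?_
    filter_upwards [self_mem_nhdsWithin] with τ hτ
    exact (circleIntegral_cov_deform hU hf hg hρ hρU hτ).symm
  · refine continuousOn_circleIntegral hρ0 (X := ℝ × ℂ) (Φ := fun x ξ =>
      g (fJouk y₁ y₂ x.2) * (f (fJouk y₁ y₂ ξ) * (1 / (x.1 * ξ * x.2 - 1) ^ 2))) ?_
    rintro ⟨⟨τ, η⟩, ξ⟩ ⟨⟨hτ, hη⟩, hξ⟩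
    have hηρ : ‖η‖ = ρ := by simpa using hη
    have hξρ : ‖ξ‖ = ρ := by simpa using hξ
    have h1 := pow_ne_zero 2 (mul_mul_sub_one_ne_zero hτ.1 (ξ := ξ) (η := η) (hξρ ▸ hρ.le)
      (hηρ ▸ hρ.le) (.inr (hηρ ▸ hρ)))
    have c1 : ContinuousAt (fun p : (ℝ × ℂ) × ℂ => g (fJouk y₁ y₂ p.1.2)) ((τ, η), ξ) :=
      ContinuousAt.comp_of_eq (g := fun ξ => g (fJouk y₁ y₂ ξ))
        (differentiableAt_comp_fJouk hU hg (ne_zero_of_one_lt_norm (hηρ ▸ hρ))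
          (hρU _ (hηρ ▸ hρ.le) hηρ.le)).continuousAt (by fun_prop) rfl
    have c2 : ContinuousAt (fun p : (ℝ × ℂ) × ℂ => f (fJouk y₁ y₂ p.2)) ((τ, η), ξ) :=
      ContinuousAt.comp_of_eq (g := fun ξ => f (fJouk y₁ y₂ ξ))
        (differentiableAt_comp_fJouk hU hf (ne_zero_of_one_lt_norm (hξρ ▸ hρ))
          (hρU _ (hξρ ▸ hρ.le) hξρ.le)).continuousAt continuousAt_snd rfl
    exact ContinuousAt.continuousWithinAt (c1.mul (c2.mul (by fun_prop (disch := assumption))))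

/-- The regular part of the covariance kernel, integrated over one contour. -/
lemma integral_regular (hy₁ : 0 < y₁) (hy₂ : 0 < y₂) (hy₂' : y₂ < 1) {U : Set ℂ} (hU : IsOpen U)
    {f : ℂ → ℂ} (hf : DifferentiableOn ℂ f U) {Γ : Loop}
    (hΓ : Γ.Encloses (fCenter y₁ y₂) (fRadius y₁ y₂) U) {ρ : ℝ} (hρ : 1 < ρ)
    (hρU : ∀ ξ : ℂ, 1 ≤ ‖ξ‖ → ‖ξ‖ ≤ ρ → fJouk y₁ y₂ ξ ∈ U)
    (hlt : ∀ z ∈ Γ.trace, ρ < ‖fInv y₁ y₂ z‖) {ζ : ℂ} (hζ : 1 < ‖ζ‖) :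
    Γ.integral (fun z => f z * (1 / (fInv y₁ y₂ z * ζ - 1) ^ 2 * fInvDeriv y₁ y₂ z)) =
      ∮ ξ in C(0, ρ), f (fJouk y₁ y₂ ξ) * (1 / (ξ * ζ - 1) ^ 2) := by
  refine hΓ.integral_eq_circleIntegral (fRadius_pos hy₁ hy₂ hy₂') hU hf
    (H := fun u => u / (ζ - u) ^ 2) (G := fun ξ => 1 / (ξ * ζ - 1) ^ 2)
    (fun u hu => ?_) (fun ξ hξ => ?_) hρ hρU hlt
  · have hu' : ‖u‖ < 1 := by simpa using hu
    have := pow_ne_zero 2 (ne_of_norm_lt (hu'.trans hζ))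
    exact DifferentiableAt.differentiableWithinAt (by fun_prop (disch := assumption))
  · have h0 := ne_zero_of_one_lt_norm hξ
    have h1 : ξ * ζ - 1 ≠ 0 := mul_sub_one_ne_zero hξ hζ.le
    have e : ζ - ξ⁻¹ = (ξ * ζ - 1) * ξ⁻¹ := by field_simp
    rw [e, mul_pow]
    field_simp

/-- The main part of the covariance. The square of the Cauchy kernel contributes
`∮ f g' dz` times the index of one contour about the points of the other; the index is constant,
so this contribution vanishes by Cauchy's theorem, whatever the position of the two contours. -/
theorem integral_cov (hy₁ : 0 < y₁) (hy₂ : 0 < y₂) (hy₂' : y₂ < 1) {U : Set ℂ} (hU : IsOpen U)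
    {f g : ℂ → ℂ} (hf : DifferentiableOn ℂ f U) (hg : DifferentiableOn ℂ g U) {Γ₁ Γ₂ : Loop}
    (hΓ₁ : Γ₁.Encloses (fCenter y₁ y₂) (fRadius y₁ y₂) U)
    (hΓ₂ : Γ₂.Encloses (fCenter y₁ y₂) (fRadius y₁ y₂) U)
    (h₁0 : ∀ z ∈ Γ₁.trace, z ≠ 0) (h₂0 : ∀ z ∈ Γ₂.trace, z ≠ 0)
    (hdisj : Disjoint Γ₁.trace Γ₂.trace) {ρ : ℝ} (hρ : 1 < ρ)
    (hρU : ∀ ξ : ℂ, 1 ≤ ‖ξ‖ → ‖ξ‖ ≤ ρ → fJouk y₁ y₂ ξ ∈ U)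
    (hlt₁ : ∀ z ∈ Γ₁.trace, ρ < ‖fInv y₁ y₂ z‖) (hlt₂ : ∀ z ∈ Γ₂.trace, ρ < ‖fInv y₁ y₂ z‖) :
    (Γ₁.integral fun z₁ => Γ₂.integral fun z₂ =>
      f z₁ * g z₂ / (m0 y₁ y₂ z₁ - m0 y₁ y₂ z₂) ^ 2 *
        deriv (m0 y₁ y₂) z₁ * deriv (m0 y₁ y₂) z₂) =
      ∮ η in C(0, ρ), ∮ ξ in C(0, ρ), g (fJouk y₁ y₂ η) * (f (fJouk y₁ y₂ ξ) *
        (1 / (ξ * η - 1) ^ 2)) := by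
  have hr := fRadius_pos hy₁ hy₂ hy₂'
  have hρ0 : 0 ≤ ρ := by linarith
  have hoff₁ : ∀ z ∈ Γ₁.trace, z ∉ contSupport y₁ y₂ := fun z hz => by
    rw [contSupport_eq]; exact hΓ₁.trace_disjoint z hz
  have hoff₂ : ∀ z ∈ Γ₂.trace, z ∉ contSupport y₁ y₂ := fun z hz => by
    rw [contSupport_eq]; exact hΓ₂.trace_disjoint z hz
  have hnot : ∀ z ∈ Γ₁.trace, z ∉ Γ₂.trace := fun z hz hz' => disjoint_left.mp hdisj hz hz'
  have hξ₁ : ∀ z ∈ Γ₁.trace, 1 < ‖fInv y₁ y₂ z‖ := fun z hz => hρ.trans (hlt₁ z hz)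
  have hξ₂ : ∀ z ∈ Γ₂.trace, 1 < ‖fInv y₁ y₂ z‖ := fun z hz => hρ.trans (hlt₂ z hz)
  have cξ₁ : ContinuousOn (fInv y₁ y₂) Γ₁.trace := hΓ₁.continuousOn_joukInv hr
  have cξ₂ : ContinuousOn (fInv y₁ y₂) Γ₂.trace := hΓ₂.continuousOn_joukInv hr
  have cD₁ : ContinuousOn (fInvDeriv y₁ y₂) Γ₁.trace := hΓ₁.continuousOn_joukInvDeriv hr
  have cD₂ : ContinuousOn (fInvDeriv y₁ y₂) Γ₂.trace := hΓ₂.continuousOn_joukInvDeriv hr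
  have cf : ContinuousOn f Γ₁.trace := hf.continuousOn.mono hΓ₁.trace_subset
  have cg : ContinuousOn g Γ₂.trace := hg.continuousOn.mono hΓ₂.trace_subset
  set N := Γ₂.index (Γ₁.pt 0) with hN
  have hindex : ∀ z ∈ Γ₁.trace, Γ₂.index z = N := fun z hz =>
    Loop.index_eq_of_isPreconnected Loop.isPreconnected_trace hnot hz (Loop.pt_mem 0)
  set Φ : ℂ → ℂ → ℂ := fun z η => g (fJouk y₁ y₂ η) *
    (f z * (1 / (fInv y₁ y₂ z * η - 1) ^ 2 * fInvDeriv y₁ y₂ z)) with hΦ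
  have cΦ : ContinuousOn (Function.uncurry Φ) (Γ₁.trace ×ˢ Metric.sphere 0 ρ) := by
    have hfst : MapsTo Prod.fst (Γ₁.trace ×ˢ Metric.sphere (0 : ℂ) ρ) Γ₁.trace := fun p hp => hp.1
    have cgJ : ContinuousOn (fun p : ℂ × ℂ => g (fJouk y₁ y₂ p.2))
        (Γ₁.trace ×ˢ Metric.sphere 0 ρ) := by
      rintro ⟨z, η⟩ ⟨-, hη⟩
      have hηρ : ‖η‖ = ρ := by simpa using hη
      exact ContinuousAt.continuousWithinAt <|
        ContinuousAt.comp_of_eq (g := fun ξ => g (fJouk y₁ y₂ ξ))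
        (differentiableAt_comp_fJouk hU hg (ne_zero_of_one_lt_norm (hηρ ▸ hρ))
          (hρU _ (hηρ ▸ hρ.le) hηρ.le)).continuousAt continuousAt_snd rfl
    have cK : ContinuousOn (fun p : ℂ × ℂ => 1 / (fInv y₁ y₂ p.1 * p.2 - 1) ^ 2)
        (Γ₁.trace ×ˢ Metric.sphere 0 ρ) := by
      refine continuousOn_const.div ((((cξ₁.comp continuousOn_fst hfst).mul
        continuousOn_snd).sub continuousOn_const).pow 2) ?_
      rintro ⟨z, η⟩ ⟨hz, hη⟩
      have hηρ : ‖η‖ = ρ := by simpa using hη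
      exact pow_ne_zero 2 (mul_sub_one_ne_zero (hξ₁ z hz) (hηρ ▸ hρ.le))
    exact cgJ.mul ((cf.comp continuousOn_fst hfst).mul
      (cK.mul (cD₁.comp continuousOn_fst hfst)))
  have hinner : ∀ z₁ ∈ Γ₁.trace, (Γ₂.integral fun z₂ =>
      f z₁ * g z₂ / (m0 y₁ y₂ z₁ - m0 y₁ y₂ z₂) ^ 2 *
        deriv (m0 y₁ y₂) z₁ * deriv (m0 y₁ y₂) z₂) =
      N * (f z₁ * deriv g z₁) + ∮ η in C(0, ρ), Φ z₁ η := by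
    intro z₁ hz₁
    have hz₁' := hnot z₁ hz₁
    have c1 : ContinuousOn (fun z₂ => f z₁ * (g z₂ * ((z₂ - z₁) ^ 2)⁻¹)) Γ₂.trace :=
      continuousOn_const.mul (cg.mul (Loop.continuousOn_inv_sub_sq hz₁'))
    have c2 : ContinuousOn (fun z₂ => f z₁ * fInvDeriv y₁ y₂ z₁ * (g z₂ *
        (1 / (fInv y₁ y₂ z₂ * fInv y₁ y₂ z₁ - 1) ^ 2 * fInvDeriv y₁ y₂ z₂))) Γ₂.trace := by
      refine continuousOn_const.mul (cg.mul (ContinuousOn.mul ?_ cD₂))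
      refine continuousOn_const.div (((cξ₂.mul continuousOn_const).sub
        continuousOn_const).pow 2) fun z₂ hz₂ => ?_
      exact pow_ne_zero 2 (mul_sub_one_ne_zero (hξ₂ z₂ hz₂) (hξ₁ z₁ hz₁).le)
    have hcongr : (Γ₂.integral fun z₂ =>
        f z₁ * g z₂ / (m0 y₁ y₂ z₁ - m0 y₁ y₂ z₂) ^ 2 *
          deriv (m0 y₁ y₂) z₁ * deriv (m0 y₁ y₂) z₂) =
        Γ₂.integral fun z₂ => f z₁ * (g z₂ * ((z₂ - z₁) ^ 2)⁻¹) +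
          f z₁ * fInvDeriv y₁ y₂ z₁ * (g z₂ *
            (1 / (fInv y₁ y₂ z₂ * fInv y₁ y₂ z₁ - 1) ^ 2 * fInvDeriv y₁ y₂ z₂)) := by
      refine Loop.integral_congr fun z₂ hz₂ => ?_
      have hk := covariance_kernel hy₁ hy₂ hy₂' (hoff₁ z₁ hz₁) (h₁0 z₁ hz₁) (hoff₂ z₂ hz₂)
        (h₂0 z₂ hz₂) (fun h => hz₁' (h ▸ hz₂))
      rw [div_eq_mul_inv, mul_assoc (f z₁ * g z₂), mul_assoc (f z₁ * g z₂), hk,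
        mul_comm (fInv y₁ y₂ z₁)]
      ring
    rw [hcongr, Loop.integral_add c1 c2, Loop.integral_const_mul, Loop.integral_const_mul,
      Loop.cauchy_formula_deriv hU hg hΓ₂.trace_subset hΓ₂.index_outside
        (hΓ₁.trace_subset hz₁) hz₁', hindex z₁ hz₁,
      integral_regular hy₁ hy₂ hy₂' hU hg hΓ₂ hρ hρU hlt₂ (hξ₁ z₁ hz₁)]
    congr 1
    · ring
    · rw [← circleIntegral.integral_const_mul]
      congr 1
      ext η
      simp only [hΦ]
      rw [mul_comm η]
      ring
  have c3 : ContinuousOn (fun z => N * (f z * deriv g z)) Γ₁.trace :=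
    continuousOn_const.mul (cf.mul ((hg.deriv hU).continuousOn.mono hΓ₁.trace_subset))
  have c4 := continuousOn_circleIntegral hρ0 cΦ
  obtain ⟨w, hwU, hwΓ⟩ : ∃ w ∈ U, w ∉ Γ₁.trace :=
    ⟨fJouk y₁ y₂ 1, hρU 1 (by simp) (by simpa using hρ.le),
      hΓ₁.jouk_notMem_trace hr hlt₁ (by simp) (by simpa using hρ.le)⟩
  rw [Loop.integral_congr hinner, Loop.integral_add c3 c4, Loop.integral_const_mul,
    Loop.integral_eq_zero hU (hf.fun_mul (hg.deriv hU)) hΓ₁.trace_subset hΓ₁.index_outside hwU hwΓ,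
    mul_zero, zero_add, Loop.integral_circleIntegral_swap hρ0 cΦ]
  refine circleIntegral.integral_congr hρ0 fun η hη => ?_
  have hηρ : ‖η‖ = ρ := by simpa using hη
  simp only [hΦ, Loop.integral_const_mul, circleIntegral.integral_const_mul]
  rw [integral_regular hy₁ hy₂ hy₂' hU hf hΓ₁ hρ hρU hlt₁ (hηρ ▸ hρ)]

/-- The factors of the fourth-moment part of the covariance. -/
lemma integral_fourthMoment (hy₁ : 0 < y₁) (hy₂ : 0 < y₂) (hy₂' : y₂ < 1) {U : Set ℂ}
    (hU : IsOpen U) {f : ℂ → ℂ} (hf : DifferentiableOn ℂ f U) {Γ : Loop}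
    (hΓ : Γ.Encloses (fCenter y₁ y₂) (fRadius y₁ y₂) U) (hΓ0 : ∀ z ∈ Γ.trace, z ≠ 0) {ρ : ℝ}
    (hρ : 1 < ρ) (hρU : ∀ ξ : ℂ, 1 ≤ ‖ξ‖ → ‖ξ‖ ≤ ρ → fJouk y₁ y₂ ξ ∈ U)
    (hlt : ∀ z ∈ Γ.trace, ρ < ‖fInv y₁ y₂ z‖) :
    Γ.integral (fun z => f z * (((1 + m0 y₁ y₂ z) ^ 2)⁻¹ * deriv (m0 y₁ y₂) z)) =
      -((1 - y₂) / hPrime y₁ y₂) *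
        ∮ ξ in C(0, 1), f (specPoint y₁ y₂ ξ) / (ξ + y₂ / hPrime y₁ y₂) ^ 2 := by
  have hc := norm_ratio_lt_one hy₁ hy₂ hy₂'
  have hsp := circleIntegral_specPoint hU hf hρ.le hρU
    (G := fun ξ => 1 / (ξ + y₂ / hPrime y₁ y₂ : ℂ) ^ 2) (fun ξ hξ => by
      have := pow_ne_zero 2 (add_ne_zero_of_norm_lt (hc.trans_le hξ))
      fun_prop (disch := assumption))
  simp only [mul_one_div] at hsp
  have hpow := integral_pow hy₁ hy₂ hy₂' hU hf hΓ hρ hρU hlt 1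
  simp only [mul_one_div, Nat.reduceAdd] at hpow
  rw [hsp, ← hpow, ← Loop.integral_const_mul]
  refine Loop.integral_congr fun z hz => ?_
  have hoff : z ∉ contSupport y₁ y₂ := by rw [contSupport_eq]; exact hΓ.trace_disjoint z hz
  rw [deriv_m0_div_pow hy₁ hy₂ hy₂' hoff (hΓ0 z hz) 1]
  ring

/-- A circle in the Joukowski coordinate that lies between the slit and both of two given curves. -/
lemma exists_common_radius (hy₁ : 0 < y₁) (hy₂ : 0 < y₂) (hy₂' : y₂ < 1) {U : Set ℂ}
    (hU : IsOpen U) (hKU : contSupport y₁ y₂ ⊆ U) {Γ₁ Γ₂ : Loop}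
    (hΓ₁ : Γ₁.Encloses (fCenter y₁ y₂) (fRadius y₁ y₂) U)
    (hΓ₂ : Γ₂.Encloses (fCenter y₁ y₂) (fRadius y₁ y₂) U) :
    ∃ ρ > 1, (∀ ξ : ℂ, 1 ≤ ‖ξ‖ → ‖ξ‖ ≤ ρ → fJouk y₁ y₂ ξ ∈ U) ∧
      (∀ z ∈ Γ₁.trace, ρ < ‖fInv y₁ y₂ z‖) ∧ ∀ z ∈ Γ₂.trace, ρ < ‖fInv y₁ y₂ z‖ := by
  have hr := fRadius_pos hy₁ hy₂ hy₂'
  obtain ⟨a, ha, ha'⟩ := exists_radius hr hU (contSupport_eq ▸ hKU)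
  obtain ⟨b, hb, hb'⟩ := hΓ₁.exists_lt_norm hr
  obtain ⟨d, hd, hd'⟩ := hΓ₂.exists_lt_norm hr
  obtain ⟨ρ, hρ, hρ'⟩ := exists_between (lt_min ha (lt_min hb hd))
  rw [lt_min_iff, lt_min_iff] at hρ'
  exact ⟨ρ, hρ, ha' ρ hρ'.1, hb' ρ hρ'.2.1, hd' ρ hρ'.2.2⟩

end Parameters

end FMatrixLSS

end

theorem mainTheorem2 (κ βx βy y₁ y₂ : ℝ) (hy₁ : 0 < y₁) (hy₂ : 0 < y₂) (hy₂' : y₂ < 1)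
    (U : Set ℂ) (hU : IsOpen U) (hKU : FMatrixLSS.contSupport y₁ y₂ ⊆ U)
    (s : ℕ) (f : Fin s → ℂ → ℂ) (hf : ∀ j, AnalyticOnNhd ℂ (f j) U) :
    (∀ j : Fin s, ∃ L : ℂ,
      Tendsto (fun τ : ℝ => ((κ : ℂ) - 1) / (4 * Real.pi * I) *
          ∮ ξ in C(0, 1), f j (FMatrixLSS.specPoint y₁ y₂ ξ) *
            (1 / (ξ - 1 / (τ : ℂ)) + 1 / (ξ + 1 / (τ : ℂ))
              - 2 / (ξ + y₂ / (FMatrixLSS.hPrime y₁ y₂ * (τ : ℂ)))))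
        (𝓝[>] 1) (𝓝 L) ∧
      ∀ γ : ℝ → ℂ, FMatrixLSS.IsContour y₁ y₂ U γ →
        FMatrixLSS.limMean κ βx βy y₁ y₂ γ (f j) =
          L
          + βx * y₁ * (1 - y₂) ^ 2 / (2 * Real.pi * I * FMatrixLSS.hPrime y₁ y₂ ^ 2) *
            (∮ ξ in C(0, 1), f j (FMatrixLSS.specPoint y₁ y₂ ξ) *
              (1 / (ξ + y₂ / FMatrixLSS.hPrime y₁ y₂) ^ 3))
          + βy * y₂ * (1 - y₂) / (2 * Real.pi * I * FMatrixLSS.hPrime y₁ y₂) *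
            (∮ ξ in C(0, 1), f j (FMatrixLSS.specPoint y₁ y₂ ξ) *
              ((ξ + 1 / FMatrixLSS.hPrime y₁ y₂) /
                (ξ + y₂ / FMatrixLSS.hPrime y₁ y₂) ^ 3))) ∧
    (∀ j l : Fin s, ∃ L : ℂ,
      Tendsto (fun τ : ℝ => (κ : ℂ) / (4 * Real.pi ^ 2) *
          ∮ ξ₁ in C(0, 1), ∮ ξ₂ in C(0, 1),
            f j (FMatrixLSS.specPoint y₁ y₂ ξ₁) * f l (FMatrixLSS.specPoint y₁ y₂ ξ₂) /
              (ξ₁ - (τ : ℂ) * ξ₂) ^ 2)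
        (𝓝[>] 1) (𝓝 L) ∧
      ∀ γ₁ γ₂ : ℝ → ℂ, FMatrixLSS.IsContour y₁ y₂ U γ₁ → FMatrixLSS.IsContour y₁ y₂ U γ₂ →
        Disjoint (γ₁ '' Icc 0 1) (γ₂ '' Icc 0 1) →
        FMatrixLSS.limCov κ βx βy y₁ y₂ γ₁ γ₂ (f j) (f l) =
          -L
          - (βx * y₁ + βy * y₂) * (1 - y₂) ^ 2 /
              (4 * Real.pi ^ 2 * FMatrixLSS.hPrime y₁ y₂ ^ 2) *
            (∮ ξ₁ in C(0, 1), f j (FMatrixLSS.specPoint y₁ y₂ ξ₁) /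
              (ξ₁ + y₂ / FMatrixLSS.hPrime y₁ y₂) ^ 2) *
            (∮ ξ₂ in C(0, 1), f l (FMatrixLSS.specPoint y₁ y₂ ξ₂) /
              (ξ₂ + y₂ / FMatrixLSS.hPrime y₁ y₂) ^ 2)) := by
  have hr := FMatrixLSS.fRadius_pos hy₁ hy₂ hy₂'
  have hd : ∀ j, DifferentiableOn ℂ (f j) U := fun j => (hf j).differentiableOn
  obtain ⟨ρ₀, hρ₀, hρ₀U⟩ := FMatrixLSS.exists_radius hr hU (FMatrixLSS.contSupport_eq ▸ hKU)
  obtain ⟨ρ, hρ, hρ'⟩ := exists_between hρ₀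
  have hρU : ∀ ξ : ℂ, 1 ≤ ‖ξ‖ → ‖ξ‖ ≤ ρ → FMatrixLSS.fJouk y₁ y₂ ξ ∈ U := hρ₀U ρ hρ'
  refine ⟨fun j => ?_, fun j l => ?_⟩
  · have hlim := fun {ρ : ℝ} (h1 : 1 < ρ)
      (h2 : ∀ ξ : ℂ, 1 ≤ ‖ξ‖ → ‖ξ‖ ≤ ρ → FMatrixLSS.fJouk y₁ y₂ ξ ∈ U) =>
      (FMatrixLSS.tendsto_mean hy₁ hy₂ hy₂' hU (hd j) h1 h2).const_mul
        (((κ : ℂ) - 1) / (4 * Real.pi * I))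
    refine ⟨_, hlim hρ hρU, fun γ hγ => ?_⟩
    obtain ⟨Γ, hΓ, -, hΓ0, hint⟩ := hγ.exists_encloses
    obtain ⟨σ, hσ, hσU, hlt, -⟩ :=
      FMatrixLSS.exists_common_radius hy₁ hy₂ hy₂' hU hKU hΓ hΓ
    -- the value of the limit does not depend on the radius of the auxiliary circle
    rw [tendsto_nhds_unique (hlim hρ hρU) (hlim hσ hσU)]
    exact FMatrixLSS.limMean_eq hy₁ hy₂ hy₂' κ βx βy hU (hd j) hΓ hΓ0 hint hσ hσU hlt
  · have hlim := fun {ρ : ℝ} (h1 : 1 < ρ)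
      (h2 : ∀ ξ : ℂ, 1 ≤ ‖ξ‖ → ‖ξ‖ ≤ ρ → FMatrixLSS.fJouk y₁ y₂ ξ ∈ U) =>
      (FMatrixLSS.tendsto_cov hU (hd j) (hd l) h1 h2).const_mul ((κ : ℂ) / (4 * Real.pi ^ 2))
    refine ⟨_, hlim hρ hρU, fun γ₁ γ₂ hγ₁ hγ₂ hdisj => ?_⟩
    obtain ⟨Γ₁, hΓ₁, htr₁, h₁0, hint₁⟩ := hγ₁.exists_encloses
    obtain ⟨Γ₂, hΓ₂, htr₂, h₂0, hint₂⟩ := hγ₂.exists_encloses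
    rw [← htr₁, ← htr₂] at hdisj
    obtain ⟨σ, hσ, hσU, hlt₁, hlt₂⟩ :=
      FMatrixLSS.exists_common_radius hy₁ hy₂ hy₂' hU hKU hΓ₁ hΓ₂
    rw [tendsto_nhds_unique (hlim hρ hρU) (hlim hσ hσU), FMatrixLSS.limCov]
    simp only [hint₁, hint₂]
    rw [FMatrixLSS.integral_cov hy₁ hy₂ hy₂' hU (hd j) (hd l) hΓ₁ hΓ₂ h₁0 h₂0 hdisj hσ hσU
      hlt₁ hlt₂]
    have hprod : (Γ₁.integral fun z₁ => Γ₂.integral fun z₂ =>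
        f j z₁ * f l z₂ / ((1 + FMatrixLSS.m0 y₁ y₂ z₁) ^ 2 *
          (1 + FMatrixLSS.m0 y₁ y₂ z₂) ^ 2) *
          deriv (FMatrixLSS.m0 y₁ y₂) z₁ * deriv (FMatrixLSS.m0 y₁ y₂) z₂) =
        Γ₂.integral (fun z₂ => f l z₂ * (((1 + FMatrixLSS.m0 y₁ y₂ z₂) ^ 2)⁻¹ *
          deriv (FMatrixLSS.m0 y₁ y₂) z₂)) *
        Γ₁.integral (fun z₁ => f j z₁ * (((1 + FMatrixLSS.m0 y₁ y₂ z₁) ^ 2)⁻¹ *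
          deriv (FMatrixLSS.m0 y₁ y₂) z₁)) := by
      rw [← FMatrixLSS.Loop.integral_const_mul]
      refine FMatrixLSS.Loop.integral_congr fun z₁ _ => ?_
      rw [mul_comm, ← FMatrixLSS.Loop.integral_const_mul]
      refine FMatrixLSS.Loop.integral_congr fun z₂ _ => ?_
      rw [div_eq_mul_inv, mul_inv]
      ring
    rw [hprod, FMatrixLSS.integral_fourthMoment hy₁ hy₂ hy₂' hU (hd j) hΓ₁ h₁0 hσ hσU hlt₁,
      FMatrixLSS.integral_fourthMoment hy₁ hy₂ hy₂' hU (hd l) hΓ₂ h₂0 hσ hσU hlt₂]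
    have hhC : (FMatrixLSS.hPrime y₁ y₂ : ℂ) ≠ 0 :=
      ofReal_ne_zero.mpr (FMatrixLSS.hPrime_pos hy₁ hy₂ hy₂').ne'
    have hπ : (Real.pi : ℂ) ≠ 0 := ofReal_ne_zero.mpr Real.pi_pos.ne'
    field_simp
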